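/- Let $d>10$ and let $Z$ be a random variable with values in $\{0,1,2,\dots\}$ such that $\mathbf E[Z]=1$, $\mathbf P[Z=1]\neq 1$ and $\mathbf E[Z^2]<\infty$. Let $\tilde Z$ be its size-biased version, $\mathbf P[\tilde Z=k]=k\,\mathbf P[Z=k]$. **Model.** The bi-infinite critical Galton–Watson tree is the random tree obtained from a bi-infinite path of vertices $(v_n)_{n\in\mathbb Z}$ (the backbone, with root $v_0$) by giving each $v_n$ a further $\tilde Z-1$ children off the backbone, each of which starts an ordinary Galton–Watson tree with offspring law $Z$, all numbers of offspring being independent. Let $T_n$ be the tree that hangs from $v_n$ (with root $v_n$, without the other backbone vertices). Embed the whole tree in $\mathbb Z^d$ by sending $v_0$ to $0$ and assigning to the edges independent jumps that are uniform on the $2d$ unit vectors $\pm e_i$; let $\alpha(n)\in\mathbb Z^d$ be the image of $v_n$ and $\mathcal B_n\subset\mathbb Z^d$ the image of the vertex set of $T_n$. Let $\omega$ be the subgraph of $\mathbb Z^d$ formed by the images of the vertices and edges of the tree, let $d_\omega$ be its graph distance and $R_{\rm eff}$ the effective resistance in $\omega$ when every edge has resistance $1$ (that is, $R_{\rm eff}(x,y)^{-1}$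 is the infimum, over functions $f$ on the vertices of $\omega$ with $f(x)=1$ and $f(y)=0$, of the sum over the edges $\{u,v\}$ of $\omega$ of $(f(u)-f(v))^2$). Write $\mathbf P^{-\infty,\infty}$ for the law of this model and $\mathbf E^{-\infty,\infty}$ for its expectation. The point $\alpha(i)$ is called pivotal if $\bigl(\bigcup_{n\le i}\mathcal B_n\bigr)\cap\bigl(\bigcup_{n\ge i+1}\mathcal B_n\bigr)=\emptyset$, and $\gamma_1$ denotes the smallest $n\ge 1$ such that $\alpha(n)$ is pivotal. **Claim.** One has $\mathbf P^{-\infty,\infty}[0\text{ is pivotal}]>0$ (where "$0$ is pivotal" means that $\alpha(0)$ is pivotal), $\gamma_1$ exists $\mathbf P^{-\infty,\infty}$-almost surely, and $\gamma_1$, $R_{\rm eff}(0,\alpha(\gamma_1))$ and $d_\omega(0,\alpha(\gamma_1))$ are integrable under $\mathbf P^{-\infty,\infty}[\,\cdot\mid 0\text{ is pivotal}]$, so that the constants $$\rho_1=\frac{\mathbf E^{-\infty,\infty}[R_{\rm eff}(0,\alpha(\gamma_1))\mid 0\text{ is pivotal}]}{\mathbf E^{-\infty,\infty}[\gamma_1\mid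 0\text{ is pivotal}]},\qquad \rho_2=\frac{\mathbf E^{-\infty,\infty}[d_{\omega}(0,\alpha(\gamma_1))\mid 0\text{ is pivotal}]}{\mathbf E^{-\infty,\infty}[\gamma_1\mid 0\text{ is pivotal}]}$$ are well defined. Moreover, $\mathbf P^{-\infty,\infty}$-almost surely, $$\lim_{n\to\infty}\frac{R_{\rm eff}(0,\alpha(n))}{n}=\rho_1\qquad\text{and}\qquad \lim_{n\to\infty}\frac{d_\omega(0,\alpha(n))}{n}=\rho_2 .$$ -/

import Mathlib

open MeasureTheory Filter Topology
open scoped ENNReal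

namespace BRW

noncomputable section

/-! ### Effective resistance of a graph with unit resistances -/

/-- Dirichlet energy of `f` on the graph `G` with unit conductances: the sum over the edges `{x, y}`
of `(f x - f y) ^ 2` (every edge carries two darts). -/
def dirichletEnergy {V : Type*} (G : SimpleGraph V) (f : V → ℝ) : ℝ≥0∞ :=
  2⁻¹ * ∑' e : G.Dart, ENNReal.ofReal ((f e.fst - f e.snd) ^ 2)

/-- Effective resistance between `x` and `y` when every edge of `G` has resistance `1`: the inverse
of the smallest Dirichlet energy of a potential with value `1` at `x` and `0` at `y`. It is `0` if
`x = y` and `∞` if `x` and `y` are not connected. -/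
def effectiveResistance {V : Type*} (G : SimpleGraph V) (x y : V) : ℝ≥0∞ :=
  (⨅ (f : V → ℝ) (_ : f x = 1 ∧ f y = 0), dirichletEnergy G f)⁻¹

/-! ### The probability space of the bi-infinite critical branching random walk -/

/-- The size-biased version of a law `p` on `ℕ` with mean one: it gives mass `k * p k` to `k`. -/
def sizeBiased (p : PMF ℕ) (hp : ∑' k : ℕ, (k : ℝ≥0∞) * p k = 1) : PMF ℕ :=
  ⟨fun k => (k : ℝ≥0∞) * p k, hp ▸ ENNReal.summable.hasSum⟩

/-- The law of the number of ordinary (off-backbone) children of the vertex with label `u` in a tree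
hanging from the backbone. The root `[]` is a backbone vertex, and has `Z̃ - 1` ordinary
children, where `Z̃` is the size-biased version of `Z`; all the other vertices have `Z` children. -/
def childrenLaw (p : PMF ℕ) (hp : ∑' k : ℕ, (k : ℝ≥0∞) * p k = 1) : List ℕ → PMF ℕ
  | [] => (sizeBiased p hp).map (fun k => k - 1)
  | _ :: _ => p

/-- The `2 * d` directions of the edges of `ℤ ^ d`: `(i, true)` is `e i` and `(i, false)` is
`-e i`. -/
abbrev Direction (d : ℕ) : Type := Fin d × Bool

/-- The unit vector of `ℤ ^ d` in a given direction. -/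
def Direction.vec {d : ℕ} (e : Direction d) : Fin d → ℤ :=
  Pi.single e.1 (if e.2 then 1 else -1)

/-- Samples. To the potential vertex `(n, u)`, where `n : ℤ` is a time on the backbone and `u` is a
label in the tree hanging from the `n`-th backbone vertex, a sample attaches the number of ordinary
children of `(n, u)`, and the direction of the jump along the edge that leads to `(n, u)`
(from its parent if `u ≠ []`, from the backbone vertex `(n - 1, [])` if `u = []`). -/
abbrev Sample (d : ℕ) : Type := ℤ → List ℕ → ℕ × Direction d

/-- The law of the bi-infinite critical branching random walk: all the numbers of children and all
the jumps are independent, the numbers of children have the laws `childrenLaw`, and the jumps are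
those of the simple random walk on `ℤ ^ d`. -/
def law (d : ℕ) [NeZero d] (p : PMF ℕ) (hp : ∑' k : ℕ, (k : ℝ≥0∞) * p k = 1) :
    Measure (Sample d) :=
  Measure.infinitePi fun _ : ℤ => Measure.infinitePi fun u : List ℕ =>
    (childrenLaw p hp u).toMeasure.prod (PMF.uniformOfFintype (Direction d)).toMeasure

variable {d : ℕ}

/-! ### The tree and its embedding in `ℤ ^ d` -/

/-- `InTree ω n u`: the label `u` is a vertex of the tree hanging from the `n`-th backbone vertex.
The label `i :: u` stands for the `i`-th child of `u` (counted from `0`). -/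
def InTree (ω : Sample d) (n : ℤ) : List ℕ → Prop
  | [] => True
  | i :: u => InTree ω n u ∧ i < (ω n u).1

/-- The bi-infinite tree. Its edges join consecutive backbone vertices `(n, [])` and `(n + 1, [])`,
and every vertex `(n, u)` to its ordinary children `(n, i :: u)`. (Labels that are not vertices of
the tree are isolated.) -/
def tree (ω : Sample d) : SimpleGraph (ℤ × List ℕ) :=
  SimpleGraph.fromRel fun a b =>
    (a.2 = [] ∧ b = (a.1 + 1, [])) ∨
      ∃ i : ℕ, b = (a.1, i :: a.2) ∧ InTree ω a.1 (i :: a.2)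

/-- The position `α n` of the `n`-th backbone vertex: `α 0 = 0`, and `α n - α (n - 1)` is the jump
attached to `(n, [])`, for all `n : ℤ`. -/
def backbone (ω : Sample d) (n : ℤ) : Fin d → ℤ :=
  ∑ k ∈ Finset.Ioc 0 n, (ω k []).2.vec - ∑ k ∈ Finset.Ioc n 0, (ω k []).2.vec

/-- The displacement from the root of the `n`-th hanging tree to its vertex `u`. -/
def displacement (ω : Sample d) (n : ℤ) : List ℕ → (Fin d → ℤ)
  | [] => 0
  | i :: u => displacement ω n u + (ω n (i :: u)).2.vec

/-- The spatial location of a vertex of the tree. -/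
def position (ω : Sample d) (a : ℤ × List ℕ) : Fin d → ℤ :=
  backbone ω a.1 + displacement ω a.1 a.2

/-- The graph traced in `ℤ ^ d` by the branching random walk: its edges are the images of the edges
of the tree. (Sites that are not visited are isolated.) -/
def trace (ω : Sample d) : SimpleGraph (Fin d → ℤ) :=
  SimpleGraph.fromRel fun x y => ∃ a b, (tree ω).Adj a b ∧ position ω a = x ∧ position ω b = y

/-! ### Pivotal points -/

/-- The set of sites visited by the `n`-th hanging tree (started at the backbone). -/
def branch (ω : Sample d) (n : ℤ) : Set (Fin d → ℤ) :=
  {x | ∃ u, InTree ω n u ∧ position ω (n, u) = x}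

/-- The `i`-th backbone point is pivotal: the sites visited by the trees hanging from the
backbone at times `≤ i` are disjoint from those visited at times `≥ i + 1`. -/
def IsPivotal (ω : Sample d) (i : ℤ) : Prop :=
  Disjoint (⋃ n ∈ Set.Iic i, branch ω n) (⋃ n ∈ Set.Ici (i + 1), branch ω n)

/-- The first positive pivotal time `γ₁` (almost surely it exists when `d > 10`). -/
def firstPivotal (ω : Sample d) : ℕ :=
  sInf {n : ℕ | 0 < n ∧ IsPivotal ω n}

/-! ### The random quantities and the limiting constants -/

/-- Effective resistance between the origin and `α n` in the traced graph. (It is at most `n`, as the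
backbone connects them by `n` edges.) -/
def resistance (ω : Sample d) (n : ℕ) : ℝ :=
  (effectiveResistance (trace ω) 0 (backbone ω n)).toReal

/-- Graph distance between the origin and `α n` in the traced graph. -/
def distance (ω : Sample d) (n : ℕ) : ℝ :=
  (trace ω).dist 0 (backbone ω n)

/-- The law of the bi-infinite branching random walk conditioned on `0` being a pivotal point. -/
def pivotalLaw (d : ℕ) [NeZero d] (p : PMF ℕ) (hp : ∑' k : ℕ, (k : ℝ≥0∞) * p k = 1) :
    Measure (Sample d) :=
  ProbabilityTheory.cond (law d p hp) {ω | IsPivotal ω 0}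

/-- `ρ₁ = E[R_eff(0, α(γ₁)) | 0 is pivotal] / E[γ₁ | 0 is pivotal]`. -/
def rho₁ (d : ℕ) [NeZero d] (p : PMF ℕ) (hp : ∑' k : ℕ, (k : ℝ≥0∞) * p k = 1) : ℝ :=
  (∫ ω, resistance ω (firstPivotal ω) ∂pivotalLaw d p hp) /
    ∫ ω, (firstPivotal ω : ℝ) ∂pivotalLaw d p hp

/-- `ρ₂ = E[d_ω(0, α(γ₁)) | 0 is pivotal] / E[γ₁ | 0 is pivotal]`. -/
def rho₂ (d : ℕ) [NeZero d] (p : PMF ℕ) (hp : ∑' k : ℕ, (k : ℝ≥0∞) * p k = 1) : ℝ :=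
  (∫ ω, distance ω (firstPivotal ω) ∂pivotalLaw d p hp) /
    ∫ ω, (firstPivotal ω : ℝ) ∂pivotalLaw d p hp

end

end BRW

/-! Suppose first that `0` is pivotal with positive probability. The hanging trees together with the
backbone jumps form an i.i.d. sequence indexed by `ℤ`, so the shift along the backbone is ergodic
(`ergodic_shift`) and pivotal times occur almost surely in both directions. At a pivotal time `i`,
every edge of the trace that leaves the set of sites visited up to time `i` starts at `α(i)`. Thus
`α(i)` is a cut vertex, and both the effective resistance and the graph distance add up there
(`effectiveResistance_add_le`, `dist_add_dist_le_of_cut`). Let `D` be either of these metrics along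
the backbone. The ergodic sums of `1{0 pivotal} D(0, γ₁)` telescope to the value of `D` between `γ₁`
and the first pivotal time after `n` (`IsPivotalMetric.birkhoffSum_pivotalGap`), and the pointwise
ergodic theorem gives the limit `E[D(0, γ₁); 0 pivotal]`. Integrability comes from `D(0, γ₁) ≤ γ₁`
and Kac's formula `E[γ₁; 0 pivotal] = 1` (`lintegral_firstPivotal`), which also identifies the limit
with the ratio of conditional expectations. The same theorem for the metric `|i - j|` shows that the
first pivotal time after `n` is `n + o(n)`, so it may be replaced by `n`.

Positivity (`law_isPivotal_pos`) is where the dimension enters. Force a window: at times in `[-L,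
L]` the backbone goes straight and the hanging trees have height at most one, lie on the same line
and point away from the cut. No forbidden intersection occurs inside the window, so if `0` is not
pivotal, the far past meets the far future, or one of them meets the line. Each such meeting makes a
sum of `N` simple random walk jumps, independent of the window, travel a distance of at least `L`.
For `d ≥ 11` the heat kernel is `O(N ^ (-11/2))`, and the expected generation sizes of the hanging
trees are bounded, since `Z` is critical with a finite second moment. The union bound over at most
two backbone times and two generations then converges with a factor `1 / L` to spare, so the
conditional probability of failure given the window is `O(1 / L)`. -/

namespace BRW

/-! ### The pointwise ergodic theorem -/

section Ergodic

variable {α : Type*} {T : α → α} {f : α → ℝ}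

/-- The maximum of `0` and the first `n` Birkhoff sums. -/
def runningMax (T : α → α) (f : α → ℝ) : ℕ → α → ℝ
  | 0, _ => 0
  | n + 1, x => max 0 (f x + runningMax T f n (T x))

lemma runningMax_nonneg (n : ℕ) (x : α) : 0 ≤ runningMax T f n x := by
  cases n <;> simp [runningMax]

lemma runningMax_le_succ (n : ℕ) : ∀ x, runningMax T f n x ≤ runningMax T f (n + 1) x := by
  induction n with
  | zero => intro x; simp [runningMax]
  | succ n ih => intro x; exact max_le_max le_rfl (by simpa using ih (T x))

lemma runningMax_mono (x : α) : Monotone fun n => runningMax T f n x :=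
  monotone_nat_of_le_succ fun n => runningMax_le_succ n x

lemma birkhoffSum_le_runningMax (n : ℕ) : ∀ x, birkhoffSum T f n x ≤ runningMax T f n x := by
  induction n with
  | zero => intro x; simp [runningMax]
  | succ n ih =>
    intro x
    rw [birkhoffSum_succ']
    exact le_max_of_le_right (by simpa using ih (T x))

variable [MeasurableSpace α] {μ : Measure α}

lemma measurable_runningMax (hT : Measurable T) (hf : Measurable f) (n : ℕ) :
    Measurable (runningMax T f n) := by
  induction n with
  | zero => exact measurable_const
  | succ n ih => exact measurable_const.max (hf.add (ih.comp hT))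

lemma integrable_runningMax (hT : MeasurePreserving T μ μ) (hf : Integrable f μ) (n : ℕ) :
    Integrable (runningMax T f n) μ := by
  induction n with
  | zero => exact integrable_zero _ _ _
  | succ n ih =>
    exact (integrable_zero _ _ _).sup (hf.add (hT.integrable_comp_of_integrable ih))

/-- If `∫ f < 0` and `T` is ergodic, then the Birkhoff sums of `f` are almost surely bounded
above. -/
lemma ae_exists_birkhoffSum_le [IsProbabilityMeasure μ] (hT : Ergodic T μ) (hf : Integrable f μ)
    (hfm : Measurable f) (hneg : ∫ x, f x ∂μ < 0) :
    ∀ᵐ x ∂μ, ∃ C : ℝ, ∀ n, birkhoffSum T f n x ≤ C := by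
  set A : Set α := {x | ∀ C : ℕ, ∃ n, (C : ℝ) < runningMax T f n x} with hA
  have hAm : MeasurableSet A := by
    have : A = ⋂ C : ℕ, ⋃ n, {x | (C : ℝ) < runningMax T f n x} := by ext; simp [hA]
    rw [this]
    exact .iInter fun C => .iUnion fun n =>
      measurableSet_lt measurable_const (measurable_runningMax hT.measurable hfm n)
  have hinv : T ⁻¹' A = A := by
    ext x
    constructor
    · intro h C
      obtain ⟨C', hC'⟩ := exists_nat_gt ((C : ℝ) - f x)
      obtain ⟨n, hn⟩ := h C'
      refine ⟨n + 1, lt_max_of_lt_right ?_⟩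
      linarith
    · intro h C
      obtain ⟨C', hC'⟩ := exists_nat_gt ((C : ℝ) + f x)
      obtain ⟨n, hn⟩ := h (max C' 0)
      cases n with
      | zero => exact absurd hn (by simp [runningMax])
      | succ n =>
        refine ⟨n, ?_⟩
        have h1 : (C' : ℝ) < runningMax T f (n + 1) x := lt_of_le_of_lt (by simp) hn
        have h0 : (0 : ℝ) ≤ (C' : ℝ) := by positivity
        rcases lt_max_iff.1 h1 with h2 | h2
        · linarith
        · linarith
  rcases hT.ae_mem_or_ae_notMem hAm hinv with h | h
  · exfalso
    have hint : ∀ n, Integrable (fun x => runningMax T f (n + 1) x - runningMax T f n (T x)) μ :=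
      fun n => (integrable_runningMax hT.toMeasurePreserving hf _).sub
        (hT.toMeasurePreserving.integrable_comp_of_integrable
          (integrable_runningMax hT.toMeasurePreserving hf _))
    -- With `M n` the running maximum, `M (n+1) - M n ∘ T = max (-M n ∘ T) f`. This is dominated by
    -- `|f|`, and equals `f` as soon as `M n ∘ T ≥ -f`, which happens eventually on `A`. Its
    -- integral is nonnegative because `M (n+1) ≥ M n` and `T` preserves `μ`; in the limit `0 ≤ ∫
    -- f`, a contradiction.
    have hlim : Tendsto (fun n => ∫ x, (runningMax T f (n + 1) x - runningMax T f n (T x)) ∂μ)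
        atTop (𝓝 (∫ x, f x ∂μ)) := by
      refine tendsto_integral_of_dominated_convergence (fun x => |f x|)
        (fun n => (hint n).aestronglyMeasurable) hf.abs (fun n => ?_) ?_
      · refine Eventually.of_forall fun x => ?_
        have := runningMax_nonneg (T := T) (f := f) n (T x)
        simp only [runningMax, Real.norm_eq_abs]
        rcases max_cases 0 (f x + runningMax T f n (T x)) with ⟨h1, h2⟩ | ⟨h1, h2⟩
        · rw [h1, zero_sub, abs_neg, abs_of_nonneg this, abs_of_nonpos (by linarith)]
          linarith
        · rw [h1, add_sub_cancel_right]
      · filter_upwards [h] with x hx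
        have hTx : T x ∈ A := by rw [← hinv] at hx; exact hx
        obtain ⟨C, hC⟩ := exists_nat_gt (-f x)
        obtain ⟨N, hN⟩ := hTx C
        refine tendsto_const_nhds.congr' ?_
        filter_upwards [eventually_ge_atTop N] with n hn
        have := runningMax_mono (T := T) (f := f) (T x) hn
        simp only at this
        rw [runningMax, max_eq_right (by linarith)]
        ring
    refine hneg.not_ge (ge_of_tendsto' hlim fun n => ?_)
    have hcomp : Integrable (fun x => runningMax T f n (T x)) μ :=
      hT.toMeasurePreserving.integrable_comp_of_integrable
        (integrable_runningMax hT.toMeasurePreserving hf _)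
    rw [integral_sub (integrable_runningMax hT.toMeasurePreserving hf _) hcomp]
    have : ∫ x, runningMax T f n (T x) ∂μ = ∫ x, runningMax T f n x ∂μ := by
      rw [← integral_map (f := runningMax T f n) hT.measurable.aemeasurable
        (measurable_runningMax hT.measurable hfm n).aestronglyMeasurable, hT.map_eq]
    rw [this, sub_nonneg]
    exact integral_mono (integrable_runningMax hT.toMeasurePreserving hf _)
      (integrable_runningMax hT.toMeasurePreserving hf _) (runningMax_le_succ n)
  · filter_upwards [h] with x hx
    simp only [hA, Set.mem_ofPred_eq, not_forall, not_exists, not_lt] at hx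
    obtain ⟨C, hC⟩ := hx
    exact ⟨C, fun n => (birkhoffSum_le_runningMax n x).trans (hC n)⟩

/-- Subtracting `∫ f + ε / 2` makes the mean negative, so the centred sums stay below a random
constant `C`; the other `ε / 2` absorbs `C / n`. -/
lemma ae_eventually_birkhoffSum_le [IsProbabilityMeasure μ] (hT : Ergodic T μ)
    (hf : Integrable f μ) (hfm : Measurable f) {ε : ℝ} (hε : 0 < ε) :
    ∀ᵐ x ∂μ, ∀ᶠ n : ℕ in atTop, birkhoffSum T f n x / n ≤ (∫ x, f x ∂μ) + ε := by
  have key := ae_exists_birkhoffSum_le (f := fun x => f x - ((∫ x, f x ∂μ) + ε / 2)) hT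
    (hf.sub (integrable_const _)) (hfm.sub_const _) (by
      rw [integral_sub hf (integrable_const _)]; simp; linarith)
  filter_upwards [key] with x ⟨C, hC⟩
  have hlim : Tendsto (fun n : ℕ => C / (n : ℝ)) atTop (𝓝 0) :=
    tendsto_const_div_atTop_nhds_zero_nat C
  filter_upwards [hlim.eventually (gt_mem_nhds (half_pos hε)), eventually_gt_atTop 0] with n h1 h2
  have hn : (0 : ℝ) < n := by exact_mod_cast h2
  have h3 := hC n
  simp only [birkhoffSum, Finset.sum_sub_distrib, Finset.sum_const, Finset.card_range,
    nsmul_eq_mul] at h3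
  rw [div_lt_iff₀ hn] at h1
  rw [div_le_iff₀ hn]
  simp only [birkhoffSum]
  nlinarith

/-- The pointwise ergodic theorem for ergodic maps. -/
theorem ae_tendsto_birkhoffSum_div [IsProbabilityMeasure μ] (hT : Ergodic T μ)
    (hf : Integrable f μ) (hfm : Measurable f) :
    ∀ᵐ x ∂μ, Tendsto (fun n : ℕ => birkhoffSum T f n x / n) atTop (𝓝 (∫ x, f x ∂μ)) := by
  have h1 : ∀ᵐ x ∂μ, ∀ k : ℕ, ∀ᶠ n : ℕ in atTop,
      birkhoffSum T f n x / n ≤ (∫ x, f x ∂μ) + 1 / ((k : ℝ) + 1) :=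
    ae_all_iff.2 fun k => ae_eventually_birkhoffSum_le hT hf hfm (by positivity)
  have h2 : ∀ᵐ x ∂μ, ∀ k : ℕ, ∀ᶠ n : ℕ in atTop,
      birkhoffSum T (fun x => -f x) n x / n ≤ (∫ x, -f x ∂μ) + 1 / ((k : ℝ) + 1) :=
    ae_all_iff.2 fun k => ae_eventually_birkhoffSum_le hT hf.neg hfm.neg (by positivity)
  filter_upwards [h1, h2] with x h1 h2
  rw [Metric.tendsto_atTop']
  intro ε hε
  obtain ⟨k, hk⟩ := exists_nat_one_div_lt hε
  obtain ⟨N, hN⟩ := eventually_atTop.1 ((h1 k).and (h2 k))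
  refine ⟨N, fun n hn => ?_⟩
  obtain ⟨h3, h4⟩ := hN n hn.le
  rw [integral_neg] at h4
  simp only [birkhoffSum, Finset.sum_neg_distrib, neg_div] at h3 h4 ⊢
  rw [Real.dist_eq, abs_lt]
  constructor <;> linarith

end Ergodic

/-! ### Ergodicity of the Bernoulli shift -/

section Shift

open ProbabilityTheory

variable {X : Type*}

/-- The left shift on bi-infinite sequences. -/
def shift (ω : ℤ → X) : ℤ → X := fun n => ω (n + 1)

lemma iterate_shift (k : ℕ) (ω : ℤ → X) (n : ℤ) : (shift^[k] ω) n = ω (n + k) := by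
  induction k generalizing ω with
  | zero => simp
  | succ k ih =>
    rw [Function.iterate_succ_apply, ih, shift]
    congr 1
    push_cast
    ring

variable [MeasurableSpace X]

lemma measurable_shift : Measurable (shift : (ℤ → X) → ℤ → X) :=
  measurable_pi_lambda _ fun _ => measurable_pi_apply _

variable (μ : Measure X) [IsProbabilityMeasure μ]

lemma measurePreserving_shift :
    MeasurePreserving shift (Measure.infinitePi fun _ : ℤ => μ) (Measure.infinitePi fun _ => μ) :=
  ⟨measurable_shift, Measure.map_infinitePi_infinitePi_of_inj (P := fun _ : ℤ => μ)
    (add_left_injective (1 : ℤ))⟩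

/-- A translation by more than the diameter of the finite base `I` makes `I` and `I + k` disjoint,
so the two events depend on disjoint sets of independent coordinates. -/
lemma measure_inter_shift_preimage_of_mem_measurableCylinders {B : Set (ℤ → X)}
    (hB : B ∈ measurableCylinders fun _ : ℤ => X) :
    ∃ k : ℕ, (Measure.infinitePi fun _ : ℤ => μ) (B ∩ shift^[k] ⁻¹' B) =
      (Measure.infinitePi fun _ : ℤ => μ) B * (Measure.infinitePi fun _ : ℤ => μ) B := by
  classical
  obtain ⟨I, S, hS, rfl⟩ := (mem_measurableCylinders _).1 hB
  obtain ⟨k, hk⟩ : ∃ k : ℕ, ∀ i ∈ I, ∀ j ∈ I, i ≠ j + k := by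
    obtain ⟨M, hM⟩ := I.bddAbove
    obtain ⟨m, hm⟩ := I.bddBelow
    refine ⟨(M - m + 1).toNat, fun i hi j hj h => ?_⟩
    have := hM hi
    have := hm hj
    have := Int.self_le_toNat (M - m + 1)
    omega
  refine ⟨k, ?_⟩
  let J : Finset ℤ := I.image (· + (k : ℤ))
  have hIJ : Disjoint I J := by
    rw [Finset.disjoint_left]
    intro i hi hj
    obtain ⟨j', hj', rfl⟩ := Finset.mem_image.1 hj
    exact hk _ hi j' hj' rfl
  have hind := (iIndepFun_infinitePi (P := fun _ : ℤ => μ) (X := fun _ x => x)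
    fun _ => measurable_id).indepFun_finset I J hIJ fun i => measurable_pi_apply i
  let φ : ((i : J) → X) → ((i : I) → X) := fun x i =>
    x ⟨(i : ℤ) + k, Finset.mem_image_of_mem _ i.2⟩
  have hφ : Measurable φ := measurable_pi_lambda _ fun i => measurable_pi_apply _
  have hpre : shift^[k] ⁻¹' (cylinder I S) = (fun (ω : ℤ → X) (i : J) => ω i) ⁻¹' (φ ⁻¹' S) := by
    ext ω
    simp only [Set.mem_preimage, mem_cylinder]
    have : I.restrict (shift^[k] ω) = φ fun i : J => ω i := by
      ext i; simp [φ, iterate_shift]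
    rw [this]
  have hmp := ((measurePreserving_shift μ).iterate k).measure_preimage
    (hS.cylinder (s := I)).nullMeasurableSet
  rw [hpre] at hmp ⊢
  have := hind.measure_inter_preimage_eq_mul S (φ ⁻¹' S) hS (hφ hS)
  rw [hmp] at this
  exact this

/-- The Bernoulli shift on bi-infinite sequences is ergodic. -/
theorem ergodic_shift : Ergodic shift (Measure.infinitePi fun _ : ℤ => μ) := by
  set P := Measure.infinitePi fun _ : ℤ => μ with hP
  refine ⟨measurePreserving_shift μ, ⟨fun A hA hinv => ?_⟩⟩
  have hdense : P.MeasureDense (measurableCylinders fun _ : ℤ => X) :=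
    .of_generateFrom_isSetAlgebra_finite _ isSetAlgebra_measurableCylinders
      generateFrom_measurableCylinders.symm
  have hinvk : ∀ k : ℕ, shift^[k] ⁻¹' A = A := by
    intro k
    induction k with
    | zero => rfl
    | succ k ih => rw [Function.iterate_succ, Set.preimage_comp, ih, hinv]
  have key : P.real A = P.real A * P.real A := by
    -- Approximate the invariant set `A` by a cylinder `B`. By invariance the translate of `B`
    -- approximates `A` equally well, so `P(A)` is within `2ε` of `P(B ∩ shift^[k] ⁻¹' B) = P(B)²`.
    -- In turn `P(B)²` is within `2ε` of `P(A)²`.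
    have hle : ∀ ε > 0, |P.real A - P.real A * P.real A| ≤ 4 * ε := by
      intro ε hε
      obtain ⟨B, hB, hAB⟩ := hdense.approx A hA (measure_ne_top _ _) ε hε
      have hBm : MeasurableSet B := hdense.measurable B hB
      obtain ⟨k, hk⟩ := measure_inter_shift_preimage_of_mem_measurableCylinders μ hB
      rw [← hP] at hk
      have hk' : P.real (B ∩ shift^[k] ⁻¹' B) = P.real B * P.real B := by
        simp only [Measure.real, hk, ENNReal.toReal_mul]
      have h1 : P.real (symmDiff A B) ≤ ε :=
        ENNReal.toReal_le_of_le_ofReal hε.le hAB.le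
      have hTm : MeasurableSet (shift^[k] ⁻¹' B) := (measurable_shift.iterate k) hBm
      have h2 : P.real (symmDiff A (shift^[k] ⁻¹' B)) ≤ ε := by
        have : symmDiff A (shift^[k] ⁻¹' B) = shift^[k] ⁻¹' (symmDiff A B) := by
          conv_lhs => rw [← hinvk k]
          rfl
        rw [this, Measure.real, ((measurePreserving_shift μ).iterate k).measure_preimage
          (hA.symmDiff hBm).nullMeasurableSet]
        exact h1
      have h3 : |P.real A - P.real B| ≤ ε :=
        (abs_measureReal_sub_le_measureReal_symmDiff hA.nullMeasurableSet
          hBm.nullMeasurableSet).trans h1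
      have h4 : |P.real A - P.real (B ∩ shift^[k] ⁻¹' B)| ≤ 2 * ε := by
        refine (abs_measureReal_sub_le_measureReal_symmDiff hA.nullMeasurableSet
          (hBm.inter hTm).nullMeasurableSet).trans ?_
        have hsub : symmDiff A (B ∩ shift^[k] ⁻¹' B) ⊆
            symmDiff A B ∪ symmDiff A (shift^[k] ⁻¹' B) := by
          intro x
          simp only [Set.mem_symmDiff, Set.mem_inter_iff, Set.mem_union]
          tauto
        refine (measureReal_mono hsub).trans ((measureReal_union_le _ _).trans ?_)
        linarith
      rw [hk'] at h4
      have hA1 : P.real A ≤ 1 := measureReal_le_one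
      have hB1 : P.real B ≤ 1 := measureReal_le_one
      have hA0 : 0 ≤ P.real A := measureReal_nonneg
      have hB0 : 0 ≤ P.real B := measureReal_nonneg
      rw [abs_le] at h3 h4 ⊢
      constructor <;> nlinarith
    have : |P.real A - P.real A * P.real A| ≤ 0 :=
      le_of_forall_pos_le_add fun ε hε => by
        have := hle (ε / 4) (by positivity); linarith
    linarith [abs_nonpos_iff.1 this]
  have h01 : P.real A = 0 ∨ P.real A = 1 := by
    have : P.real A * (P.real A - 1) = 0 := by linarith
    rcases mul_eq_zero.1 this with h | h
    · exact Or.inl h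
    · exact Or.inr (by linarith)
  rw [eventuallyConst_set']
  rcases h01 with h | h
  · left
    rw [measureReal_eq_zero_iff] at h
    exact ae_eq_empty.2 h
  · right
    rw [ae_eq_univ]
    have := probReal_compl_eq_one_sub (μ := P) hA
    rw [h, sub_self, measureReal_eq_zero_iff] at this
    exact this

end Shift

end BRW

namespace BRW

/-! ### Effective resistance: triangle inequality, series law, measurability -/

section EffectiveResistance

variable {V : Type*} (G : SimpleGraph V)

/-- The contribution of an ordered pair of vertices to twice the Dirichlet energy. -/
noncomputable def pairEnergy (f : V → ℝ) (e : V × V) : ℝ≥0∞ :=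
  {e : V × V | G.Adj e.1 e.2}.indicator (fun e => ENNReal.ofReal ((f e.1 - f e.2) ^ 2)) e

/-- The type of darts depends on `G`. Summing over all of `V × V` fixes the index set, which is
needed to compare energies and to let the graph be random. -/
lemma dirichletEnergy_eq_tsum (f : V → ℝ) :
    dirichletEnergy G f = 2⁻¹ * ∑' e : V × V, pairEnergy G f e := by
  rw [dirichletEnergy]
  congr 1
  have hinj : Function.Injective (fun e : G.Dart => e.toProd) := fun a b h =>
    SimpleGraph.Dart.ext a b h
  rw [← hinj.tsum_eq]
  · refine tsum_congr fun e => ?_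
    rw [pairEnergy, Set.indicator_of_mem (show e.toProd ∈ {e : V × V | G.Adj e.1 e.2} from e.adj)]
  · intro e he
    have : G.Adj e.1 e.2 := by
      by_contra h
      exact he (Set.indicator_of_notMem (s := {e : V × V | G.Adj e.1 e.2}) h _)
    exact ⟨⟨e, this⟩, rfl⟩

/-- Effective conductance: the smallest Dirichlet energy of a potential with value `1` at `x` and
`0` at `y`. -/
noncomputable def conductance (x y : V) : ℝ≥0∞ :=
  ⨅ (f : V → ℝ) (_ : f x = 1 ∧ f y = 0), dirichletEnergy G f

lemma effectiveResistance_eq (x y : V) : effectiveResistance G x y = (conductance G x y)⁻¹ := rfl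

variable {G}

lemma pairEnergy_mono {f g : V → ℝ} {c : ℝ} (e : V × V)
    (h : (g e.1 - g e.2) ^ 2 ≤ c * (f e.1 - f e.2) ^ 2) :
    pairEnergy G g e ≤ ENNReal.ofReal c * pairEnergy G f e := by
  by_cases he : e ∈ {e : V × V | G.Adj e.1 e.2}
  · simp only [pairEnergy, Set.indicator_of_mem he]
    rw [← ENNReal.ofReal_mul' (sq_nonneg _)]
    exact ENNReal.ofReal_le_ofReal h
  · simp [pairEnergy, Set.indicator_of_notMem he]

lemma dirichletEnergy_le_mul {f g : V → ℝ} {c : ℝ}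
    (h : ∀ u v, (g u - g v) ^ 2 ≤ c * (f u - f v) ^ 2) :
    dirichletEnergy G g ≤ ENNReal.ofReal c * dirichletEnergy G f := by
  rw [dirichletEnergy_eq_tsum, dirichletEnergy_eq_tsum, mul_left_comm (ENNReal.ofReal c),
    ← ENNReal.tsum_mul_left (a := ENNReal.ofReal c)]
  exact mul_le_mul_right (ENNReal.tsum_le_tsum fun e => pairEnergy_mono e (h _ _)) _

lemma dirichletEnergy_le_mul_add_mul {f₁ f₂ g : V → ℝ} {a b : ℝ} (ha : 0 ≤ a) (hb : 0 ≤ b)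
    (h : ∀ u v, G.Adj u v → (g u - g v) ^ 2 ≤ a * (f₁ u - f₁ v) ^ 2 + b * (f₂ u - f₂ v) ^ 2) :
    dirichletEnergy G g ≤
      ENNReal.ofReal a * dirichletEnergy G f₁ + ENNReal.ofReal b * dirichletEnergy G f₂ := by
  simp only [dirichletEnergy_eq_tsum]
  rw [mul_left_comm (ENNReal.ofReal a), ← ENNReal.tsum_mul_left (a := ENNReal.ofReal a),
    mul_left_comm (ENNReal.ofReal b), ← ENNReal.tsum_mul_left (a := ENNReal.ofReal b),
    ← mul_add, ← ENNReal.tsum_add]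
  refine mul_le_mul_right (ENNReal.tsum_le_tsum fun e => ?_) _
  by_cases he : e ∈ {e : V × V | G.Adj e.1 e.2}
  · simp only [pairEnergy, Set.indicator_of_mem he]
    rw [← ENNReal.ofReal_mul ha, ← ENNReal.ofReal_mul hb,
      ← ENNReal.ofReal_add (by positivity) (by positivity)]
    exact ENNReal.ofReal_le_ofReal (h _ _ he)
  · simp [pairEnergy, Set.indicator_of_notMem he]

/-- Along an edge, the increments of the two truncations have the same sign and add up to the
increment of `f`, so the sum of their squares is at most its square. -/
lemma dirichletEnergy_max_add_min_le (f : V → ℝ) (t : ℝ) :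
    dirichletEnergy G (fun v => max (f v) t) + dirichletEnergy G (fun v => min (f v) t) ≤
      dirichletEnergy G f := by
  simp only [dirichletEnergy_eq_tsum]
  rw [← mul_add, ← ENNReal.tsum_add]
  refine mul_le_mul_right (ENNReal.tsum_le_tsum fun e => ?_) _
  by_cases he : e ∈ {e : V × V | G.Adj e.1 e.2}
  · simp only [pairEnergy, Set.indicator_of_mem he]
    rw [← ENNReal.ofReal_add (by positivity) (by positivity)]
    refine ENNReal.ofReal_le_ofReal ?_
    rcases max_cases (f e.1) t with ⟨h1, h1'⟩ | ⟨h1, h1'⟩ <;>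
    rcases max_cases (f e.2) t with ⟨h2, h2'⟩ | ⟨h2, h2'⟩ <;>
    rcases min_cases (f e.1) t with ⟨h3, h3'⟩ | ⟨h3, h3'⟩ <;>
    rcases min_cases (f e.2) t with ⟨h4, h4'⟩ | ⟨h4, h4'⟩ <;>
    rw [h1, h2, h3, h4] <;> nlinarith
  · simp [pairEnergy, Set.indicator_of_notMem he]

lemma sq_mul_conductance_le (f : V → ℝ) (x y : V) :
    ENNReal.ofReal ((f x - f y) ^ 2) * conductance G x y ≤ dirichletEnergy G f := by
  by_cases h : f x = f y
  · simp [h]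
  have h' : f x - f y ≠ 0 := sub_ne_zero.2 h
  have hc : conductance G x y ≤ dirichletEnergy G fun v => (f v - f y) / (f x - f y) :=
    iInf₂_le _ ⟨div_self h', by simp⟩
  have hle : dirichletEnergy G (fun v => (f v - f y) / (f x - f y)) ≤
      ENNReal.ofReal (((f x - f y) ^ 2)⁻¹) * dirichletEnergy G f := by
    refine dirichletEnergy_le_mul fun u v => le_of_eq ?_
    field_simp
    ring
  have hpos : 0 < (f x - f y) ^ 2 := by positivity
  calc _ ≤ ENNReal.ofReal ((f x - f y) ^ 2) *
      (ENNReal.ofReal (((f x - f y) ^ 2)⁻¹) * dirichletEnergy G f) := by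
        gcongr; exact hc.trans hle
    _ = dirichletEnergy G f := by
        rw [← mul_assoc, ← ENNReal.ofReal_mul hpos.le, mul_inv_cancel₀ hpos.ne']
        simp

/-- The left side is `ab / (a + b)`, the minimum over `t` of the right side; the difference is `(a(1
- t) - tb)² / (a + b)`. -/
lemma inv_inv_add_inv_le {a b : ℝ≥0∞} {t : ℝ} (h0 : 0 < t) (h1 : t < 1) :
    (a⁻¹ + b⁻¹)⁻¹ ≤ ENNReal.ofReal ((1 - t) ^ 2) * a + ENNReal.ofReal (t ^ 2) * b := by
  have ht0 : ENNReal.ofReal (t ^ 2) ≠ 0 := by simp; positivity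
  have ht1 : ENNReal.ofReal ((1 - t) ^ 2) ≠ 0 := by
    have : 0 < 1 - t := by linarith
    simp; positivity
  rcases eq_or_ne a ∞ with rfl | ha
  · simp [ENNReal.mul_top ht1]
  rcases eq_or_ne b ∞ with rfl | hb
  · simp [ENNReal.mul_top ht0]
  rcases eq_or_ne a 0 with rfl | ha0
  · simp
  rcases eq_or_ne b 0 with rfl | hb0
  · simp
  lift a to NNReal using ha
  lift b to NNReal using hb
  have ha' : 0 < a := pos_iff_ne_zero.2 (by simpa using ha0)
  have hb' : 0 < b := pos_iff_ne_zero.2 (by simpa using hb0)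
  rw [← ENNReal.coe_inv ha'.ne', ← ENNReal.coe_inv hb'.ne', ← ENNReal.coe_add,
    ← ENNReal.coe_inv (by positivity), ENNReal.ofReal, ENNReal.ofReal, ← ENNReal.coe_mul,
    ← ENNReal.coe_mul, ← ENNReal.coe_add, ENNReal.coe_le_coe, ← NNReal.coe_le_coe]
  push_cast
  rw [Real.coe_toNNReal _ (by positivity), Real.coe_toNNReal _ (by positivity)]
  have ha2 : (0 : ℝ) < a := ha'
  have hb2 : (0 : ℝ) < b := hb'
  rw [inv_add_inv ha2.ne' hb2.ne', inv_div, div_le_iff₀ (by positivity)]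
  nlinarith [sq_nonneg ((a : ℝ) * (1 - t) - t * b)]

/-- Effective resistance satisfies the triangle inequality. -/
theorem effectiveResistance_triangle (x y z : V) :
    effectiveResistance G x z ≤ effectiveResistance G x y + effectiveResistance G y z := by
  simp only [effectiveResistance_eq]
  rw [ENNReal.inv_le_iff_inv_le]
  refine le_iInf₂ fun f ⟨hx, hz⟩ => ?_
  -- Cut the potential at the level `t = f y`. The part above drops by `1 - t` from `x` to `y` and
  -- the part below drops by `t` from `y` to `z`. If `t` is outside `(0, 1)`, one of these drops is
  -- already at least `1` and a single term suffices.
  have hE := dirichletEnergy_max_add_min_le (G := G) f (f y)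
  have hc1 := sq_mul_conductance_le (G := G) (fun v => max (f v) (f y)) x y
  have hc2 := sq_mul_conductance_le (G := G) (fun v => min (f v) (f y)) y z
  simp only [hx, hz, max_self, min_self] at hc1 hc2
  rcases le_or_gt (f y) 0 with h | h
  · rw [max_eq_left (by linarith)] at hc1
    have h1 : (1 : ℝ≥0∞) ≤ ENNReal.ofReal ((1 - f y) ^ 2) := by
      rw [ENNReal.one_le_ofReal]; nlinarith
    calc _ ≤ conductance G x y := ENNReal.inv_le_iff_inv_le.1 le_self_add
      _ ≤ ENNReal.ofReal ((1 - f y) ^ 2) * conductance G x y := le_mul_of_one_le_left' h1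
      _ ≤ _ := hc1.trans (le_self_add.trans hE)
  · rw [min_eq_left h.le, sub_zero] at hc2
    rcases le_or_gt 1 (f y) with h' | h'
    · have h1 : (1 : ℝ≥0∞) ≤ ENNReal.ofReal ((f y) ^ 2) := by
        rw [ENNReal.one_le_ofReal]; nlinarith
      calc _ ≤ conductance G y z := ENNReal.inv_le_iff_inv_le.1 le_add_self
        _ ≤ ENNReal.ofReal ((f y) ^ 2) * conductance G y z := le_mul_of_one_le_left' h1
        _ ≤ _ := hc2.trans (le_add_self.trans hE)
    · rw [max_eq_left h'.le] at hc1
      exact (inv_inv_add_inv_le h h').trans ((add_le_add hc1 hc2).trans hE)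

/-- Take `t = a / (a + b)`, the minimiser of the quadratic form. The first two hypotheses settle the
cases where `a` or `b` is `0` or `∞`. -/
lemma inv_add_inv_le_inv {a b c : ℝ≥0∞} (h0 : c ≤ a) (h1 : c ≤ b)
    (h : ∀ t : ℝ, 0 < t → t < 1 →
      c ≤ ENNReal.ofReal ((1 - t) ^ 2) * a + ENNReal.ofReal (t ^ 2) * b) :
    a⁻¹ + b⁻¹ ≤ c⁻¹ := by
  rcases eq_or_ne a ∞ with rfl | ha
  · simpa using h1
  rcases eq_or_ne b ∞ with rfl | hb
  · simpa using h0
  rcases eq_or_ne a 0 with rfl | ha0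
  · simp [nonpos_iff_eq_zero.1 h0]
  rcases eq_or_ne b 0 with rfl | hb0
  · simp [nonpos_iff_eq_zero.1 h1]
  lift a to NNReal using ha
  lift b to NNReal using hb
  have ha' : 0 < a := pos_iff_ne_zero.2 (by simpa using ha0)
  have hb' : 0 < b := pos_iff_ne_zero.2 (by simpa using hb0)
  have ha2 : (0 : ℝ) < a := ha'
  have hb2 : (0 : ℝ) < b := hb'
  have hc := h (a / (a + b)) (by positivity) (by rw [div_lt_one (by positivity)]; linarith)
  rw [ENNReal.le_inv_iff_le_inv]
  refine hc.trans ?_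
  rw [← ENNReal.coe_inv ha'.ne', ← ENNReal.coe_inv hb'.ne', ← ENNReal.coe_add,
    ← ENNReal.coe_inv (by positivity), ENNReal.ofReal, ENNReal.ofReal, ← ENNReal.coe_mul,
    ← ENNReal.coe_mul, ← ENNReal.coe_add, ENNReal.coe_le_coe, ← NNReal.coe_le_coe]
  push_cast
  rw [Real.coe_toNNReal _ (by positivity), Real.coe_toNNReal _ (by positivity),
    inv_add_inv ha2.ne' hb2.ne', inv_div]
  refine le_of_eq ?_
  field_simp
  ring

@[simp] lemma effectiveResistance_self (x : V) : effectiveResistance G x x = 0 := by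
  rw [effectiveResistance, ENNReal.inv_eq_zero, iInf₂_eq_top]
  rintro f ⟨h1, h2⟩
  exact absurd (h1.symm.trans h2) one_ne_zero

/-- The series law: effective resistances add up across a cut vertex `y`. -/
theorem effectiveResistance_add_le {A : Set V} {x y z : V} (hx : x ∈ A) (hy : y ∈ A) (hz : z ∉ A)
    (hA : ∀ u ∈ A, ∀ v ∉ A, G.Adj u v → u = y) :
    effectiveResistance G x y + effectiveResistance G y z ≤ effectiveResistance G x z := by
  classical
  rcases eq_or_ne x y with rfl | hxy
  · simp
  have hyz : y ≠ z := fun h => hz (h ▸ hy)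
  have key : ∀ t : ℝ, ∀ f₁ f₂ : V → ℝ, (f₁ x = 1 ∧ f₁ y = 0) → (f₂ y = 1 ∧ f₂ z = 0) →
      conductance G x z ≤ ENNReal.ofReal ((1 - t) ^ 2) * dirichletEnergy G f₁ +
        ENNReal.ofReal (t ^ 2) * dirichletEnergy G f₂ := by
    rintro t f₁ f₂ ⟨h1x, h1y⟩ ⟨h2y, h2z⟩
    -- The two potentials are rescaled and glued at level `t`. An edge leaving `A` starts at `y`,
    -- where both formulas take the value `t` (`f₁ y = 0`, `f₂ y = 1`), so on it the glued potential
    -- has the increment of `t * f₂`.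
    refine (iInf₂_le (fun v => if v ∈ A then t + (1 - t) * f₁ v else t * f₂ v) ?_).trans
      (dirichletEnergy_le_mul_add_mul (sq_nonneg _) (sq_nonneg _) fun u v huv => ?_)
    · simp [hx, hz, h1x, h2z]
    · have cross : ∀ u ∈ A, ∀ v ∉ A, G.Adj u v →
          (t + (1 - t) * f₁ u - t * f₂ v) ^ 2 ≤
            (1 - t) ^ 2 * (f₁ u - f₁ v) ^ 2 + t ^ 2 * (f₂ u - f₂ v) ^ 2 := by
        intro u hu v hv huv
        obtain rfl := hA u hu v hv huv
        rw [h1y, h2y]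
        have : 0 ≤ (1 - t) ^ 2 * (0 - f₁ v) ^ 2 := by positivity
        linarith [this, (by ring : (t + (1 - t) * 0 - t * f₂ v) ^ 2 = t ^ 2 * (1 - f₂ v) ^ 2)]
      by_cases hu : u ∈ A <;> by_cases hv : v ∈ A
      · simp only [hu, hv, if_true]
        have : 0 ≤ t ^ 2 * (f₂ u - f₂ v) ^ 2 := by positivity
        linarith [(by ring : (t + (1 - t) * f₁ u - (t + (1 - t) * f₁ v)) ^ 2 =
          (1 - t) ^ 2 * (f₁ u - f₁ v) ^ 2)]
      · simp only [hu, hv, if_true, if_false]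
        exact cross u hu v hv huv
      · simp only [hu, hv, if_true, if_false]
        have := cross v hv u hu huv.symm
        linarith [(by ring : (t * f₂ u - (t + (1 - t) * f₁ v)) ^ 2 =
          (t + (1 - t) * f₁ v - t * f₂ u) ^ 2), (by ring : (f₁ u - f₁ v) ^ 2 = (f₁ v - f₁ u) ^ 2),
          (by ring : (f₂ u - f₂ v) ^ 2 = (f₂ v - f₂ u) ^ 2)]
      · simp only [hu, hv, if_false]
        have : 0 ≤ (1 - t) ^ 2 * (f₁ u - f₁ v) ^ 2 := by positivity
        linarith [(by ring : (t * f₂ u - t * f₂ v) ^ 2 = t ^ 2 * (f₂ u - f₂ v) ^ 2)]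
  simp only [effectiveResistance_eq]
  refine inv_add_inv_le_inv ?_ ?_ fun t ht0 ht1 => ?_
  · refine le_iInf₂ fun f hf => ?_
    -- At `t = 0` the second potential has weight zero, so any admissible function will do, even one
    -- of infinite energy. The case `t = 1` below is symmetric.
    simpa using key 0 f (Pi.single y (1 : ℝ)) hf (by simp [hyz.symm])
  · refine le_iInf₂ fun f hf => ?_
    simpa using key 1 (Pi.single x (1 : ℝ)) f (by simp [hxy.symm]) hf
  · have h1 : 0 < (1 - t) ^ 2 := by have : 0 < 1 - t := by linarith
                                    positivity
    have h2 : 0 < t ^ 2 := by positivity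
    simp only [conductance, iInf_subtype'] at key ⊢
    rw [ENNReal.mul_iInf_of_ne (by simpa using h1.ne') ENNReal.ofReal_ne_top,
      ENNReal.mul_iInf_of_ne (by simpa using h2.ne') ENNReal.ofReal_ne_top]
    exact ENNReal.le_iInf_add_iInf fun f₁ f₂ => key t f₁ f₂ f₁.2 f₂.2

lemma effectiveResistance_le_one {x y : V} (h : G.Adj x y) : effectiveResistance G x y ≤ 1 := by
  classical
  rw [effectiveResistance_eq, ENNReal.inv_le_one]
  refine le_iInf₂ fun f ⟨hx, hy⟩ => ?_
  rw [dirichletEnergy_eq_tsum]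
  have hne : (x, y) ≠ (y, x) := fun h' => h.ne (Prod.ext_iff.1 h').1
  have := ENNReal.sum_le_tsum (f := pairEnergy G f) {(x, y), (y, x)}
  rw [Finset.sum_pair hne] at this
  have h1 : pairEnergy G f (x, y) = 1 := by
    rw [pairEnergy, Set.indicator_of_mem (show (x, y) ∈ {e : V × V | G.Adj e.1 e.2} from h)]
    simp [hx, hy]
  have h2 : pairEnergy G f (y, x) = 1 := by
    rw [pairEnergy, Set.indicator_of_mem (show (y, x) ∈ {e : V × V | G.Adj e.1 e.2} from h.symm)]
    simp [hx, hy]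
  rw [h1, h2, one_add_one_eq_two] at this
  calc (1 : ℝ≥0∞) = 2⁻¹ * 2 := (ENNReal.inv_mul_cancel (by simp) (by simp)).symm
    _ ≤ _ := by gcongr

lemma effectiveResistance_congr {W : Type*} {H : SimpleGraph W} (e : G ≃g H) (x y : V) :
    effectiveResistance H (e x) (e y) = effectiveResistance G x y := by
  have hE : ∀ f : W → ℝ, dirichletEnergy G (f ∘ e) = dirichletEnergy H f := by
    intro f
    rw [dirichletEnergy_eq_tsum, dirichletEnergy_eq_tsum,
      ← (e.toEquiv.prodCongr e.toEquiv).tsum_eq]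
    congr 1
    refine tsum_congr fun p => ?_
    by_cases h : p ∈ {e : V × V | G.Adj e.1 e.2}
    · have h' : (e p.1, e p.2) ∈ {e : W × W | H.Adj e.1 e.2} := e.map_adj_iff.2 h
      rw [pairEnergy, Set.indicator_of_mem h, pairEnergy]
      exact (Set.indicator_of_mem h' fun e : W × W => ENNReal.ofReal ((f e.1 - f e.2) ^ 2)).symm
    · have h' : (e p.1, e p.2) ∉ {e : W × W | H.Adj e.1 e.2} := fun h' => h (e.map_adj_iff.1 h')
      rw [pairEnergy, Set.indicator_of_notMem h, pairEnergy]
      exact (Set.indicator_of_notMem h' fun e : W × W =>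
        ENNReal.ofReal ((f e.1 - f e.2) ^ 2)).symm
  rw [effectiveResistance, effectiveResistance]
  congr 1
  refine Function.Surjective.iInf_congr (fun f : W → ℝ => f ∘ e) (fun f => ⟨f ∘ e.symm, ?_⟩) ?_
  · ext; simp
  · intro f
    rw [hE]
    rfl

/-- The smallest energy on a finite set of pairs of a potential with values in `[0, 1]`. -/
noncomputable def finiteConductance (x y : V) (F : Finset (V × V)) : ℝ≥0∞ :=
  ⨅ (f : V → ℝ) (_ : (f x = 1 ∧ f y = 0) ∧ ∀ v, f v ∈ Set.Icc (0 : ℝ) 1),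
    2⁻¹ * ∑ e ∈ F, ENNReal.ofReal ((f e.1 - f e.2) ^ 2)

-- Truncating a potential to `[0, 1]` does not increase its energy, so potentials may be taken in
-- the cube `[0, 1] ^ V`, compact by Tychonoff. Potentials with small energy on a finite set of
-- pairs form closed subsets of it, nonempty and directed, and a point of their intersection has
-- small energy on the whole graph.
open scoped Classical in
lemma conductance_eq_iSup (x y : V) :
    conductance G x y = ⨆ F : Finset (V × V),
      finiteConductance x y (F.filter fun e => G.Adj e.1 e.2) := by
  have hsum : ∀ (f : V → ℝ) (F : Finset (V × V)),
      ∑ e ∈ F.filter (fun e => G.Adj e.1 e.2), ENNReal.ofReal ((f e.1 - f e.2) ^ 2) =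
        ∑ e ∈ F, pairEnergy G f e := by
    intro f F
    rw [Finset.sum_filter]
    refine Finset.sum_congr rfl fun e _ => ?_
    rw [pairEnergy, Set.indicator_apply]
    rfl
  apply le_antisymm
  · refine le_of_forall_gt fun c hc => ?_
    obtain ⟨b, hb, hbc⟩ := exists_between hc
    refine lt_of_le_of_lt ?_ hbc
    let K : Finset (V × V) → Set (V → ℝ) := fun F =>
      {f | ((f x = 1 ∧ f y = 0) ∧ ∀ v, f v ∈ Set.Icc (0 : ℝ) 1) ∧
        2⁻¹ * ∑ e ∈ F, pairEnergy G f e ≤ b}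
    have hclosed : ∀ F, IsClosed (K F) := by
      intro F
      have h1 : IsClosed {f : V → ℝ | f x = 1 ∧ f y = 0} :=
        (isClosed_eq (continuous_apply x) continuous_const).inter
          (isClosed_eq (continuous_apply y) continuous_const)
      have h2 : IsClosed {f : V → ℝ | ∀ v, f v ∈ Set.Icc (0 : ℝ) 1} := by
        simp only [Set.ofPred_forall]
        exact isClosed_iInter fun v => isClosed_Icc.preimage (continuous_apply v)
      have h3 : IsClosed {f : V → ℝ | 2⁻¹ * ∑ e ∈ F, pairEnergy G f e ≤ b} := by
        refine isClosed_le ?_ continuous_const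
        refine ENNReal.continuous_const_mul (by simp) |>.comp ?_
        refine continuous_finsetSum _ fun e _ => ?_
        by_cases he : e ∈ {e : V × V | G.Adj e.1 e.2}
        · simp only [pairEnergy, Set.indicator_of_mem he]
          exact ENNReal.continuous_ofReal.comp (by fun_prop)
        · simp only [pairEnergy, Set.indicator_of_notMem he]
          fun_prop
      exact (h1.inter h2).inter h3
    have hcompact : ∀ F, IsCompact (K F) := fun F =>
      (isCompact_univ_pi fun _ : V => isCompact_Icc (a := (0 : ℝ)) (b := 1)).of_isClosed_subset
        (hclosed F) fun f hf v _ => hf.1.2 v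
    have hanti : ∀ F F' : Finset (V × V), F ⊆ F' → K F' ⊆ K F := fun F F' h f hf =>
      ⟨hf.1, le_trans (by gcongr) hf.2⟩
    have hne : ∀ F, (K F).Nonempty := by
      intro F
      have := (le_iSup (fun F : Finset (V × V) =>
        finiteConductance x y (F.filter fun e => G.Adj e.1 e.2)) F).trans_lt hb
      simp only [finiteConductance, iInf_lt_iff] at this
      obtain ⟨f, hf, hlt⟩ := this
      rw [hsum] at hlt
      exact ⟨f, hf, hlt.le⟩
    obtain ⟨f, hf⟩ := IsCompact.nonempty_iInter_of_directed_nonempty_isCompact_isClosed K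
      (fun F F' => ⟨F ∪ F', hanti _ _ Finset.subset_union_left,
        hanti _ _ Finset.subset_union_right⟩) hne hcompact hclosed
    rw [Set.mem_iInter] at hf
    refine (iInf₂_le f (hf ∅).1.1).trans ?_
    rw [dirichletEnergy_eq_tsum, ENNReal.tsum_eq_iSup_sum, ENNReal.mul_iSup]
    exact iSup_le fun F => (hf F).2
  · refine iSup_le fun F => le_iInf₂ fun f ⟨hx, hy⟩ => ?_
    refine (iInf₂_le (fun v => max 0 (min (f v) 1)) ⟨⟨by simp [hx], by simp [hy]⟩, fun v =>
      ⟨le_max_left _ _, by simp⟩⟩).trans ?_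
    rw [hsum (fun v => max 0 (min (f v) 1)), dirichletEnergy_eq_tsum]
    refine mul_le_mul_right ((ENNReal.sum_le_tsum F).trans (ENNReal.tsum_le_tsum fun e => ?_)) _
    refine (pairEnergy_mono (c := 1) (f := f) e ?_).trans (by simp)
    rw [one_mul, sq_le_sq]
    have h1 := abs_max_sub_max_le_abs (min (f e.1) 1) (min (f e.2) 1) 0
    rw [max_comm, max_comm (min (f e.2) 1)] at h1
    exact h1.trans ((abs_min_sub_min_le_max _ _ _ _).trans (by simp))

/-- The infimum runs over uncountably many potentials. After `conductance_eq_iSup` it is a countable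
supremum, and each term depends on the graph only through a random finite set of pairs, which takes
countably many values. -/
theorem measurable_effectiveResistance {Ω : Type*} [MeasurableSpace Ω] [Countable V]
    {G : Ω → SimpleGraph V} (hG : ∀ u v, MeasurableSet {ω | (G ω).Adj u v}) (x y : V) :
    Measurable fun ω => effectiveResistance (G ω) x y := by
  classical
  simp only [effectiveResistance_eq]
  refine Measurable.inv ?_
  simp only [conductance_eq_iSup]
  refine Measurable.iSup fun F => ?_
  have hm : Measurable[_, ⊤] fun ω => F.filter fun e => (G ω).Adj e.1 e.2 := by
    let _ : MeasurableSpace (Finset (V × V)) := ⊤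
    refine measurable_to_countable' fun S => ?_
    have : (fun ω => F.filter fun e => (G ω).Adj e.1 e.2) ⁻¹' {S} =
        ⋂ e : V × V, {ω | (e ∈ F ∧ (G ω).Adj e.1 e.2) ↔ e ∈ S} := by
      ext ω
      simp [Finset.ext_iff]
    rw [this]
    refine .iInter fun e => ?_
    exact ((MeasurableSet.const _).inter (hG _ _)).iff (MeasurableSet.const _)
  exact (measurable_from_top (f := finiteConductance x y)).comp hm

end EffectiveResistance

/-! ### Graph distance: cut vertices and measurability -/

section GraphDistance

variable {V : Type*} {G : SimpleGraph V}

/-- The first edge of the walk that leaves `A` starts at `y`; split the walk there. -/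
lemma exists_walks_of_cut {A : Set V} {y z : V} (hz : z ∉ A)
    (hA : ∀ u ∈ A, ∀ v ∉ A, G.Adj u v → u = y) {x : V} (p : G.Walk x z) (hx : x ∈ A) :
    ∃ (q : G.Walk x y) (r : G.Walk y z), q.length + r.length ≤ p.length := by
  induction p with
  | nil => exact absurd hx hz
  | @cons u v w h p ih =>
    by_cases hv : v ∈ A
    · obtain ⟨q, r, hqr⟩ := ih hz hv
      exact ⟨.cons h q, r, by simp only [SimpleGraph.Walk.length_cons]; omega⟩
    · obtain rfl := hA u hx v hv h
      exact ⟨.nil, .cons h p, by simp⟩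

/-- Graph distances add up across a cut vertex `y`. -/
theorem dist_add_dist_le_of_cut {A : Set V} {x y z : V} (hx : x ∈ A) (hz : z ∉ A)
    (hA : ∀ u ∈ A, ∀ v ∉ A, G.Adj u v → u = y) (hr : G.Reachable x z) :
    G.dist x y + G.dist y z ≤ G.dist x z := by
  obtain ⟨p, hp⟩ := hr.exists_walk_length_eq_dist
  obtain ⟨q, r, h⟩ := exists_walks_of_cut hz hA p hx
  have := SimpleGraph.dist_le q
  have := SimpleGraph.dist_le r
  omega

lemma dist_congr {W : Type*} {H : SimpleGraph W} (e : G ≃g H) (x y : V) :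
    H.dist (e x) (e y) = G.dist x y := by
  rw [SimpleGraph.dist_eq_sInf, SimpleGraph.dist_eq_sInf]
  congr 1
  ext n
  refine ⟨?_, ?_⟩
  · rintro ⟨p, hp⟩
    exact ⟨(p.map e.symm.toHom).copy (e.symm_apply_apply x) (e.symm_apply_apply y),
      by simpa using hp⟩
  · rintro ⟨p, hp⟩
    exact ⟨p.map e.toHom, by simpa using hp⟩

lemma measurable_sInf_nat {Ω : Type*} [MeasurableSpace Ω] {P : Ω → ℕ → Prop}
    (hP : ∀ n, MeasurableSet {ω | P ω n}) : Measurable fun ω => sInf {n | P ω n} := by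
  refine measurable_to_countable' fun k => ?_
  have hlt : MeasurableSet {ω | P ω k ∧ ∀ j < k, ¬ P ω j} := by
    have : {ω | ∀ j < k, ¬ P ω j} = ⋂ j, ⋂ _ : j < k, {ω | P ω j}ᶜ := by ext; simp
    have h : MeasurableSet {ω | ∀ j < k, ¬ P ω j} := by
      rw [this]; exact .iInter fun j => .iInter fun _ => (hP j).compl
    exact (hP k).inter h
  -- Since `sInf ∅ = 0`, the fibre over `0` also contains the event that no `n` satisfies `P`.
  have hnone : MeasurableSet {ω | k = 0 ∧ ∀ j, ¬ P ω j} := by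
    have : {ω | ∀ j, ¬ P ω j} = ⋂ j, {ω | P ω j}ᶜ := by ext; simp
    have h : MeasurableSet {ω | ∀ j, ¬ P ω j} := by
      rw [this]; exact .iInter fun j => (hP j).compl
    exact (MeasurableSet.const _).inter h
  convert hlt.union hnone using 1
  ext ω
  simp only [Set.mem_preimage, Set.mem_singleton_iff, Set.mem_union, Set.mem_ofPred_eq]
  constructor
  · rintro rfl
    rcases Set.eq_empty_or_nonempty {n | P ω n} with h | h
    · right
      exact ⟨by rw [h, Nat.sInf_empty], fun j hj => by
        have : j ∈ {n | P ω n} := hj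
        rw [h] at this; exact this⟩
    · exact Or.inl ⟨Nat.sInf_mem h, fun j hj => Nat.notMem_of_lt_sInf hj⟩
  · rintro (⟨h1, h2⟩ | ⟨rfl, h⟩)
    · exact le_antisymm (Nat.sInf_le h1) (le_csInf ⟨k, h1⟩ fun j hj => by
        by_contra hlt
        exact h2 j (not_le.1 hlt) hj)
    · have : {n | P ω n} = ∅ := Set.eq_empty_of_forall_notMem h
      rw [this, Nat.sInf_empty]

theorem measurable_dist {Ω : Type*} [MeasurableSpace Ω] [Countable V]
    {G : Ω → SimpleGraph V} (hG : ∀ u v, MeasurableSet {ω | (G ω).Adj u v}) (x y : V) :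
    Measurable fun ω => (G ω).dist x y := by
  have hwalk : ∀ (n : ℕ) (x : V), MeasurableSet {ω | ∃ p : (G ω).Walk x y, p.length = n} := by
    intro n
    induction n with
    | zero =>
      intro x
      have : {ω | ∃ p : (G ω).Walk x y, p.length = 0} = {_ω | x = y} := by
        ext ω
        constructor
        · rintro ⟨p, hp⟩; exact SimpleGraph.Walk.eq_of_length_eq_zero hp
        · rintro rfl; exact ⟨.nil, rfl⟩
      rw [this]
      exact .const _
    | succ n ih =>
      intro x
      have : {ω | ∃ p : (G ω).Walk x y, p.length = n + 1} =
          ⋃ z, {ω | (G ω).Adj x z} ∩ {ω | ∃ p : (G ω).Walk z y, p.length = n} := by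
        ext ω
        simp only [Set.mem_iUnion, Set.mem_inter_iff, Set.mem_ofPred_eq]
        constructor
        · rintro ⟨p, hp⟩
          cases p with
          | nil => simp at hp
          | cons h q => exact ⟨_, h, q, by simpa using hp⟩
        · rintro ⟨z, h, q, hq⟩
          exact ⟨.cons h q, by simpa using hq⟩
      rw [this]
      exact .iUnion fun z => (hG x z).inter (ih z)
  simp only [SimpleGraph.dist_eq_sInf]
  exact measurable_sInf_nat (P := fun ω n => ∃ p : (G ω).Walk x y, p.length = n) fun n => hwalk n x

end GraphDistance

end BRW

namespace BRW

/-! ### Heat kernel of the simple random walk -/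

section HeatKernel

variable {d : ℕ}

/-- The transition probabilities of the simple random walk on `ℤ ^ d`. -/
noncomputable def heatKernel : ℕ → (Fin d → ℤ) → ℝ
  | 0, x => if x = 0 then 1 else 0
  | n + 1, x => (2 * d : ℝ)⁻¹ * ∑ e : Direction d, heatKernel n (x - e.vec)

lemma heatKernel_nonneg (n : ℕ) (x : Fin d → ℤ) : 0 ≤ heatKernel n x := by
  induction n generalizing x with
  | zero => rw [heatKernel]; split_ifs <;> norm_num
  | succ n ih => rw [heatKernel]; exact mul_nonneg (by positivity) (Finset.sum_nonneg fun e _ => ih _)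

lemma abs_vec_le (e : Direction d) (i : Fin d) : |e.vec i| ≤ 1 := by
  rw [Direction.vec, Pi.single_apply]
  split_ifs <;> simp

lemma heatKernel_eq_zero {n : ℕ} {x : Fin d → ℤ} {i : Fin d} (h : (n : ℤ) < |x i|) :
    heatKernel n x = 0 := by
  induction n generalizing x with
  | zero =>
    rw [heatKernel, if_neg]
    rintro rfl
    simp at h
  | succ n ih =>
    rw [heatKernel, Finset.sum_eq_zero, mul_zero]
    intro e _
    apply ih
    have h1 := abs_vec_le e i
    have h2 := abs_sub_abs_le_abs_sub (x i) (e.vec i)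
    simp only [Pi.sub_apply]
    push_cast at h
    omega

/-- The measure of integration on the dual torus. -/
noncomputable def torusMeasure (d : ℕ) : Measure (Fin d → ℝ) :=
  Measure.pi fun _ => volume.restrict (Set.Ioc 0 (2 * Real.pi))

noncomputable instance : IsFiniteMeasure (torusMeasure d) := by
  unfold torusMeasure; infer_instance

/-- The characteristic function of a step of the simple random walk. -/
noncomputable def stepChar (θ : Fin d → ℝ) : ℝ := (d : ℝ)⁻¹ * ∑ i, Real.cos (θ i)

lemma abs_stepChar_le (θ : Fin d → ℝ) :
    |stepChar θ| ≤ (d : ℝ)⁻¹ * ∑ i, |Real.cos (θ i)| := by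
  rw [stepChar, abs_mul, abs_of_nonneg (by positivity : (0 : ℝ) ≤ (d : ℝ)⁻¹)]
  gcongr
  exact Finset.abs_sum_le_sum_abs _ _

lemma abs_stepChar_le_one (θ : Fin d → ℝ) : |stepChar θ| ≤ 1 := by
  refine (abs_stepChar_le θ).trans ?_
  have : ∑ i, |Real.cos (θ i)| ≤ d := by
    refine (Finset.sum_le_sum fun i _ => Real.abs_cos_le_one (θ i)).trans (by simp)
  calc (d : ℝ)⁻¹ * ∑ i, |Real.cos (θ i)| ≤ (d : ℝ)⁻¹ * d := by gcongr
    _ ≤ 1 := inv_mul_le_one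

lemma continuous_stepChar : Continuous (stepChar : (Fin d → ℝ) → ℝ) := by
  unfold stepChar; fun_prop

lemma integral_cexp_int (n : ℤ) :
    ∫ t in Set.Ioc 0 (2 * Real.pi), Complex.exp (Complex.I * (t * n)) =
      if n = 0 then 2 * (Real.pi : ℂ) else 0 := by
  rw [← intervalIntegral.integral_of_le (by positivity)]
  split_ifs with h
  · simp [h]
  · have hc : Complex.I * n ≠ 0 := mul_ne_zero Complex.I_ne_zero (by exact_mod_cast h)
    have := integral_exp_mul_complex (a := 0) (b := 2 * Real.pi) hc
    rw [show (fun t : ℝ => Complex.exp (Complex.I * (t * n))) =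
      fun t : ℝ => Complex.exp (Complex.I * n * t) by ext; ring_nf, this]
    have h1 : Complex.exp (Complex.I * n * ((2 * Real.pi : ℝ) : ℂ)) = 1 := by
      rw [← Complex.exp_int_mul_two_pi_mul_I n]
      push_cast
      ring_nf
    rw [h1]
    simp

lemma integral_cos_torus (x : Fin d → ℤ) :
    ∫ θ, Real.cos (∑ i, θ i * x i) ∂torusMeasure d =
      (2 * Real.pi) ^ d * if x = 0 then 1 else 0 := by
  have h1 : ∀ θ : Fin d → ℝ, Real.cos (∑ i, θ i * x i) =
      (∏ i, Complex.exp (Complex.I * (θ i * x i))).re := by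
    intro θ
    rw [← Complex.exp_sum, ← Finset.mul_sum, mul_comm Complex.I]
    have : (∑ i, (θ i : ℂ) * x i) = ((∑ i, θ i * x i : ℝ) : ℂ) := by push_cast; rfl
    rw [this, Complex.exp_ofReal_mul_I_re]
  simp_rw [h1]
  have hint : Integrable (fun θ : Fin d → ℝ => ∏ i, Complex.exp (Complex.I * (θ i * x i)))
      (torusMeasure d) := by
    refine Integrable.of_bound (C := 1) (Continuous.aestronglyMeasurable (by fun_prop))
      (Eventually.of_forall fun θ => ?_)
    rw [norm_prod]
    refine Finset.prod_le_one (fun _ _ => norm_nonneg _) fun i _ => ?_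
    rw [mul_comm Complex.I, ← Complex.ofReal_intCast, ← Complex.ofReal_mul,
      Complex.norm_exp_ofReal_mul_I]
  have h2 := integral_re hint
  simp only [RCLike.re_eq_complex_re] at h2
  rw [h2, torusMeasure,
    integral_fintype_prod_eq_prod (𝕜 := ℂ) (fun i (t : ℝ) => Complex.exp (Complex.I * (t * x i)))]
  simp_rw [integral_cexp_int]
  split_ifs with h
  · simp only [h, Pi.zero_apply, if_true, Finset.prod_const, Finset.card_univ, Fintype.card_fin,
      mul_one]
    norm_cast
  · obtain ⟨i, hi⟩ := Function.ne_iff.1 h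
    rw [Finset.prod_eq_zero (Finset.mem_univ i) (if_neg hi)]
    simp

lemma integrable_stepChar_pow_mul_cos (n : ℕ) (x : Fin d → ℤ) :
    Integrable (fun θ => stepChar θ ^ n * Real.cos (∑ i, θ i * x i)) (torusMeasure d) := by
  refine Integrable.of_bound (C := 1) ?_ (Eventually.of_forall fun θ => ?_)
  · exact ((continuous_stepChar.pow n).mul (by fun_prop)).aestronglyMeasurable
  · rw [norm_mul, norm_pow, Real.norm_eq_abs, Real.norm_eq_abs]
    exact mul_le_one₀ (pow_le_one₀ (abs_nonneg _) (abs_stepChar_le_one θ)) (abs_nonneg _)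
      (Real.abs_cos_le_one _)

lemma sum_cos_sub_vec (θ : Fin d → ℝ) (x : Fin d → ℤ) :
    ∑ e : Direction d, Real.cos (∑ i, θ i * ((x - e.vec) i : ℤ)) =
      2 * (∑ i, Real.cos (θ i)) * Real.cos (∑ i, θ i * x i) := by
  have h : ∀ e : Direction d, ∑ i, θ i * ((x - e.vec) i : ℤ) =
      ∑ i, θ i * x i - θ e.1 * (if e.2 then 1 else -1) := by
    intro e
    simp only [Pi.sub_apply, Int.cast_sub, mul_sub, Finset.sum_sub_distrib, Direction.vec,
      Pi.single_apply]
    congr 1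
    rw [Finset.sum_eq_single e.1]
    · simp only [if_true]; split_ifs <;> simp
    · intro j _ hj; simp [hj]
    · simp
  simp_rw [h]
  rw [Fintype.sum_prod_type]
  simp only [Fintype.sum_bool, if_true, Bool.false_eq_true, if_false, mul_neg, mul_one,
    sub_neg_eq_add]
  rw [Finset.mul_sum, Finset.sum_mul]
  refine Finset.sum_congr rfl fun i _ => ?_
  rw [Real.cos_sub, Real.cos_add]
  ring

/-- Fourier inversion. The step law is symmetric, so real cosines suffice: by `sum_cos_sub_vec`, one
more step multiplies the integrand by `stepChar`. -/
lemma heatKernel_eq_integral [NeZero d] (n : ℕ) (x : Fin d → ℤ) :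
    (2 * Real.pi) ^ d * heatKernel n x =
      ∫ θ, stepChar θ ^ n * Real.cos (∑ i, θ i * x i) ∂torusMeasure d := by
  induction n generalizing x with
  | zero => simp [integral_cos_torus, heatKernel]
  | succ n ih =>
    rw [heatKernel, mul_left_comm, Finset.mul_sum]
    simp_rw [ih]
    rw [← integral_finsetSum _ fun e _ => integrable_stepChar_pow_mul_cos n _,
      ← integral_const_mul]
    refine integral_congr_ae (Eventually.of_forall fun θ => ?_)
    simp only
    rw [← Finset.mul_sum, sum_cos_sub_vec, pow_succ]
    have hd : (d : ℝ) ≠ 0 := by exact_mod_cast NeZero.ne d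
    rw [stepChar]
    field_simp

/-- The zeros of `sin` on the interval are `0`, `π` and `2π`. Every `t` is within `π / 2` of one of
them, where Jordan's inequality `|sin s| ≥ 2|s| / π` produces a Gaussian. The peak at `π` reflects
the parity of the walk. -/
lemma exp_neg_mul_sin_sq_le {a t : ℝ} (ha : 0 ≤ a) (ht : t ∈ Set.Ioc 0 (2 * Real.pi)) :
    Real.exp (-(a * Real.sin t ^ 2)) ≤
      Real.exp (-(a * (4 / Real.pi ^ 2)) * t ^ 2) +
      Real.exp (-(a * (4 / Real.pi ^ 2)) * (t - Real.pi) ^ 2) +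
      Real.exp (-(a * (4 / Real.pi ^ 2)) * (t - 2 * Real.pi) ^ 2) := by
  have hpi := Real.pi_pos
  have key : ∀ c : ℝ, |t - c| ≤ Real.pi / 2 → Real.sin (t - c) ^ 2 = Real.sin t ^ 2 →
      Real.exp (-(a * Real.sin t ^ 2)) ≤ Real.exp (-(a * (4 / Real.pi ^ 2)) * (t - c) ^ 2) := by
    intro c hc hs
    rw [← hs, Real.exp_le_exp]
    have h1 := Real.mul_abs_le_abs_sin hc
    have h2 : (2 / Real.pi * |t - c|) ^ 2 ≤ |Real.sin (t - c)| ^ 2 := by gcongr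
    rw [sq_abs, mul_pow, sq_abs, div_pow] at h2
    have h3 := mul_le_mul_of_nonneg_left h2 ha
    have : (2 : ℝ) ^ 2 = 4 := by norm_num
    rw [this] at h3
    linarith
  rcases le_or_gt t (Real.pi / 2) with h | h
  · have := key 0 (by rw [abs_le]; constructor <;> linarith [ht.1]) (by simp)
    rw [sub_zero] at this
    linarith [Real.exp_pos (-(a * (4 / Real.pi ^ 2)) * (t - Real.pi) ^ 2),
      Real.exp_pos (-(a * (4 / Real.pi ^ 2)) * (t - 2 * Real.pi) ^ 2)]
  · rcases le_or_gt t (3 * Real.pi / 2) with h' | h'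
    · have := key Real.pi (by rw [abs_le]; constructor <;> linarith) (by
        rw [Real.sin_sub_pi, neg_sq])
      linarith [Real.exp_pos (-(a * (4 / Real.pi ^ 2)) * t ^ 2),
        Real.exp_pos (-(a * (4 / Real.pi ^ 2)) * (t - 2 * Real.pi) ^ 2)]
    · have := key (2 * Real.pi) (by rw [abs_le]; constructor <;> linarith [ht.2]) (by
        rw [Real.sin_sub_two_pi])
      linarith [Real.exp_pos (-(a * (4 / Real.pi ^ 2)) * t ^ 2),
        Real.exp_pos (-(a * (4 / Real.pi ^ 2)) * (t - Real.pi) ^ 2)]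

lemma integral_exp_neg_mul_sin_sq_le {a : ℝ} (ha : 0 < a) :
    ∫ t in Set.Ioc 0 (2 * Real.pi), Real.exp (-(a * Real.sin t ^ 2)) ≤
      3 * √(Real.pi ^ 3 / (4 * a)) := by
  have hpi := Real.pi_pos
  set b := a * (4 / Real.pi ^ 2) with hb
  have hb0 : 0 < b := by positivity
  have hI : ∀ c : ℝ, Integrable (fun t : ℝ => Real.exp (-b * (t - c) ^ 2)) := fun c =>
    (integrable_exp_neg_mul_sq hb0).comp_sub_right c
  have hI0 := integrable_exp_neg_mul_sq hb0
  have hval : ∀ c : ℝ, ∫ t : ℝ, Real.exp (-b * (t - c) ^ 2) = √(Real.pi / b) := fun c => by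
    rw [integral_sub_right_eq_self (fun t => Real.exp (-b * t ^ 2)) c, integral_gaussian]
  calc ∫ t in Set.Ioc 0 (2 * Real.pi), Real.exp (-(a * Real.sin t ^ 2))
      ≤ ∫ t in Set.Ioc 0 (2 * Real.pi), (Real.exp (-b * t ^ 2) + Real.exp (-b * (t - Real.pi) ^ 2)
          + Real.exp (-b * (t - 2 * Real.pi) ^ 2)) := by
        refine setIntegral_mono_on ?_ (((hI0.add (hI _)).add (hI _)).integrableOn)
          measurableSet_Ioc fun t ht => exp_neg_mul_sin_sq_le ha.le ht
        exact (Continuous.integrableOn_Ioc (by fun_prop))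
    _ ≤ ∫ t : ℝ, (Real.exp (-b * t ^ 2) + Real.exp (-b * (t - Real.pi) ^ 2)
          + Real.exp (-b * (t - 2 * Real.pi) ^ 2)) :=
        setIntegral_le_integral ((hI0.add (hI _)).add (hI _))
          (Eventually.of_forall fun t => by positivity)
    _ = 3 * √(Real.pi / b) := by
        rw [integral_add (f := fun t => Real.exp (-b * t ^ 2) + Real.exp (-b * (t - Real.pi) ^ 2))
          (hI0.add (hI _)) (hI _), integral_add hI0 (hI _), hval, hval,
          integral_gaussian]
        ring
    _ = 3 * √(Real.pi ^ 3 / (4 * a)) := by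
        congr 2
        rw [hb]
        field_simp

lemma abs_stepChar_pow_le [NeZero d] (n : ℕ) (θ : Fin d → ℝ) :
    |stepChar θ| ^ n ≤ ∏ i, Real.exp (-((n / (2 * d) : ℝ) * Real.sin (θ i) ^ 2)) := by
  have hd : (0 : ℝ) < d := by exact_mod_cast NeZero.pos d
  have h1 : |stepChar θ| ≤ Real.exp (-((2 * d : ℝ)⁻¹ * ∑ i, Real.sin (θ i) ^ 2)) := by
    refine (abs_stepChar_le θ).trans (le_trans ?_ (Real.add_one_le_exp _))
    -- Uses `|c| ≤ (1 + c²) / 2 = 1 - sin² / 2` for each cosine `c`.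
    have h2 : ∑ i, |Real.cos (θ i)| ≤ ∑ i, (1 - Real.sin (θ i) ^ 2 / 2) := by
      refine Finset.sum_le_sum fun i _ => ?_
      have := Real.sin_sq_add_cos_sq (θ i)
      nlinarith [sq_abs (Real.cos (θ i)), sq_nonneg (1 - |Real.cos (θ i)|)]
    rw [Finset.sum_sub_distrib, ← Finset.sum_div] at h2
    simp only [Finset.sum_const, Finset.card_univ, Fintype.card_fin, nsmul_eq_mul, mul_one] at h2
    calc (d : ℝ)⁻¹ * ∑ i, |Real.cos (θ i)| ≤ (d : ℝ)⁻¹ * (d - (∑ i, Real.sin (θ i) ^ 2) / 2) := by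
          gcongr
      _ = _ := by field_simp; ring
  calc |stepChar θ| ^ n ≤ Real.exp (-((2 * d : ℝ)⁻¹ * ∑ i, Real.sin (θ i) ^ 2)) ^ n := by gcongr
    _ = _ := by
      rw [← Real.exp_nat_mul, ← Real.exp_sum, Finset.sum_neg_distrib, ← Finset.mul_sum]
      congr 1
      field_simp

lemma heatKernel_le_pow [NeZero d] {n : ℕ} (hn : 0 < n) (x : Fin d → ℤ) :
    heatKernel n x ≤ (3 * √(Real.pi * d / 8) * (√n)⁻¹) ^ d := by
  have hd : (0 : ℝ) < d := by exact_mod_cast NeZero.pos d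
  have hn' : (0 : ℝ) < n := by exact_mod_cast hn
  have hpi := Real.pi_pos
  have h1 : (2 * Real.pi) ^ d * heatKernel n x ≤
      (3 * √(Real.pi ^ 3 / (4 * (n / (2 * d))))) ^ d := by
    rw [heatKernel_eq_integral]
    calc ∫ θ, stepChar θ ^ n * Real.cos (∑ i, θ i * x i) ∂torusMeasure d
        ≤ ∫ θ, ∏ i, Real.exp (-((n / (2 * d) : ℝ) * Real.sin (θ i) ^ 2)) ∂torusMeasure d := by
          refine integral_mono (integrable_stepChar_pow_mul_cos n x) ?_ fun θ => ?_
          · refine Integrable.of_bound (C := 1) (Continuous.aestronglyMeasurable (by fun_prop))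
              (Eventually.of_forall fun θ => ?_)
            rw [norm_prod]
            refine Finset.prod_le_one (fun _ _ => norm_nonneg _) fun i _ => ?_
            rw [Real.norm_eq_abs, Real.abs_exp, Real.exp_le_one_iff, neg_nonpos]
            positivity
          · refine le_trans ?_ (abs_stepChar_pow_le n θ)
            refine (le_abs_self _).trans ?_
            rw [abs_mul, abs_pow]
            exact mul_le_of_le_one_right (by positivity) (Real.abs_cos_le_one _)
      _ = ∏ _i : Fin d, ∫ t in Set.Ioc 0 (2 * Real.pi),
            Real.exp (-((n / (2 * d) : ℝ) * Real.sin t ^ 2)) := by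
          rw [torusMeasure, integral_fintype_prod_eq_prod (𝕜 := ℝ)
            (fun _ (t : ℝ) => Real.exp (-((n / (2 * d) : ℝ) * Real.sin t ^ 2)))]
      _ ≤ _ := by
          rw [Finset.prod_const, Finset.card_univ, Fintype.card_fin]
          exact pow_le_pow_left₀ (setIntegral_nonneg measurableSet_Ioc fun t _ => (Real.exp_pos _).le)
            (integral_exp_neg_mul_sin_sq_le (by positivity)) d
  have h2 : 3 * √(Real.pi ^ 3 / (4 * (n / (2 * d)))) =
      2 * Real.pi * (3 * √(Real.pi * d / 8) * (√n)⁻¹) := by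
    have : Real.pi ^ 3 / (4 * (n / (2 * d))) = (2 * Real.pi) ^ 2 * (Real.pi * d / 8) * (n : ℝ)⁻¹ := by
      field_simp
      ring
    rw [this, Real.sqrt_mul (by positivity), Real.sqrt_mul (by positivity),
      Real.sqrt_sq (by positivity), Real.sqrt_inv]
    ring
  rw [h2, mul_pow (2 * Real.pi)] at h1
  exact le_of_mul_le_mul_left h1 (by positivity)

/-- The heat kernel of the simple random walk in dimension at least `11` decays like
`n ^ (-11 / 2)`. -/
theorem exists_heatKernel_le [NeZero d] (hd : 10 < d) :
    ∃ C : ℝ, 0 ≤ C ∧ ∀ n (x : Fin d → ℤ), heatKernel n x ≤ C * ((n : ℝ) + 1) ^ (-(11 / 2) : ℝ) := by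
  set K : ℝ := (3 * √(Real.pi * d / 8)) ^ d with hK
  have hK0 : 0 ≤ K := by positivity
  -- The power of `2` turns `n` into `n + 1` when `n ≥ 1`; the summand `1` covers `n = 0`, where the
  -- previous bound is not available.
  refine ⟨K * 2 ^ (11 / 2 : ℝ) + 1, by positivity, fun n x => ?_⟩
  rcases Nat.eq_zero_or_pos n with rfl | hn
  · have : heatKernel 0 x ≤ 1 := by rw [heatKernel]; split_ifs <;> norm_num
    simp only [Nat.cast_zero, zero_add, Real.one_rpow, mul_one]
    have : 0 ≤ K * 2 ^ (11 / 2 : ℝ) := by positivity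
    linarith
  · have hn1 : (1 : ℝ) ≤ n := by exact_mod_cast hn
    have hn0 : (0 : ℝ) < n := by linarith
    have h1 : (√(n : ℝ))⁻¹ ^ d ≤ (n : ℝ) ^ (-(11 / 2) : ℝ) := by
      rw [inv_pow, Real.rpow_neg hn0.le]
      gcongr
      rw [Real.sqrt_eq_rpow, ← Real.rpow_natCast, ← Real.rpow_mul hn0.le]
      refine Real.rpow_le_rpow_of_exponent_le hn1 ?_
      have : (11 : ℝ) ≤ d := by exact_mod_cast hd
      linarith
    have h2 : (n : ℝ) ^ (-(11 / 2) : ℝ) ≤ 2 ^ (11 / 2 : ℝ) * ((n : ℝ) + 1) ^ (-(11 / 2) : ℝ) := by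
      rw [Real.rpow_neg hn0.le, Real.rpow_neg (by positivity), ← div_eq_mul_inv,
        ← Real.div_rpow (by positivity) (by positivity), ← Real.inv_rpow hn0.le]
      refine Real.rpow_le_rpow (by positivity) ?_ (by norm_num)
      · rw [inv_le_comm₀ hn0 (by positivity), inv_div, div_le_iff₀ (by norm_num)]
        linarith
    have h3 := heatKernel_le_pow hn x
    rw [mul_pow] at h3
    have h4 : 0 ≤ ((n : ℝ) + 1) ^ (-(11 / 2) : ℝ) := by positivity
    calc heatKernel n x ≤ K * (√(n : ℝ))⁻¹ ^ d := h3
      _ ≤ K * (2 ^ (11 / 2 : ℝ) * ((n : ℝ) + 1) ^ (-(11 / 2) : ℝ)) := by gcongr; exact h1.trans h2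
      _ ≤ _ := by nlinarith

end HeatKernel

end BRW

namespace BRW

/-! ### The model: shift covariance, cut points, metrics along the backbone -/

section Model

variable {d : ℕ}

/-! #### The backbone and the shift -/

@[simp] lemma backbone_zero (ω : Sample d) : backbone ω 0 = 0 := by simp [backbone]

lemma backbone_add_one (ω : Sample d) (n : ℤ) :
    backbone ω (n + 1) = backbone ω n + (ω (n + 1) []).2.vec := by
  rcases le_or_gt 0 n with h | h
  · have h1 : Finset.Ioc 0 (n + 1) = insert (n + 1) (Finset.Ioc 0 n) := by
      ext k; simp only [Finset.mem_insert, Finset.mem_Ioc]; omega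
    rw [backbone, backbone, h1, Finset.sum_insert (by simp),
      Finset.Ioc_eq_empty_of_le (show 0 ≤ n + 1 by omega), Finset.Ioc_eq_empty_of_le h]
    simp [add_comm]
  · have h1 : Finset.Ioc n 0 = insert (n + 1) (Finset.Ioc (n + 1) 0) := by
      ext k; simp only [Finset.mem_insert, Finset.mem_Ioc]; omega
    rw [backbone, backbone, h1, Finset.sum_insert (by simp),
      Finset.Ioc_eq_empty_of_le (show n + 1 ≤ 0 by omega), Finset.Ioc_eq_empty_of_le h.le]
    simp

lemma backbone_sub_backbone (ω : Sample d) {i j : ℤ} (h : i ≤ j) :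
    backbone ω j - backbone ω i = ∑ k ∈ Finset.Ioc i j, (ω k []).2.vec := by
  induction j, h using Int.leInduction with
  | base => simp
  | succ j hj ih =>
    have h1 : Finset.Ioc i (j + 1) = insert (j + 1) (Finset.Ioc i j) := by
      ext k; simp only [Finset.mem_insert, Finset.mem_Ioc]; omega
    rw [h1, Finset.sum_insert (by simp), ← ih, backbone_add_one]
    abel

lemma backbone_shift (ω : Sample d) (n : ℤ) :
    backbone (shift ω) n = backbone ω (n + 1) - backbone ω 1 := by
  have step : ∀ n : ℤ, backbone (shift ω) n = backbone ω (n + 1) - backbone ω 1 ↔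
      backbone (shift ω) (n + 1) = backbone ω (n + 1 + 1) - backbone ω 1 := by
    intro n
    rw [backbone_add_one (shift ω), backbone_add_one ω (n + 1), shift, add_sub_right_comm,
      add_left_inj]
  induction n using Int.induction_on with
  | zero => simp
  | succ n ih => exact (step _).1 ih
  | pred n ih =>
    rw [step, show (-(n : ℤ) - 1 + 1) = -n by ring]
    exact ih

lemma inTree_shift (ω : Sample d) (n : ℤ) (u : List ℕ) :
    InTree (shift ω) n u ↔ InTree ω (n + 1) u := by
  induction u with
  | nil => rfl
  | cons i u ih => simp only [InTree, ih]; rfl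

lemma displacement_shift (ω : Sample d) (n : ℤ) (u : List ℕ) :
    displacement (shift ω) n u = displacement ω (n + 1) u := by
  induction u with
  | nil => rfl
  | cons i u ih => simp only [displacement, ih]; rfl

lemma position_shift (ω : Sample d) (n : ℤ) (u : List ℕ) :
    position (shift ω) (n, u) = position ω (n + 1, u) - backbone ω 1 := by
  simp only [position, backbone_shift, displacement_shift]
  abel

lemma tree_shift_adj (ω : Sample d) (n m : ℤ) (u v : List ℕ) :
    (tree (shift ω)).Adj (n, u) (m, v) ↔ (tree ω).Adj (n + 1, u) (m + 1, v) := by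
  simp only [tree, SimpleGraph.fromRel_adj, inTree_shift, Prod.mk.injEq, ne_eq, add_left_inj]

lemma trace_shift_adj (ω : Sample d) (x y : Fin d → ℤ) :
    (trace ω).Adj (x + backbone ω 1) (y + backbone ω 1) ↔ (trace (shift ω)).Adj x y := by
  have key : ∀ x y : Fin d → ℤ,
      (∃ a b, (tree ω).Adj a b ∧ position ω a = x + backbone ω 1 ∧
        position ω b = y + backbone ω 1) ↔
      ∃ a b, (tree (shift ω)).Adj a b ∧ position (shift ω) a = x ∧ position (shift ω) b = y := by
    intro x y
    constructor
    · rintro ⟨⟨n, u⟩, ⟨m, v⟩, h, hx, hy⟩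
      refine ⟨(n - 1, u), (m - 1, v), ?_, ?_, ?_⟩
      · rw [tree_shift_adj]; simpa using h
      · rw [position_shift, sub_add_cancel, hx, add_sub_cancel_right]
      · rw [position_shift, sub_add_cancel, hy, add_sub_cancel_right]
    · rintro ⟨⟨n, u⟩, ⟨m, v⟩, h, hx, hy⟩
      refine ⟨(n + 1, u), (m + 1, v), (tree_shift_adj _ _ _ _ _).1 h, ?_, ?_⟩
      · rw [← hx, position_shift, sub_add_cancel]
      · rw [← hy, position_shift, sub_add_cancel]
  simp only [trace, SimpleGraph.fromRel_adj, key, ne_eq, add_left_inj]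

/-- Translation by `α 1` identifies the trace of the shifted sample with the original trace. -/
noncomputable def traceShiftIso (ω : Sample d) : trace (shift ω) ≃g trace ω where
  toEquiv := Equiv.addRight (backbone ω 1)
  map_rel_iff' := trace_shift_adj ω _ _

lemma traceShiftIso_apply (ω : Sample d) (x : Fin d → ℤ) :
    traceShiftIso ω x = x + backbone ω 1 := rfl

lemma mem_branch_shift (ω : Sample d) (n : ℤ) (x : Fin d → ℤ) :
    x ∈ branch (shift ω) n ↔ x + backbone ω 1 ∈ branch ω (n + 1) := by
  simp only [branch, Set.mem_ofPred_eq, inTree_shift, position_shift, sub_eq_iff_eq_add]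

lemma isPivotal_iff (ω : Sample d) (i : ℤ) :
    IsPivotal ω i ↔ ∀ x, ∀ n ≤ i, ∀ m ≥ i + 1, x ∈ branch ω n → x ∉ branch ω m := by
  simp only [IsPivotal, Set.disjoint_left, Set.mem_iUnion, Set.mem_Iic, Set.mem_Ici]
  grind

lemma isPivotal_shift (ω : Sample d) (i : ℤ) : IsPivotal (shift ω) i ↔ IsPivotal ω (i + 1) := by
  simp only [isPivotal_iff, mem_branch_shift]
  constructor
  · intro h x n hn m hm hx
    have := h (x - backbone ω 1) (n - 1) (by omega) (m - 1) (by omega)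
    simp only [sub_add_cancel] at this
    exact this hx
  · intro h x n hn m hm hx
    exact h _ (n + 1) (by omega) (m + 1) (by omega) hx

/-! #### Pivotal points are cut points of the trace -/

lemma vec_ne_zero (e : Direction d) : e.vec ≠ 0 := by
  intro h
  have := congrFun h e.1
  rw [Direction.vec, Pi.single_eq_same] at this
  split_ifs at this; all_goals simp at this

lemma backbone_mem_branch (ω : Sample d) (n : ℤ) : backbone ω n ∈ branch ω n :=
  ⟨[], trivial, by simp [position, displacement]⟩

lemma trace_adj_backbone (ω : Sample d) (n : ℤ) :
    (trace ω).Adj (backbone ω n) (backbone ω (n + 1)) := by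
  rw [trace, SimpleGraph.fromRel_adj]
  refine ⟨fun h => vec_ne_zero (ω (n + 1) []).2 ?_, Or.inl ⟨(n, []), (n + 1, []), ?_, ?_, ?_⟩⟩
  · rw [backbone_add_one] at h
    simpa using h
  · rw [tree, SimpleGraph.fromRel_adj]
    exact ⟨by simp, Or.inl (Or.inl ⟨rfl, rfl⟩)⟩
  · simp [position, displacement]
  · simp [position, displacement]

lemma exists_of_trace_adj {ω : Sample d} {x y : Fin d → ℤ} (h : (trace ω).Adj x y) :
    (∃ n, x ∈ branch ω n ∧ y ∈ branch ω n) ∨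
      ∃ n, (x = backbone ω n ∧ y = backbone ω (n + 1)) ∨
        (y = backbone ω n ∧ x = backbone ω (n + 1)) := by
  have key : ∀ {a b : ℤ × List ℕ},
      ((a.2 = [] ∧ b = (a.1 + 1, [])) ∨ ∃ i : ℕ, b = (a.1, i :: a.2) ∧ InTree ω a.1 (i :: a.2)) →
      (∃ n, position ω a ∈ branch ω n ∧ position ω b ∈ branch ω n) ∨
      ∃ n, position ω a = backbone ω n ∧ position ω b = backbone ω (n + 1) := by
    rintro ⟨n, u⟩ ⟨m, v⟩ (⟨h1, h2⟩ | ⟨i, h1, h2⟩)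
    · simp only [Prod.mk.injEq] at h1 h2
      obtain ⟨rfl, rfl⟩ := h2
      subst h1
      exact Or.inr ⟨n, by simp [position, displacement], by simp [position, displacement]⟩
    · simp only [Prod.mk.injEq] at h1
      obtain ⟨rfl, rfl⟩ := h1
      exact Or.inl ⟨m, ⟨u, h2.1, rfl⟩, ⟨_, h2, rfl⟩⟩
  have key' : ∀ {x y : Fin d → ℤ}, (∃ a b, (tree ω).Adj a b ∧ position ω a = x ∧ position ω b = y) →
      (∃ n, x ∈ branch ω n ∧ y ∈ branch ω n) ∨
      ∃ n, (x = backbone ω n ∧ y = backbone ω (n + 1)) ∨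
        (y = backbone ω n ∧ x = backbone ω (n + 1)) := by
    rintro x y ⟨a, b, hab, rfl, rfl⟩
    rw [tree, SimpleGraph.fromRel_adj] at hab
    rcases hab.2 with h | h
    · rcases key h with h | ⟨n, h⟩
      · exact Or.inl h
      · exact Or.inr ⟨n, Or.inl h⟩
    · rcases key h with ⟨n, h⟩ | ⟨n, h⟩
      · exact Or.inl ⟨n, h.symm⟩
      · exact Or.inr ⟨n, Or.inr h⟩
  rw [trace, SimpleGraph.fromRel_adj] at h
  rcases h.2 with h | h
  · exact key' h
  · rcases key' h with ⟨n, h⟩ | ⟨n, h⟩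
    · exact Or.inl ⟨n, h.symm⟩
    · exact Or.inr ⟨n, h.symm⟩

/-- The sites visited up to a given time of the backbone. -/
def past (ω : Sample d) (i : ℤ) : Set (Fin d → ℤ) := ⋃ n ∈ Set.Iic i, branch ω n

lemma mem_past {ω : Sample d} {i n : ℤ} (h : n ≤ i) {x : Fin d → ℤ} (hx : x ∈ branch ω n) :
    x ∈ past ω i := Set.mem_biUnion (Set.mem_Iic.2 h) hx

lemma IsPivotal.notMem_past {ω : Sample d} {i : ℤ} (hp : IsPivotal ω i) {n : ℤ} (h : i + 1 ≤ n)
    {x : Fin d → ℤ} (hx : x ∈ branch ω n) : x ∉ past ω i :=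
  fun h' => Set.disjoint_left.1 hp h' (Set.mem_biUnion (Set.mem_Ici.2 h) hx)

/-- An edge of the trace comes from one hanging tree or from one backbone step. A tree lies entirely
in the past or entirely in the future, which are disjoint, so only the step from `α(i)` to `α(i +
1)` can cross. -/
lemma IsPivotal.eq_of_adj {ω : Sample d} {i : ℤ} (hp : IsPivotal ω i) :
    ∀ u ∈ past ω i, ∀ v ∉ past ω i, (trace ω).Adj u v → u = backbone ω i := by
  intro u hu v hv huv
  rcases exists_of_trace_adj huv with ⟨n, hun, hvn⟩ | ⟨n, ⟨rfl, rfl⟩ | ⟨rfl, rfl⟩⟩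
  · rcases le_or_gt n i with h | h
    · exact absurd (mem_past h hvn) hv
    · exact absurd hu (hp.notMem_past h hun)
  · rcases lt_trichotomy n i with h | rfl | h
    · exact absurd (mem_past h (backbone_mem_branch ω (n + 1))) hv
    · rfl
    · exact absurd hu (hp.notMem_past h (backbone_mem_branch ω n))
  · rcases le_or_gt n i with h | h
    · exact absurd (mem_past h (backbone_mem_branch ω n)) hv
    · exact absurd hu (hp.notMem_past (by omega) (backbone_mem_branch ω (n + 1)))

/-! #### Measurability -/

lemma measurable_coord (n : ℤ) (u : List ℕ) : Measurable fun ω : Sample d => ω n u :=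
  (measurable_pi_apply u).comp (measurable_pi_apply n)

lemma measurable_vec : Measurable (Direction.vec : Direction d → Fin d → ℤ) :=
  measurable_of_countable _

lemma measurableSet_inTree (n : ℤ) (u : List ℕ) : MeasurableSet {ω : Sample d | InTree ω n u} := by
  induction u with
  | nil => exact .univ
  | cons i u ih =>
    exact ih.inter (measurableSet_lt measurable_const (measurable_coord n u).fst)

lemma measurable_backbone (n : ℤ) : Measurable fun ω : Sample d => backbone ω n := by
  unfold backbone
  refine Measurable.sub ?_ ?_ <;>
  exact Finset.measurable_sum _ fun k _ => measurable_vec.comp (measurable_coord k []).snd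

lemma measurable_displacement (n : ℤ) (u : List ℕ) :
    Measurable fun ω : Sample d => displacement ω n u := by
  induction u with
  | nil => exact measurable_const
  | cons i u ih => exact ih.add (measurable_vec.comp (measurable_coord n _).snd)

lemma measurable_position (a : ℤ × List ℕ) : Measurable fun ω : Sample d => position ω a :=
  (measurable_backbone _).add (measurable_displacement _ _)

lemma measurableSet_tree_adj (a b : ℤ × List ℕ) :
    MeasurableSet {ω : Sample d | (tree ω).Adj a b} := by
  have key : ∀ a b : ℤ × List ℕ, MeasurableSet {ω : Sample d |
      (a.2 = [] ∧ b = (a.1 + 1, [])) ∨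
        ∃ i : ℕ, b = (a.1, i :: a.2) ∧ InTree ω a.1 (i :: a.2)} := by
    intro a b
    refine (MeasurableSet.const _).union ?_
    have : {ω : Sample d | ∃ i : ℕ, b = (a.1, i :: a.2) ∧ InTree ω a.1 (i :: a.2)} =
        ⋃ i : ℕ, {_ω | b = (a.1, i :: a.2)} ∩ {ω | InTree ω a.1 (i :: a.2)} := by
      ext; simp
    have h : MeasurableSet {ω : Sample d | ∃ i : ℕ, b = (a.1, i :: a.2) ∧
        InTree ω a.1 (i :: a.2)} := by
      rw [this]
      exact .iUnion fun i => (MeasurableSet.const _).inter (measurableSet_inTree _ _)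
    exact h
  simp only [tree, SimpleGraph.fromRel_adj]
  exact (MeasurableSet.const _).inter ((key a b).union (key b a))

lemma measurableSet_trace_adj (x y : Fin d → ℤ) :
    MeasurableSet {ω : Sample d | (trace ω).Adj x y} := by
  have key : ∀ x y : Fin d → ℤ, MeasurableSet {ω : Sample d |
      ∃ a b, (tree ω).Adj a b ∧ position ω a = x ∧ position ω b = y} := by
    intro x y
    have : {ω : Sample d | ∃ a b, (tree ω).Adj a b ∧ position ω a = x ∧ position ω b = y} =
        ⋃ a, ⋃ b, {ω | (tree ω).Adj a b} ∩ ({ω | position ω a = x} ∩ {ω | position ω b = y}) := by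
      ext; simp
    rw [this]
    exact .iUnion fun a => .iUnion fun b => (measurableSet_tree_adj a b).inter
      ((measurable_position a (measurableSet_singleton x)).inter
        (measurable_position b (measurableSet_singleton y)))
  simp only [trace, SimpleGraph.fromRel_adj]
  exact (MeasurableSet.const _).inter ((key x y).union (key y x))

lemma measurableSet_mem_branch (x : Fin d → ℤ) (n : ℤ) :
    MeasurableSet {ω : Sample d | x ∈ branch ω n} := by
  have : {ω : Sample d | x ∈ branch ω n} =
      ⋃ u, {ω | InTree ω n u} ∩ {ω | position ω (n, u) = x} := by
    ext; simp [branch]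
  rw [this]
  exact .iUnion fun u => (measurableSet_inTree n u).inter
    (measurable_position _ (measurableSet_singleton x))

lemma measurableSet_isPivotal (i : ℤ) : MeasurableSet {ω : Sample d | IsPivotal ω i} := by
  have : {ω : Sample d | IsPivotal ω i} = ⋂ x, ⋂ n, ⋂ m,
      ({ω : Sample d | n ≤ i ∧ m ≥ i + 1 ∧ x ∈ branch ω n} ∩ {ω | x ∈ branch ω m})ᶜ := by
    ext ω
    simp only [isPivotal_iff, Set.mem_ofPred_eq, Set.mem_iInter, Set.mem_compl_iff,
      Set.mem_inter_iff]
    exact ⟨fun h x n m ⟨⟨hn, hm, hx⟩, hx'⟩ => h x n hn m hm hx hx',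
      fun h x n hn m hm hx hx' => h x n m ⟨⟨hn, hm, hx⟩, hx'⟩⟩
  rw [this]
  exact .iInter fun x => .iInter fun n => .iInter fun m =>
    (((MeasurableSet.const _).inter ((MeasurableSet.const _).inter
      (measurableSet_mem_branch x n))).inter (measurableSet_mem_branch x m)).compl

lemma measurable_firstPivotal : Measurable (firstPivotal : Sample d → ℕ) :=
  measurable_sInf_nat (P := fun ω n => 0 < n ∧ IsPivotal ω n) fun n =>
    (MeasurableSet.const _).inter (measurableSet_isPivotal n)

/-! #### Metrics along the backbone that add up at pivotal points -/

/-- A stationary family of metrics on the backbone times which are dominated by the usual distance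
and which are additive at pivotal points. -/
structure IsPivotalMetric (D : Sample d → ℤ → ℤ → ℝ) : Prop where
  measurable : ∀ i j, Measurable fun ω => D ω i j
  nonneg : ∀ ω i j, 0 ≤ D ω i j
  le_abs : ∀ ω i j, D ω i j ≤ |(i : ℝ) - j|
  triangle : ∀ ω i j k, D ω i k ≤ D ω i j + D ω j k
  add_le : ∀ ω i j k, IsPivotal ω j → i ≤ j → j ≤ k → D ω i j + D ω j k ≤ D ω i k
  shift : ∀ ω i j, D (shift ω) i j = D ω (i + 1) (j + 1)

lemma le_abs_of_triangle {D : ℤ → ℤ → ℝ≥0∞} (h0 : ∀ i, D i i = 0)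
    (h1 : ∀ i, D i (i + 1) ≤ 1) (h2 : ∀ i, D (i + 1) i ≤ 1)
    (htri : ∀ i j k, D i k ≤ D i j + D j k) (i j : ℤ) : D i j ≤ ENNReal.ofReal |(i : ℝ) - j| := by
  have key : ∀ n : ℕ, ∀ i : ℤ, D i (i + n) ≤ n ∧ D (i + n) i ≤ n := by
    intro n
    induction n with
    | zero => simp [h0]
    | succ n ih =>
      intro i
      push_cast
      rw [← add_assoc]
      exact ⟨(htri _ (i + n) _).trans (add_le_add (ih i).1 (h1 _)),
        (htri _ (i + n) _).trans (by rw [add_comm]; exact add_le_add (ih i).2 (h2 _))⟩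
  rcases le_total i j with h | h
  · obtain ⟨n, rfl⟩ := Int.le.dest h
    refine (key n i).1.trans (le_of_eq ?_)
    push_cast
    rw [sub_add_cancel_left, abs_neg, Nat.abs_cast, ENNReal.ofReal_natCast]
  · obtain ⟨n, rfl⟩ := Int.le.dest h
    refine (key n j).2.trans (le_of_eq ?_)
    push_cast
    rw [add_sub_cancel_left, Nat.abs_cast, ENNReal.ofReal_natCast]

/-- A function of the position of backbone points is measurable if it is so for fixed points. -/
lemma measurable_of_backbone {f : Sample d → (Fin d → ℤ) → (Fin d → ℤ) → ℝ}
    (hf : ∀ x y, Measurable fun ω => f ω x y) (i j : ℤ) :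
    Measurable fun ω => f ω (backbone ω i) (backbone ω j) := by
  have h := measurable_from_prod_countable_left (α := Sample d)
    (β := (Fin d → ℤ) × (Fin d → ℤ)) (f := fun p => f p.1 p.2.1 p.2.2) fun p => hf p.1 p.2
  exact h.comp (measurable_id.prodMk ((measurable_backbone i).prodMk (measurable_backbone j)))

lemma effectiveResistance_backbone_le (ω : Sample d) (i j : ℤ) :
    effectiveResistance (trace ω) (backbone ω i) (backbone ω j) ≤
      ENNReal.ofReal |(i : ℝ) - j| :=
  le_abs_of_triangle
    (D := fun i j => effectiveResistance (trace ω) (backbone ω i) (backbone ω j))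
    (fun _ => effectiveResistance_self _)
    (fun i => effectiveResistance_le_one (trace_adj_backbone ω i))
    (fun i => effectiveResistance_le_one (trace_adj_backbone ω i).symm)
    (fun _ _ _ => effectiveResistance_triangle _ _ _) i j

lemma isPivotalMetric_effectiveResistance : IsPivotalMetric fun (ω : Sample d) i j =>
    (effectiveResistance (trace ω) (backbone ω i) (backbone ω j)).toReal := by
  have htop : ∀ (ω : Sample d) i j,
      effectiveResistance (trace ω) (backbone ω i) (backbone ω j) ≠ ∞ := fun ω i j =>
    ne_top_of_le_ne_top ENNReal.ofReal_ne_top (effectiveResistance_backbone_le ω i j)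
  refine ⟨fun i j => ?_, fun _ _ _ => ENNReal.toReal_nonneg, fun ω i j => ?_, fun ω i j k => ?_,
    fun ω i j k hp hij hjk => ?_, fun ω i j => ?_⟩
  · exact measurable_of_backbone (f := fun ω x y => (effectiveResistance (trace ω) x y).toReal)
      (fun x y => (measurable_effectiveResistance measurableSet_trace_adj x y).ennreal_toReal) i j
  · exact ENNReal.toReal_le_of_le_ofReal (abs_nonneg _) (effectiveResistance_backbone_le ω i j)
  · rw [← ENNReal.toReal_add (htop _ _ _) (htop _ _ _)]
    exact ENNReal.toReal_mono (ENNReal.add_ne_top.2 ⟨htop _ _ _, htop _ _ _⟩)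
      (effectiveResistance_triangle _ _ _)
  -- The cut argument needs `α(k)` to lie outside the past of `j`, which fails for `k = j`.
  · rcases hjk.eq_or_lt with rfl | hjk
    · simp
    rw [← ENNReal.toReal_add (htop _ _ _) (htop _ _ _)]
    exact ENNReal.toReal_mono (htop _ _ _) (effectiveResistance_add_le
      (mem_past hij (backbone_mem_branch ω i)) (mem_past le_rfl (backbone_mem_branch ω j))
      (hp.notMem_past hjk (backbone_mem_branch ω k)) hp.eq_of_adj)
  · rw [← effectiveResistance_congr (traceShiftIso ω), backbone_shift, backbone_shift,
      traceShiftIso_apply, traceShiftIso_apply, sub_add_cancel, sub_add_cancel]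

lemma trace_reachable_backbone (ω : Sample d) (i j : ℤ) :
    (trace ω).Reachable (backbone ω i) (backbone ω j) := by
  have key : ∀ n : ℕ, ∀ i : ℤ, (trace ω).Reachable (backbone ω i) (backbone ω (i + n)) := by
    intro n
    induction n with
    | zero => intro i; simp
    | succ n ih =>
      intro i
      push_cast
      rw [← add_assoc]
      exact (ih i).trans (trace_adj_backbone ω _).reachable
  rcases le_total i j with h | h
  · obtain ⟨n, rfl⟩ := Int.le.dest h
    exact key n i
  · obtain ⟨n, rfl⟩ := Int.le.dest h
    exact (key n j).symm

lemma isPivotalMetric_dist : IsPivotalMetric fun (ω : Sample d) i j =>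
    ((trace ω).dist (backbone ω i) (backbone ω j) : ℝ) := by
  have htri : ∀ (ω : Sample d) i j k, (trace ω).dist (backbone ω i) (backbone ω k) ≤
      (trace ω).dist (backbone ω i) (backbone ω j) +
        (trace ω).dist (backbone ω j) (backbone ω k) := fun ω i j k =>
    (trace_reachable_backbone ω i j).dist_triangle_left _
  refine ⟨fun i j => ?_, fun _ _ _ => by positivity, fun ω i j => ?_, fun ω i j k => ?_,
    fun ω i j k hp hij hjk => ?_, fun ω i j => ?_⟩
  · exact measurable_of_backbone (f := fun ω x y => ((trace ω).dist x y : ℝ))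
      (fun x y => measurable_from_top.comp (measurable_dist measurableSet_trace_adj x y)) i j
  · have h1 : ∀ i, (trace ω).dist (backbone ω i) (backbone ω (i + 1)) = 1 := fun i =>
      SimpleGraph.dist_eq_one_iff_adj.2 (trace_adj_backbone ω i)
    have := le_abs_of_triangle
      (D := fun i j => ((trace ω).dist (backbone ω i) (backbone ω j) : ℝ≥0∞))
      (by simp) (fun i => by simp [h1])
      (fun i => by rw [SimpleGraph.dist_comm]; simp [h1])
      (fun i j k => by exact_mod_cast htri ω i j k) i j
    rw [ENNReal.le_ofReal_iff_toReal_le (by simp) (abs_nonneg _)] at this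
    simpa using this
  · exact_mod_cast htri ω i j k
  · rcases hjk.eq_or_lt with rfl | hjk
    · simp
    exact_mod_cast dist_add_dist_le_of_cut (mem_past hij (backbone_mem_branch ω i))
      (hp.notMem_past hjk (backbone_mem_branch ω k)) hp.eq_of_adj (trace_reachable_backbone ω i k)
  · rw [← dist_congr (traceShiftIso ω), backbone_shift, backbone_shift,
      traceShiftIso_apply, traceShiftIso_apply, sub_add_cancel, sub_add_cancel]

/-- Time itself is a pivotal metric: its law of large numbers controls the first pivotal time after
`n`. -/
lemma isPivotalMetric_abs_sub : IsPivotalMetric fun (_ : Sample d) i j => |(i : ℝ) - j| := by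
  refine ⟨fun _ _ => measurable_const, fun _ _ _ => abs_nonneg _, fun _ _ _ => le_rfl,
    fun _ _ _ _ => abs_sub_le _ _ _, fun _ i j k _ hij hjk => ?_, fun _ i j => ?_⟩
  · have h1 : (i : ℝ) ≤ j := by exact_mod_cast hij
    have h2 : (j : ℝ) ≤ k := by exact_mod_cast hjk
    rw [abs_of_nonpos (by linarith), abs_of_nonpos (by linarith), abs_of_nonpos (by linarith)]
    linarith
  · push_cast
    congr 1
    ring

end Model

end BRW

namespace BRW

/-! ### Independence of the jumps from everything else -/

section Independence

lemma measurePreserving_infinitePi {ι : Type*} {X : ι → Type*} [∀ i, MeasurableSpace (X i)]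
    {μ : (i : ι) → Measure (X i)} [∀ i, IsProbabilityMeasure (μ i)] {f : (i : ι) → X i → X i}
    (hf : ∀ i, MeasurePreserving (f i) (μ i) (μ i)) :
    MeasurePreserving (fun x i => f i (x i)) (Measure.infinitePi μ) (Measure.infinitePi μ) := by
  refine ⟨measurable_pi_lambda _ fun i => (hf i).measurable.comp (measurable_pi_apply i), ?_⟩
  rw [Measure.infinitePi_map_pi μ fun i => (hf i).measurable]
  congr 1
  ext1 i
  exact (hf i).map_eq

lemma measurePreserving_perm {α : Type*} [Fintype α] [Nonempty α] [MeasurableSpace α]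
    [DiscreteMeasurableSpace α] (π : Equiv.Perm α) :
    MeasurePreserving π (PMF.uniformOfFintype α).toMeasure (PMF.uniformOfFintype α).toMeasure := by
  refine ⟨measurable_of_countable _, ?_⟩
  rw [PMF.toMeasure_map _ _ (measurable_of_countable _)]
  congr 1
  ext x
  rw [PMF.map_apply, tsum_eq_single (π.symm x)]
  · simp
  · intro y hy
    rw [if_neg]
    rintro rfl
    simp at hy

variable {d : ℕ} [NeZero d] (p : PMF ℕ) (hp : ∑' k : ℕ, (k : ℝ≥0∞) * p k = 1)

/-- The joint law of the number of children of a vertex and of the jump that leads to it. -/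
noncomputable def vertexLaw (d : ℕ) [NeZero d] (p : PMF ℕ)
    (hp : ∑' k : ℕ, (k : ℝ≥0∞) * p k = 1) (u : List ℕ) : Measure (ℕ × Direction d) :=
  (childrenLaw p hp u).toMeasure.prod (PMF.uniformOfFintype (Direction d)).toMeasure

instance (u : List ℕ) : IsProbabilityMeasure (vertexLaw d p hp u) := by
  unfold vertexLaw; infer_instance

/-- The law of a tree hanging from the backbone. -/
noncomputable def treeLaw (d : ℕ) [NeZero d] (p : PMF ℕ)
    (hp : ∑' k : ℕ, (k : ℝ≥0∞) * p k = 1) : Measure (List ℕ → ℕ × Direction d) :=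
  Measure.infinitePi fun u => vertexLaw d p hp u

instance : IsProbabilityMeasure (treeLaw d p hp) := by
  unfold treeLaw; infer_instance

lemma law_eq : law d p hp = Measure.infinitePi fun _ : ℤ => treeLaw d p hp := rfl

instance : IsProbabilityMeasure (law d p hp) := by
  rw [law_eq]; infer_instance

/-- Replace the jump that leads to the vertex `a`. -/
def setDir (ω : Sample d) (a : ℤ × List ℕ) (e : Direction d) : Sample d :=
  Function.update ω a.1 (Function.update (ω a.1) a.2 ((ω a.1 a.2).1, e))

omit [NeZero d] in
lemma setDir_apply (ω : Sample d) (a : ℤ × List ℕ) (e : Direction d) (n : ℤ) (u : List ℕ) :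
    setDir ω a e n u = if (n, u) = a then ((ω n u).1, e) else ω n u := by
  obtain ⟨m, v⟩ := a
  by_cases hn : n = m
  · subst hn
    by_cases hu : u = v
    · subst hu; simp [setDir]
    · simp [setDir, hu]
  · simp [setDir, hn]

omit [NeZero d] in
lemma setDir_fst (ω : Sample d) (a : ℤ × List ℕ) (e : Direction d) (n : ℤ) (u : List ℕ) :
    (setDir ω a e n u).1 = (ω n u).1 := by
  rw [setDir_apply]; split_ifs <;> rfl

omit [NeZero d] in
lemma setDir_of_ne (ω : Sample d) {a : ℤ × List ℕ} (e : Direction d) {n : ℤ} {u : List ℕ}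
    (h : (n, u) ≠ a) : setDir ω a e n u = ω n u := by
  rw [setDir_apply, if_neg h]

lemma measurePreserving_setDir (a : ℤ × List ℕ) (π : Equiv.Perm (Direction d)) :
    MeasurePreserving (fun ω : Sample d => setDir ω a (π (ω a.1 a.2).2)) (law d p hp)
      (law d p hp) := by
  have h1 : ∀ v, MeasurePreserving
      (if v = a.2 then Prod.map id π else id : ℕ × Direction d → ℕ × Direction d)
      (vertexLaw d p hp v) (vertexLaw d p hp v) := by
    intro v
    split_ifs
    · exact (MeasurePreserving.id _).prod (measurePreserving_perm π)
    · exact MeasurePreserving.id _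
  have h2 := measurePreserving_infinitePi h1
  have h3 : ∀ m : ℤ, MeasurePreserving
      (if m = a.1 then fun (η : List ℕ → ℕ × Direction d) v =>
        (if v = a.2 then Prod.map id π else id : ℕ × Direction d → ℕ × Direction d) (η v) else id)
      (treeLaw d p hp) (treeLaw d p hp) := by
    intro m
    split_ifs
    · exact h2
    · exact MeasurePreserving.id _
  rw [law_eq]
  convert measurePreserving_infinitePi h3 using 1
  ext1 ω
  funext n u
  obtain ⟨m, v⟩ := a
  rw [setDir_apply]
  by_cases hn : n = m
  · subst hn
    by_cases hu : u = v
    · subst hu; simp [Prod.map]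
    · simp [hu]
  · simp [hn]

lemma law_eq_sum_dir {S : Set (Sample d)} (hS : MeasurableSet S) (a : ℤ × List ℕ) :
    law d p hp S = ∑ e, law d p hp (S ∩ {ω | (ω a.1 a.2).2 = e}) := by
  rw [← tsum_fintype (L := .unconditional _), ← measure_iUnion]
  · congr 1
    ext ω
    simp
  · intro e e' he
    refine Set.disjoint_left.2 ?_
    rintro ω ⟨_, h1⟩ ⟨_, h2⟩
    exact he (h1.symm.trans h2)
  · exact fun e => hS.inter ((measurable_coord _ _).snd (measurableSet_singleton e))

/-- Exchanging two directions in the jump at `a` preserves both the law and `A`, so the `2d` values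
of this jump are equally likely on `A`. -/
lemma law_inter_dir {A : Set (Sample d)} (hA : MeasurableSet A) {a : ℤ × List ℕ}
    (hinv : ∀ ω e, setDir ω a e ∈ A ↔ ω ∈ A) (e : Direction d) :
    law d p hp (A ∩ {ω | (ω a.1 a.2).2 = e}) = ENNReal.ofReal (2 * d : ℝ)⁻¹ * law d p hp A := by
  have heq : ∀ e', law d p hp (A ∩ {ω | (ω a.1 a.2).2 = e'}) =
      law d p hp (A ∩ {ω | (ω a.1 a.2).2 = e}) := by
    intro e'
    have hmp := measurePreserving_setDir p hp a (Equiv.swap e e')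
    have hm : MeasurableSet (A ∩ {ω : Sample d | (ω a.1 a.2).2 = e}) :=
      hA.inter ((measurable_coord _ _).snd (measurableSet_singleton e))
    rw [← hmp.measure_preimage hm.nullMeasurableSet]
    congr 1
    ext ω
    simp only [Set.mem_inter_iff, Set.mem_ofPred_eq, Set.mem_preimage, hinv, and_congr_right_iff]
    intro _
    rw [setDir_apply, if_pos rfl]
    simp only
    rw [Equiv.swap_apply_eq_iff, Equiv.swap_apply_left]
  have hsum := law_eq_sum_dir p hp hA a
  simp only [heq] at hsum
  rw [Finset.sum_const, Finset.card_univ, nsmul_eq_mul] at hsum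
  have hcard : Fintype.card (Direction d) = d * 2 := by simp [Direction]
  have hd : (0 : ℝ) < d := by exact_mod_cast NeZero.pos d
  rw [hsum, hcard, ← mul_assoc, ← ENNReal.ofReal_natCast, ← ENNReal.ofReal_mul (by positivity)]
  push_cast
  rw [show (2 * (d : ℝ))⁻¹ * (d * 2) = 1 by field_simp, ENNReal.ofReal_one, one_mul]

/-- A signed sum of jumps. -/
def dirSum (J : Finset (ℤ × List ℕ)) (s : ℤ × List ℕ → ℤ) (ω : Sample d) : Fin d → ℤ :=
  ∑ a ∈ J, s a • (ω a.1 a.2).2.vec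

omit [NeZero d] in
lemma measurable_dirSum (J : Finset (ℤ × List ℕ)) (s : ℤ × List ℕ → ℤ) :
    Measurable (dirSum J s : Sample d → Fin d → ℤ) := by
  unfold dirSum
  refine Finset.measurable_sum _ fun a _ => ?_
  exact (measurable_of_countable fun e : Direction d => s a • e.vec).comp (measurable_coord _ _).snd

omit [NeZero d] in
lemma dirSum_setDir {J : Finset (ℤ × List ℕ)} {s : ℤ × List ℕ → ℤ} {a : ℤ × List ℕ} (ha : a ∉ J)
    (ω : Sample d) (e : Direction d) : dirSum J s (setDir ω a e) = dirSum J s ω := by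
  refine Finset.sum_congr rfl fun b hb => ?_
  rw [setDir_of_ne]
  rintro rfl
  exact ha hb

-- Reversing every direction is a bijection of the steps, so orientations along a path do not affect
-- its law.
omit [NeZero d] in
lemma sum_heatKernel_sub_smul (n : ℕ) (x : Fin d → ℤ) {t : ℤ} (ht : t = 1 ∨ t = -1) :
    ∑ e : Direction d, heatKernel n (x - t • e.vec) = ∑ e : Direction d, heatKernel n (x - e.vec) := by
  rcases ht with rfl | rfl
  · simp
  · let σ : Direction d ≃ Direction d := Equiv.prodCongr (Equiv.refl _) Equiv.boolNot
    rw [← σ.sum_comp]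
    refine Finset.sum_congr rfl fun e _ => ?_
    congr 2
    obtain ⟨i, b⟩ := e
    simp only [σ, Direction.vec, Equiv.prodCongr_apply, Prod.map_apply, Equiv.refl_apply,
      Equiv.boolNot_apply, neg_smul, one_smul, ← Pi.single_neg]
    cases b <;> simp

/-- Conditionally on an event that does not involve them, a signed sum of jumps is distributed as the
simple random walk. -/
theorem law_inter_dirSum_eq {A : Set (Sample d)} (hA : MeasurableSet A)
    (J : Finset (ℤ × List ℕ)) {s : ℤ × List ℕ → ℤ} (hs : ∀ a, s a = 1 ∨ s a = -1)
    (hinv : ∀ a ∈ J, ∀ ω e, setDir ω a e ∈ A ↔ ω ∈ A) (x : Fin d → ℤ) :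
    law d p hp (A ∩ {ω | dirSum J s ω = x}) =
      law d p hp A * ENNReal.ofReal (heatKernel J.card x) := by
  classical
  induction J using Finset.induction_on generalizing x with
  | empty =>
    by_cases hx : x = 0
    · simp [dirSum, heatKernel, hx]
    · simp [dirSum, heatKernel, hx, Ne.symm hx]
  | insert a J ha ih =>
    have ih' := ih fun b hb => hinv b (Finset.mem_insert_of_mem hb)
    have hms : ∀ (J : Finset (ℤ × List ℕ)) (x : Fin d → ℤ),
        MeasurableSet (A ∩ {ω : Sample d | dirSum J s ω = x}) := fun J x =>
      hA.inter (measurable_dirSum _ _ (measurableSet_singleton x))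
    rw [law_eq_sum_dir p hp (hms _ x) a]
    -- Condition on the jump at `a`: the rest of the sum, like `A`, does not involve this jump, so
    -- `law_inter_dir` splits it off and the induction hypothesis applies to `J`.
    have hterm : ∀ e, law d p hp (A ∩ {ω | dirSum (insert a J) s ω = x} ∩
        {ω | (ω a.1 a.2).2 = e}) = ENNReal.ofReal (2 * d : ℝ)⁻¹ *
          (law d p hp A * ENNReal.ofReal (heatKernel J.card (x - s a • e.vec))) := by
      intro e
      rw [← ih', ← law_inter_dir p hp (hms _ _) (a := a) ?_ e]
      · congr 1
        ext ω
        simp only [Set.mem_inter_iff, Set.mem_ofPred_eq, dirSum, Finset.sum_insert ha]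
        constructor
        · rintro ⟨⟨h1, h2⟩, h3⟩
          exact ⟨⟨h1, by rw [← h2, h3]; abel⟩, h3⟩
        · rintro ⟨⟨h1, h2⟩, h3⟩
          exact ⟨⟨h1, by rw [h2, h3]; abel⟩, h3⟩
      · intro ω e
        simp only [Set.mem_inter_iff, Set.mem_ofPred_eq, dirSum_setDir ha,
          hinv a (Finset.mem_insert_self _ _)]
    simp_rw [hterm]
    rw [← Finset.mul_sum, ← Finset.mul_sum, ← ENNReal.ofReal_sum_of_nonneg
      fun e _ => heatKernel_nonneg _ _, sum_heatKernel_sub_smul _ _ (hs a), mul_left_comm,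
      ← ENNReal.ofReal_mul (by positivity), Finset.card_insert_of_notMem ha]
    rfl

end Independence

/-! ### Expected generation sizes of the hanging trees -/

section TreeWeights

variable {d : ℕ} [NeZero d] (p : PMF ℕ) (hp : ∑' k : ℕ, (k : ℝ≥0∞) * p k = 1)

omit [NeZero d] in
lemma inTree_iff_const (ω : Sample d) (n : ℤ) (u : List ℕ) :
    InTree ω n u ↔ InTree (fun _ => ω n) 0 u := by
  induction u with
  | nil => rfl
  | cons i u ih => simp only [InTree, ih]

omit [NeZero d] in
lemma measurableSet_inTree_const (u : List ℕ) :
    MeasurableSet {η : List ℕ → ℕ × Direction d | InTree (fun _ => η) 0 u} :=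
  measurable_pi_lambda (fun (η : List ℕ → ℕ × Direction d) (_ : ℤ) => η) (fun _ => measurable_id)
    (measurableSet_inTree 0 u)

/-- The probability that a label is a vertex of a tree hanging from the backbone. -/
noncomputable def treeWeight (d : ℕ) [NeZero d] (p : PMF ℕ)
    (hp : ∑' k : ℕ, (k : ℝ≥0∞) * p k = 1) (u : List ℕ) : ℝ≥0∞ :=
  treeLaw d p hp {η | InTree (fun _ => η) 0 u}

lemma treeWeight_nil : treeWeight d p hp [] = 1 := by
  have : {η : List ℕ → ℕ × Direction d | InTree (fun _ => η) 0 []} = Set.univ := by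
    ext; simp [InTree]
  rw [treeWeight, this, measure_univ]

lemma pi_inter_eval_mem {ι : Type*} [DecidableEq ι] {X : ι → Type*} {s : Finset ι} {i : ι}
    (hi : i ∉ s) (t : (i : ι) → Set (X i)) (B : Set (X i)) :
    Set.pi (s : Set ι) t ∩ {x | x i ∈ B} =
      Set.pi ((insert i s : Finset ι) : Set ι) (Function.update t i B) := by
  ext x
  rw [Finset.coe_insert, Set.insert_pi, Set.mem_inter_iff, Set.mem_inter_iff, and_comm]
  simp only [Set.mem_preimage, Function.eval, Function.update_self, Set.mem_ofPred_eq]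
  refine and_congr_right fun _ => forall₂_congr fun j hj => ?_
  rw [Function.update_of_ne]
  rintro rfl
  exact hi hj

lemma measurableSet_update {ι : Type*} [DecidableEq ι] {X : ι → Type*}
    [∀ i, MeasurableSpace (X i)] {t : (i : ι) → Set (X i)} (ht : ∀ i, MeasurableSet (t i)) {i : ι}
    {B : Set (X i)} (hB : MeasurableSet B) (j : ι) :
    MeasurableSet (Function.update t i B j) := by
  by_cases hj : j = i
  · subst hj; rwa [Function.update_self]
  · rw [Function.update_of_ne hj]; exact ht j

lemma infinitePi_pi_inter_eval_mem {ι : Type*} {X : ι → Type*} [∀ i, MeasurableSpace (X i)]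
    (μ : (i : ι) → Measure (X i)) [∀ i, IsProbabilityMeasure (μ i)] {s : Finset ι} {i : ι}
    (hi : i ∉ s) {t : (i : ι) → Set (X i)} (ht : ∀ i, MeasurableSet (t i)) {B : Set (X i)}
    (hB : MeasurableSet B) :
    Measure.infinitePi μ (Set.pi (s : Set ι) t ∩ {x | x i ∈ B}) =
      Measure.infinitePi μ (Set.pi (s : Set ι) t) * μ i B := by
  classical
  rw [pi_inter_eval_mem hi, Measure.infinitePi_pi _ fun j _ => ht j,
    Measure.infinitePi_pi _ fun j _ => measurableSet_update ht hB j, Finset.prod_insert hi,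
    Function.update_self, mul_comm]
  congr 1
  refine Finset.prod_congr rfl fun j hj => ?_
  rw [Function.update_of_ne]
  rintro rfl
  exact hi hj

omit [NeZero d] in
lemma measurableSet_lt_fst (i : ℕ) : MeasurableSet {c : ℕ × Direction d | i < c.1} :=
  measurableSet_lt measurable_const measurable_fst

omit [NeZero d] in
lemma setOf_inTree_cons (i : ℕ) (u : List ℕ) :
    {η : List ℕ → ℕ × Direction d | InTree (fun _ => η) 0 (i :: u)} =
      {η | InTree (fun _ => η) 0 u} ∩ {η | η u ∈ {c : ℕ × Direction d | i < c.1}} := rfl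

-- Whether `u` is in the tree depends only on the numbers of children of its proper ancestors, which
-- are shorter labels. The event is therefore a finite box not involving the coordinate `u`, hence
-- independent of the number of children of `u`.
omit [NeZero d] in
lemma exists_box_inTree (u : List ℕ) : ∃ (s : Finset (List ℕ)) (t : List ℕ → Set (ℕ × Direction d)),
    (∀ v ∈ s, v.length < u.length) ∧ (∀ v, MeasurableSet (t v)) ∧
    {η : List ℕ → ℕ × Direction d | InTree (fun _ => η) 0 u} = Set.pi s t := by
  classical
  induction u with
  | nil => exact ⟨∅, fun _ => Set.univ, by simp, fun _ => .univ, by ext; simp [InTree]⟩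
  | cons i u ih =>
    obtain ⟨s, t, hs, ht, h⟩ := ih
    have hu : u ∉ s := fun hu => (hs u hu).false
    refine ⟨insert u s, Function.update t u {c | i < c.1}, ?_,
      measurableSet_update ht (measurableSet_lt_fst i), ?_⟩
    · intro v hv
      rcases Finset.mem_insert.1 hv with rfl | hv
      · simp
      · exact (hs v hv).trans (by simp)
    · rw [setOf_inTree_cons, h, pi_inter_eval_mem hu]

lemma treeWeight_cons (i : ℕ) (u : List ℕ) : treeWeight d p hp (i :: u) =
    treeWeight d p hp u * (childrenLaw p hp u).toMeasure {k | i < k} := by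
  obtain ⟨s, t, hs, ht, h⟩ := exists_box_inTree (d := d) u
  rw [treeWeight, treeWeight, setOf_inTree_cons, h, treeLaw,
    infinitePi_pi_inter_eval_mem _ (fun hu => (hs u hu).false) ht (measurableSet_lt_fst i)]
  congr 1
  have : {c : ℕ × Direction d | i < c.1} = {k | i < k} ×ˢ Set.univ := by ext; simp
  rw [this, vertexLaw, Measure.prod_prod, measure_univ, mul_one]

lemma tsum_toMeasure_lt (q : PMF ℕ) : ∑' i : ℕ, q.toMeasure {k | i < k} = ∑' k : ℕ, (k : ℝ≥0∞) * q k := by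
  have h : ∀ i : ℕ, q.toMeasure {k | i < k} = ∑' k, if i < k then q k else 0 := by
    intro i
    rw [q.toMeasure_apply]
    · refine tsum_congr fun k => ?_
      rw [Set.indicator_apply]
      rfl
    · exact .of_discrete
  simp_rw [h]
  rw [ENNReal.tsum_comm]
  refine tsum_congr fun k => ?_
  rw [tsum_eq_sum (s := Finset.range k)]
  · rw [Finset.sum_ite_of_true fun i hi => Finset.mem_range.1 hi]
    simp
  · intro i hi
    rw [if_neg]
    simpa using hi

/-- The mean of `Z̃ - 1` is `∑ (k - 1) k P[Z = k]`; this is where the second moment enters. -/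
lemma tsum_mul_childrenLaw_nil_le :
    ∑' k : ℕ, (k : ℝ≥0∞) * childrenLaw p hp [] k ≤ ∑' k : ℕ, (k : ℝ≥0∞) ^ 2 * p k := by
  have h1 : ∀ j : ℕ, childrenLaw p hp [] j = ∑' k, if j = k - 1 then (k : ℝ≥0∞) * p k else 0 := by
    intro j
    rw [childrenLaw, PMF.map_apply]
    refine tsum_congr fun k => ?_
    by_cases h : j = k - 1
    · rw [if_pos h, if_pos h]; rfl
    · rw [if_neg h, if_neg h]
  simp_rw [h1, ← ENNReal.tsum_mul_left]
  rw [ENNReal.tsum_comm]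
  refine ENNReal.tsum_le_tsum fun k => ?_
  rw [tsum_eq_single (k - 1) fun j hj => by simp [hj], if_pos rfl, sq, mul_assoc]
  gcongr
  exact Nat.sub_le k 1

/-- The expected size of a generation of a tree hanging from the backbone. -/
noncomputable def generationWeight (d : ℕ) [NeZero d] (p : PMF ℕ)
    (hp : ∑' k : ℕ, (k : ℝ≥0∞) * p k = 1) (k : ℕ) : ℝ≥0∞ :=
  ∑' u : List ℕ, if u.length = k then treeWeight d p hp u else 0

lemma generationWeight_succ (k : ℕ) : generationWeight d p hp (k + 1) =
    ∑' u : List ℕ, (if u.length = k then treeWeight d p hp u else 0) *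
      ∑' m : ℕ, (m : ℝ≥0∞) * childrenLaw p hp u m := by
  have hinj : Function.Injective fun a : List ℕ × ℕ => a.2 :: a.1 := by
    rintro ⟨u, i⟩ ⟨v, j⟩ h
    simp only [List.cons.injEq] at h
    exact Prod.ext h.2 h.1
  rw [generationWeight, ← hinj.tsum_eq, ENNReal.tsum_prod']
  · refine tsum_congr fun u => ?_
    rw [← tsum_toMeasure_lt, ← ENNReal.tsum_mul_left]
    refine tsum_congr fun i => ?_
    simp only [List.length_cons, add_left_inj, treeWeight_cons]
    split_ifs <;> simp
  · intro u hu
    cases u with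
    | nil => simp at hu
    | cons i u => exact ⟨(u, i), rfl⟩

/-- Generation `0` has one vertex, generation `1` has mean size `E[Z̃ - 1] ≤ E[Z²]`, and afterwards
criticality keeps the mean constant. -/
lemma generationWeight_le (k : ℕ) :
    generationWeight d p hp k ≤ 1 + ∑' k : ℕ, (k : ℝ≥0∞) ^ 2 * p k := by
  induction k with
  | zero =>
    rw [generationWeight, tsum_eq_single []]
    · simp [treeWeight_nil]
    · intro u hu
      simp [hu]
  | succ k ih =>
    rw [generationWeight_succ]
    cases k with
    | zero =>
      rw [tsum_eq_single []]
      · simp only [List.length_nil, if_true, treeWeight_nil, one_mul]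
        exact (tsum_mul_childrenLaw_nil_le p hp).trans le_add_self
      · intro u hu
        simp [hu]
    | succ k =>
      refine le_trans (le_of_eq ?_) ih
      rw [generationWeight]
      refine tsum_congr fun u => ?_
      cases u with
      | nil => simp
      | cons i u =>
        have : childrenLaw p hp (i :: u) = p := rfl
        rw [this, hp, mul_one]

lemma tsum_treeWeight_mul_le (h : ℕ → ℝ≥0∞) :
    ∑' u : List ℕ, treeWeight d p hp u * h u.length ≤
      (1 + ∑' k : ℕ, (k : ℝ≥0∞) ^ 2 * p k) * ∑' k, h k := by
  have h1 : ∀ u : List ℕ, treeWeight d p hp u * h u.length =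
      ∑' k, (if u.length = k then treeWeight d p hp u else 0) * h k := by
    intro u
    rw [tsum_eq_single u.length fun k hk => by rw [if_neg hk.symm, zero_mul], if_pos rfl]
  simp_rw [h1]
  rw [ENNReal.tsum_comm, ← ENNReal.tsum_mul_left]
  refine ENNReal.tsum_le_tsum fun k => ?_
  rw [ENNReal.tsum_mul_right]
  gcongr
  exact generationWeight_le p hp k

end TreeWeights

end BRW

namespace BRW

/-! ### The window event and the intersections that survive it -/

section Geometry

variable {d : ℕ}

/-- The nonempty suffixes of a label. -/
def suffixes : List ℕ → Finset (List ℕ)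
  | [] => ∅
  | i :: u => insert (i :: u) (suffixes u)

lemma length_le_of_mem_suffixes {u v : List ℕ} (h : v ∈ suffixes u) : v.length ≤ u.length := by
  induction u with
  | nil => simp [suffixes] at h
  | cons i u ih =>
    rcases Finset.mem_insert.1 h with rfl | h
    · exact le_rfl
    · exact (ih h).trans (by simp)

lemma notMem_suffixes_cons (i : ℕ) (u : List ℕ) : i :: u ∉ suffixes u := fun h => by
  simpa using length_le_of_mem_suffixes h

lemma nil_notMem_suffixes (u : List ℕ) : [] ∉ suffixes u := by
  induction u with
  | nil => simp [suffixes]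
  | cons i u ih => simp [suffixes, ih]

lemma card_suffixes (u : List ℕ) : (suffixes u).card = u.length := by
  induction u with
  | nil => rfl
  | cons i u ih =>
    rw [suffixes, Finset.card_insert_of_notMem (notMem_suffixes_cons i u), ih, List.length_cons]

lemma displacement_eq_sum (ω : Sample d) (n : ℤ) (u : List ℕ) :
    displacement ω n u = ∑ v ∈ suffixes u, (ω n v).2.vec := by
  induction u with
  | nil => rfl
  | cons i u ih =>
    rw [suffixes, Finset.sum_insert (notMem_suffixes_cons i u), ← ih, add_comm]
    rfl

/-- The vertices whose jumps lead from the backbone vertex `i` to the backbone vertex `j`, together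
with those whose jumps lead from the root to the vertex `u` of the `n`-th hanging tree. -/
noncomputable def pathVertices (i j n : ℤ) (u : List ℕ) : Finset (ℤ × List ℕ) :=
  (Finset.Ioc i j).image (fun k => (k, [])) ∪ (suffixes u).image fun v => (n, v)

lemma disjoint_pathVertices (i j n : ℤ) (u : List ℕ) :
    Disjoint ((Finset.Ioc i j).image fun k => ((k, []) : ℤ × List ℕ))
      ((suffixes u).image fun v => (n, v)) := by
  rw [Finset.disjoint_left]
  intro a ha hb
  obtain ⟨k, _, rfl⟩ := Finset.mem_image.1 ha
  obtain ⟨v, hv, h⟩ := Finset.mem_image.1 hb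
  rw [Prod.mk.injEq] at h
  exact nil_notMem_suffixes u (h.2 ▸ hv)

lemma sum_pathVertices {M : Type*} [AddCommMonoid M] (i j n : ℤ) (u : List ℕ)
    (f : ℤ × List ℕ → M) : ∑ a ∈ pathVertices i j n u, f a =
      ∑ k ∈ Finset.Ioc i j, f (k, []) + ∑ v ∈ suffixes u, f (n, v) := by
  rw [pathVertices, Finset.sum_union (disjoint_pathVertices i j n u), Finset.sum_image (by simp),
    Finset.sum_image (by simp)]

lemma card_pathVertices (i j n : ℤ) (u : List ℕ) :
    (pathVertices i j n u).card = (j - i).toNat + u.length := by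
  rw [Finset.card_eq_sum_ones, sum_pathVertices]
  simp [card_suffixes]

lemma fst_of_mem_pathVertices {i j n : ℤ} {u : List ℕ} {a : ℤ × List ℕ}
    (h : a ∈ pathVertices i j n u) : (i < a.1 ∧ a.1 ≤ j) ∨ a.1 = n := by
  rcases Finset.mem_union.1 h with h | h
  · obtain ⟨k, hk, rfl⟩ := Finset.mem_image.1 h
    exact Or.inl (Finset.mem_Ioc.1 hk)
  · obtain ⟨v, _, rfl⟩ := Finset.mem_image.1 h
    exact Or.inr rfl

/-- The orientation of the jumps on a path from the past to the future. -/
def jumpSign (a : ℤ × List ℕ) : ℤ := if a.2 = [] ∨ 0 < a.1 then 1 else -1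

lemma jumpSign_eq (a : ℤ × List ℕ) : jumpSign a = 1 ∨ jumpSign a = -1 := by
  rw [jumpSign]; split_ifs <;> simp

lemma position_future (ω : Sample d) {l j : ℤ} (hl : 0 ≤ l) (hj : l < j) (v : List ℕ) :
    position ω (j, v) = backbone ω l + dirSum (pathVertices l j j v) jumpSign ω := by
  rw [dirSum, sum_pathVertices, position, displacement_eq_sum,
    ← sub_add_cancel (backbone ω j) (backbone ω l), backbone_sub_backbone ω hj.le]
  have h1 : ∀ k : ℤ, jumpSign (k, []) = 1 := fun k => if_pos (Or.inl rfl)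
  have h2 : ∀ v, jumpSign (j, v) = 1 := fun v => if_pos (Or.inr (by simp only; omega))
  simp only [h1, h2, one_smul]
  abel

/-- The path is read from the past vertex towards the backbone, so the jumps of the hanging tree are
reversed; this accounts for the sign `-1` in `jumpSign`. -/
lemma position_past (ω : Sample d) {l i : ℤ} (hl : l < 0) (hi : i ≤ l) (u : List ℕ) :
    position ω (i, u) = backbone ω l - dirSum (pathVertices i l i u) jumpSign ω := by
  rw [dirSum, sum_pathVertices, position, displacement_eq_sum]
  have h0 := backbone_sub_backbone ω hi
  have h1 : ∀ k : ℤ, jumpSign (k, []) = 1 := fun k => if_pos (Or.inl rfl)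
  have h2 : ∀ v ∈ suffixes u, jumpSign (i, v) • (ω (i, v).1 (i, v).2).2.vec =
      -(ω i v).2.vec := by
    intro v hv
    rw [jumpSign, if_neg, neg_one_smul]
    rintro (h | h)
    · exact nil_notMem_suffixes u (h ▸ hv)
    · simp only at h; omega
  rw [Finset.sum_congr rfl h2]
  simp only [h1, one_smul, Finset.sum_neg_distrib]
  rw [← h0]
  abel

lemma inTree_setDir (ω : Sample d) (a : ℤ × List ℕ) (e : Direction d) (n : ℤ) (u : List ℕ) :
    InTree (setDir ω a e) n u ↔ InTree ω n u := by
  induction u with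
  | nil => rfl
  | cons i u ih => simp only [InTree, ih, setDir_fst]

lemma setDir_of_fst_ne (ω : Sample d) {a : ℤ × List ℕ} (e : Direction d) {n : ℤ} (h : n ≠ a.1) :
    setDir ω a e n = ω n := by
  funext u
  rw [setDir_of_ne]
  rintro rfl
  exact h rfl

variable [NeZero d]

/-- The hanging trees of height one with `m` leaves, all at distance one from the root along the
first coordinate axis, such that the backbone arrives in the root along this axis. -/
def windowTree (d : ℕ) [NeZero d] (m : ℕ) (b : Bool) : Set (List ℕ → ℕ × Direction d) :=
  {η | η [] = (m, (0, true)) ∧ ∀ i < m, η [i] = (0, (0, b))}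

/-- The samples for which the backbone goes straight at times in `[-l, l]`, where the hanging trees
have height one. -/
def window (d : ℕ) [NeZero d] (m : ℕ) (l : ℤ) : Set (Sample d) :=
  Set.pi (Finset.Icc (-l) l : Finset ℤ) fun n => windowTree d m (decide (0 < n))

/-- The first coordinate vector. -/
def firstVec (d : ℕ) [NeZero d] : Fin d → ℤ := Direction.vec (0, true)

lemma firstVec_zero : firstVec d 0 = 1 := by simp [firstVec, Direction.vec]

lemma vec_zero_false : Direction.vec ((0 : Fin d), false) = -firstVec d := by
  simp [firstVec, Direction.vec, Pi.single_neg]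

lemma window_apply {m : ℕ} {l : ℤ} {ω : Sample d} (h : ω ∈ window d m l) {n : ℤ} (h1 : -l ≤ n)
    (h2 : n ≤ l) : ω n ∈ windowTree d m (decide (0 < n)) :=
  h n (Finset.mem_coe.2 (Finset.mem_Icc.2 ⟨h1, h2⟩))

lemma backbone_of_mem_window {m : ℕ} {l : ℤ} {ω : Sample d} (h : ω ∈ window d m l) {n : ℤ}
    (h1 : -l - 1 ≤ n) (h2 : n ≤ l) :
    backbone ω n = backbone ω (-l - 1) + (n + l + 1) • firstVec d := by
  rw [← sub_eq_iff_eq_add', backbone_sub_backbone ω h1]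
  have : ∀ k ∈ Finset.Ioc (-l - 1) n, (ω k []).2.vec = firstVec d := by
    intro k hk
    rw [Finset.mem_Ioc] at hk
    rw [(window_apply h (n := k) (by omega) (by omega)).1]
    rfl
  rw [Finset.sum_congr rfl this, Finset.sum_const, Int.card_Ioc, ← natCast_zsmul,
    Int.toNat_of_nonneg (by omega)]
  congr 1
  ring

/-- Leaves point backwards up to time `0` and forwards afterwards. Hence inside the window the past
occupies abscissae `t ≤ l + 1` and the future `t ≥ l + 2`, without overlap. -/
lemma mem_branch_of_mem_window {m : ℕ} {l : ℤ} {ω : Sample d} (h : ω ∈ window d m l) {n : ℤ}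
    (h1 : -l ≤ n) (h2 : n ≤ l) {x : Fin d → ℤ} (hx : x ∈ branch ω n) :
    ∃ t : ℤ, x = backbone ω (-l - 1) + t • firstVec d ∧
      (n ≤ 0 → n + l ≤ t ∧ t ≤ n + l + 1) ∧ (1 ≤ n → n + l + 1 ≤ t ∧ t ≤ n + l + 2) := by
  obtain ⟨u, hu, rfl⟩ := hx
  have hw := window_apply h h1 h2
  have hback := backbone_of_mem_window h (n := n) (by omega) h2
  have key : ∀ u, InTree ω n u → u = [] ∨ ∃ i < m, u = [i] := by
    intro u
    induction u with
    | nil => simp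
    | cons i u ih =>
      rintro ⟨h3, h4⟩
      rcases ih h3 with rfl | ⟨j, hj, rfl⟩
      · rw [hw.1] at h4
        exact Or.inr ⟨i, h4, rfl⟩
      · rw [hw.2 j hj] at h4
        simp at h4
  rcases key u hu with rfl | ⟨i, hi, rfl⟩
  · refine ⟨n + l + 1, ?_, fun _ => ⟨by omega, by omega⟩, fun _ => ⟨by omega, by omega⟩⟩
    rw [← hback]
    simp [position, displacement]
  · simp only [position, displacement, hback, hw.2 i hi, zero_add]
    by_cases hn : 0 < n
    · refine ⟨n + l + 2, ?_, fun _ => ⟨by omega, by omega⟩, fun _ => ⟨by omega, by omega⟩⟩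
      rw [decide_eq_true hn, add_assoc]
      congr 1
      rw [show n + l + 2 = n + l + 1 + 1 by ring, add_smul (n + l + 1) (1 : ℤ), one_smul]
      rfl
    · refine ⟨n + l, ?_, fun _ => ⟨by omega, by omega⟩, fun _ => ⟨by omega, by omega⟩⟩
      rw [decide_eq_false hn, vec_zero_false, add_assoc]
      congr 1
      rw [add_smul _ (1 : ℤ), one_smul]
      abel

/-- If `0` is not pivotal on the window event, then one of the intersections of the far past and the
far future with each other or with the straight line of the window occurs. -/
lemma window_subset {m : ℕ} {L : ℕ} :
    window d m L ⊆ {ω | IsPivotal ω 0} ∪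
      ((⋃ (a : ℕ) (b : ℕ) (u : List ℕ) (v : List ℕ), (window d m L ∩
          {ω | InTree ω (-L - 1 - a) u} ∩ {ω | InTree ω (L + 1 + b) v}) ∩
          {ω | dirSum (pathVertices (-L - 1 - a) (-L - 1) (-L - 1 - a) u ∪
            pathVertices L (L + 1 + b) (L + 1 + b) v) jumpSign ω = (-(2 * L + 1) : ℤ) • firstVec d}) ∪
      ((⋃ t ∈ Finset.Icc L (2 * L + 2), ⋃ (b : ℕ) (v : List ℕ), (window d m L ∩
          {ω | InTree ω (L + 1 + b) v}) ∩
          {ω | dirSum (pathVertices L (L + 1 + b) (L + 1 + b) v) jumpSign ω =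
            (-t : ℤ) • firstVec d}) ∪
      (⋃ t ∈ Finset.Icc L (2 * L + 2), ⋃ (a : ℕ) (u : List ℕ), (window d m L ∩
          {ω | InTree ω (-L - 1 - a) u}) ∩
          {ω | dirSum (pathVertices (-L - 1 - a) (-L - 1) (-L - 1 - a) u) jumpSign ω =
            (-t : ℤ) • firstVec d}))) := by
  intro ω hω
  by_cases hpiv : IsPivotal ω 0
  · exact Or.inl hpiv
  right
  rw [isPivotal_iff] at hpiv
  push Not at hpiv
  obtain ⟨x, n, hn, n', hn', hx, hx'⟩ := hpiv
  have hL := backbone_of_mem_window hω (n := L) (by omega) le_rfl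
  have hfut : (L : ℤ) < n' → ∃ (b : ℕ) (v : List ℕ), InTree ω (L + 1 + b) v ∧
      dirSum (pathVertices L (L + 1 + b) (L + 1 + b) v) jumpSign ω = x - backbone ω L := by
    intro h
    obtain ⟨v, hv, rfl⟩ := hx'
    obtain ⟨b, hb⟩ := Int.le.dest (show (L : ℤ) + 1 ≤ n' by omega)
    subst hb
    exact ⟨b, v, hv, by rw [position_future ω (l := L) (by omega) (by omega)]; abel⟩
  have hpast : n < -L → ∃ (a : ℕ) (u : List ℕ), InTree ω (-L - 1 - a) u ∧
      dirSum (pathVertices (-L - 1 - a) (-L - 1) (-L - 1 - a) u) jumpSign ω =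
        backbone ω (-L - 1) - x := by
    intro h
    obtain ⟨u, hu, rfl⟩ := hx
    obtain ⟨a, ha⟩ := Int.le.dest (show n ≤ -L - 1 by omega)
    obtain rfl : n = -L - 1 - a := by omega
    exact ⟨a, u, hu, by rw [position_past ω (l := -L - 1) (by omega) (by omega)]; abel⟩
  rcases lt_or_ge n (-L) with hnL | hnL
  · obtain ⟨a, u, hu, hau⟩ := hpast hnL
    rcases lt_or_ge (L : ℤ) n' with hnL' | hnL'
    · left
      obtain ⟨b, v, hv, hbv⟩ := hfut hnL'
      simp only [Set.mem_iUnion]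
      refine ⟨a, b, u, v, ⟨⟨hω, hu⟩, hv⟩, ?_⟩
      have hdisj : Disjoint (pathVertices (-L - 1 - a) (-L - 1) (-L - 1 - a) u)
          (pathVertices L (L + 1 + b) (L + 1 + b) v) := by
        rw [Finset.disjoint_left]
        intro c hc hc'
        have h3 := fst_of_mem_pathVertices hc
        have h4 := fst_of_mem_pathVertices hc'
        omega
      simp only [Set.mem_ofPred_eq]
      -- The two paths meet at `x`, so the sum over both telescopes to `α(-L - 1) - α(L)`, the full
      -- length of the window.
      simp only [dirSum] at hau hbv ⊢
      rw [Finset.sum_union hdisj, hau, hbv, hL, neg_smul,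
        show (L : ℤ) + L + 1 = 2 * L + 1 by ring]
      abel
    · right; right
      obtain ⟨t, rfl, -, ht⟩ := mem_branch_of_mem_window hω (n := n') (by omega) hnL' hx'
      obtain ⟨s, rfl⟩ := Int.eq_ofNat_of_zero_le (show 0 ≤ t by have := ht (by omega); omega)
      simp only [Set.mem_iUnion]
      refine ⟨s, ?_, a, u, ⟨hω, hu⟩, ?_⟩
      · have := ht (by omega)
        rw [Finset.mem_Icc]
        omega
      · simp only [Set.mem_ofPred_eq]
        rw [hau, neg_smul]
        simp
  · obtain ⟨t, rfl, ht, -⟩ := mem_branch_of_mem_window hω hnL (by omega) hx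
    have ht := ht hn
    rcases lt_or_ge (L : ℤ) n' with hnL' | hnL'
    · right; left
      obtain ⟨b, v, hv, hbv⟩ := hfut hnL'
      -- Here `x - α(L) = (t - (2L + 1)) e₁` with `0 ≤ t ≤ L + 1`, so `s = 2L + 1 - t` is at least
      -- `L`: the future path must come back across half of the window.
      obtain ⟨s, hs⟩ := Int.eq_ofNat_of_zero_le (show 0 ≤ 2 * L + 1 - t by omega)
      simp only [Set.mem_iUnion]
      refine ⟨s, ?_, b, v, ⟨hω, hv⟩, ?_⟩
      · rw [Finset.mem_Icc]
        omega
      · simp only [Set.mem_ofPred_eq]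
        rw [hbv, hL, ← hs, add_sub_add_left_eq_sub, ← sub_smul]
        congr 1
        ring
    · obtain ⟨t', h', -, ht'⟩ := mem_branch_of_mem_window hω (n := n') (by omega) hnL' hx'
      have := congrFun h' 0
      simp only [Pi.add_apply, Pi.smul_apply, firstVec_zero, smul_eq_mul, mul_one] at this
      have := ht' (by omega)
      omega

end Geometry

end BRW

namespace BRW

/-! ### Probability of the window event -/

section WindowMeasure

variable {d : ℕ} [NeZero d] (p : PMF ℕ) (hp : ∑' k : ℕ, (k : ℝ≥0∞) * p k = 1)

omit [NeZero d] in
lemma measurableSet_eval_eq (u : List ℕ) (c : ℕ × Direction d) :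
    MeasurableSet {η : List ℕ → ℕ × Direction d | η u = c} :=
  (measurable_pi_apply u : Measurable fun η : List ℕ → ℕ × Direction d => η u)
    (measurableSet_singleton c)

lemma measurableSet_windowTree (m : ℕ) (b : Bool) : MeasurableSet (windowTree d m b) := by
  have : windowTree d m b = {η | η [] = (m, (0, true))} ∩
      ⋂ i, ⋂ _ : i < m, {η | η [i] = (0, (0, b))} := by
    ext; simp [windowTree]
  rw [this]
  exact (measurableSet_eval_eq _ _).inter
    (.iInter fun i => .iInter fun _ => measurableSet_eval_eq _ _)

lemma measurableSet_window (m : ℕ) (l : ℤ) : MeasurableSet (window d m l) :=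
  .pi (Finset.countable_toSet _) fun _ _ => measurableSet_windowTree _ _

omit [NeZero d] in
lemma setOf_inTree_eq (n : ℤ) (u : List ℕ) : {ω : Sample d | InTree ω n u} =
    {ω | ω n ∈ {η : List ℕ → ℕ × Direction d | InTree (fun _ => η) 0 u}} := by
  ext ω
  exact inTree_iff_const ω n u

lemma law_pi_inter_inTree {s : Finset ℤ} {n : ℤ} (hn : n ∉ s)
    {t : ℤ → Set (List ℕ → ℕ × Direction d)} (ht : ∀ k, MeasurableSet (t k)) (u : List ℕ) :
    law d p hp (Set.pi (s : Set ℤ) t ∩ {ω | InTree ω n u}) =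
      law d p hp (Set.pi (s : Set ℤ) t) * treeWeight d p hp u := by
  rw [setOf_inTree_eq, law_eq, infinitePi_pi_inter_eval_mem _ hn ht (measurableSet_inTree_const u)]
  rfl

lemma law_window_inter_inTree {m : ℕ} {l n : ℤ} (hn : n ∉ Finset.Icc (-l) l) (u : List ℕ) :
    law d p hp (window d m l ∩ {ω | InTree ω n u}) =
      law d p hp (window d m l) * treeWeight d p hp u :=
  law_pi_inter_inTree p hp hn (fun _ => measurableSet_windowTree _ _) u

lemma law_window_inter_inTree_inter_inTree {m : ℕ} {l n n' : ℤ} (hn : n ∉ Finset.Icc (-l) l)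
    (hn' : n' ∉ Finset.Icc (-l) l) (hne : n' ≠ n) (u v : List ℕ) :
    law d p hp (window d m l ∩ {ω | InTree ω n u} ∩ {ω | InTree ω n' v}) =
      law d p hp (window d m l) * (treeWeight d p hp u * treeWeight d p hp v) := by
  rw [← mul_assoc, ← law_window_inter_inTree p hp hn, window, setOf_inTree_eq n u,
    pi_inter_eval_mem hn]
  refine law_pi_inter_inTree p hp ?_ (measurableSet_update (fun _ => measurableSet_windowTree _ _)
    (measurableSet_inTree_const u)) v
  rw [Finset.mem_insert]
  tauto

lemma setDir_mem_window {m : ℕ} {l : ℤ} {a : ℤ × List ℕ} (ha : a.1 ∉ Finset.Icc (-l) l)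
    (ω : Sample d) (e : Direction d) : setDir ω a e ∈ window d m l ↔ ω ∈ window d m l := by
  refine forall₂_congr fun n hn => ?_
  rw [setDir_of_fst_ne]
  rintro rfl
  exact ha hn

omit [NeZero d] in
lemma setDir_mem_inTree (a : ℤ × List ℕ) (n : ℤ) (u : List ℕ) (ω : Sample d) (e : Direction d) :
    setDir ω a e ∈ {ω : Sample d | InTree ω n u} ↔ ω ∈ {ω : Sample d | InTree ω n u} :=
  inTree_setDir ω a e n u

/-- The value `0` may be impossible for `Z̃ - 1` (for instance if `Z` is `0` or `2`). This is why
the window uses trees with `m` leaves, for any possible value `m`, rather than trivial trees. -/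
lemma exists_childrenLaw_nil_ne_zero : ∃ m, childrenLaw p hp [] m ≠ 0 :=
  (childrenLaw p hp []).support_nonempty

-- If `p 0 = 0`, then `p k ≤ k * p k` for all `k`, while both sides sum to `1`. Equality must hold
-- throughout, which leaves no mass on `k ≥ 2`.
include hp in
lemma apply_zero_ne_zero (h1 : p 1 ≠ 1) : p 0 ≠ 0 := by
  intro h0
  have hle : ∀ k : ℕ, p k ≤ (k : ℝ≥0∞) * p k := by
    intro k
    rcases Nat.eq_zero_or_pos k with rfl | hk
    · simp [h0]
    · exact le_mul_of_one_le_left' (by exact_mod_cast hk)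
  have hsum : ∑' k : ℕ, ((k : ℝ≥0∞) * p k - p k) = 0 := by
    rw [ENNReal.tsum_sub (by rw [p.tsum_coe]; simp) hle, hp, p.tsum_coe, tsub_self]
  rw [ENNReal.tsum_eq_zero] at hsum
  apply h1
  have hk : ∀ k, k ≠ 1 → p k = 0 := by
    intro k hk1
    by_contra hpk
    have hk0 : k ≠ 0 := by rintro rfl; exact hpk h0
    have hk2 : (2 : ℝ≥0∞) ≤ k := by exact_mod_cast (by omega : 2 ≤ k)
    have := tsub_eq_zero_iff_le.1 (hsum k)
    have h3 : (2 : ℝ≥0∞) * p k ≤ p k := le_trans (by gcongr) this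
    have htop := p.apply_ne_top k
    have h4 := ENNReal.toReal_mono htop h3
    rw [ENNReal.toReal_mul] at h4
    have h5 := ENNReal.toReal_pos hpk htop
    norm_num at h4
    linarith
  rw [← p.tsum_coe, tsum_eq_single 1 hk]

lemma vertexLaw_singleton (u : List ℕ) (c : ℕ) (e : Direction d) :
    vertexLaw d p hp u {(c, e)} = childrenLaw p hp u c * (Fintype.card (Direction d) : ℝ≥0∞)⁻¹ := by
  rw [vertexLaw, ← Set.singleton_prod_singleton, Measure.prod_prod,
    PMF.toMeasure_apply_singleton _ _ (measurableSet_singleton _),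
    PMF.toMeasure_apply_singleton _ _ (measurableSet_singleton _), PMF.uniformOfFintype_apply]

lemma treeLaw_windowTree_ne_zero (h1 : p 1 ≠ 1) {m : ℕ} (hm : childrenLaw p hp [] m ≠ 0)
    (b : Bool) : treeLaw d p hp (windowTree d m b) ≠ 0 := by
  have hbox : windowTree d m b =
      Set.pi ((insert [] ((Finset.range m).image fun i => [i]) : Finset (List ℕ)) : Set (List ℕ))
        (fun u => if u = [] then {(m, ((0 : Fin d), true))} else {(0, ((0 : Fin d), b))}) := by
    ext η
    simp [windowTree, Set.pi]
  rw [hbox, treeLaw, Measure.infinitePi_pi _ fun u _ => by split_ifs <;> simp,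
    Finset.prod_ne_zero_iff]
  have hcard : (Fintype.card (Direction d) : ℝ≥0∞)⁻¹ ≠ 0 :=
    ENNReal.inv_ne_zero.2 (ENNReal.natCast_ne_top _)
  intro u hu
  split_ifs with h
  · subst h
    rw [vertexLaw_singleton]
    exact mul_ne_zero hm hcard
  · rw [vertexLaw_singleton]
    refine mul_ne_zero ?_ hcard
    cases u with
    | nil => exact absurd rfl h
    | cons i u => exact apply_zero_ne_zero p hp h1

lemma law_window_ne_zero (h1 : p 1 ≠ 1) {m : ℕ} (hm : childrenLaw p hp [] m ≠ 0) (l : ℤ) :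
    law d p hp (window d m l) ≠ 0 := by
  rw [window, law_eq, Measure.infinitePi_pi _ fun _ _ => measurableSet_windowTree _ _,
    Finset.prod_ne_zero_iff]
  exact fun n _ => treeLaw_windowTree_ne_zero p hp h1 hm _

end WindowMeasure

/-! ### Splitting the heat kernel bound into summable factors -/

section Bounds

/-- A summable weight. -/
noncomputable def decay (k : ℕ) : ℝ≥0∞ := ENNReal.ofReal (((k : ℝ) + 1) ^ (-(9 / 8) : ℝ))

lemma tsum_decay_ne_top : ∑' k, decay k ≠ ∞ := by
  have h : Summable fun k : ℕ => ((k : ℝ) + 1) ^ (-(9 / 8) : ℝ) := by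
    have := (summable_nat_add_iff 1).2 (Real.summable_nat_rpow (p := -(9 / 8)).2 (by norm_num))
    simpa using this
  exact h.tsum_ofReal_ne_top

lemma rpow_le_rpow_of_le {a n : ℕ} (h : a ≤ n) :
    ((n : ℝ) + 1) ^ (-(9 / 8) : ℝ) ≤ ((a : ℝ) + 1) ^ (-(9 / 8) : ℝ) := by
  have : (a : ℝ) ≤ n := by exact_mod_cast h
  exact Real.rpow_le_rpow_of_nonpos (by positivity) (by linarith) (by norm_num)

lemma rpow_succ_le_inv {L n : ℕ} (hL : 0 < L) (h : L ≤ n) : ((n : ℝ) + 1)⁻¹ ≤ (L : ℝ)⁻¹ := by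
  have : (L : ℝ) ≤ n := by exact_mod_cast h
  have : (0 : ℝ) < L := by exact_mod_cast hL
  gcongr
  linarith

variable {d : ℕ} [NeZero d]

/-- A walk needs at least `L` steps to cover the distance `L`; this is the source of the negative
powers of `L` below. -/
lemma le_of_heatKernel_ne_zero {L N : ℕ} {t : ℤ} (ht : (L : ℤ) ≤ |t|)
    (h : heatKernel N (t • firstVec d) ≠ 0) : L ≤ N := by
  by_contra hlt
  refine h (heatKernel_eq_zero (i := 0) ?_)
  simp only [Pi.smul_apply, firstVec_zero, smul_eq_mul, mul_one]
  omega

/-- The exponent splits as `11 / 2 = 1 + 4 * (9 / 8)`: four summable weights, for two backbone times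
and two generations, and one power spent on `1 / L`. -/
lemma ofReal_heatKernel_le_four {C : ℝ} (hC0 : 0 ≤ C)
    (hC : ∀ n (x : Fin d → ℤ), heatKernel n x ≤ C * ((n : ℝ) + 1) ^ (-(11 / 2) : ℝ))
    {L N a b k l : ℕ} {t : ℤ} (hL : 0 < L) (ht : (L : ℤ) ≤ |t|) (ha : a ≤ N) (hb : b ≤ N)
    (hk : k ≤ N) (hl : l ≤ N) : ENNReal.ofReal (heatKernel N (t • firstVec d)) ≤
      ENNReal.ofReal (C / L) * (decay a * decay b * decay k * decay l) := by
  by_cases h0 : heatKernel N (t • firstVec d) = 0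
  · rw [h0, ENNReal.ofReal_zero]; exact zero_le
  have hLN := le_of_heatKernel_ne_zero ht h0
  simp only [decay]
  rw [← ENNReal.ofReal_mul (by positivity), ← ENNReal.ofReal_mul (by positivity),
    ← ENNReal.ofReal_mul (by positivity), ← ENNReal.ofReal_mul (by positivity)]
  refine ENNReal.ofReal_le_ofReal ((hC _ _).trans ?_)
  have hN : (0 : ℝ) < (N : ℝ) + 1 := by positivity
  have hsplit : ((N : ℝ) + 1) ^ (-(11 / 2) : ℝ) = ((N : ℝ) + 1)⁻¹ *
      (((N : ℝ) + 1) ^ (-(9 / 8) : ℝ) * ((N : ℝ) + 1) ^ (-(9 / 8) : ℝ) *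
        ((N : ℝ) + 1) ^ (-(9 / 8) : ℝ) * ((N : ℝ) + 1) ^ (-(9 / 8) : ℝ)) := by
    rw [← Real.rpow_neg_one, ← Real.rpow_add hN, ← Real.rpow_add hN, ← Real.rpow_add hN,
      ← Real.rpow_add hN]
    norm_num
  rw [hsplit, div_eq_mul_inv C, mul_assoc C]
  have h1 := rpow_succ_le_inv hL hLN
  have h2 := rpow_le_rpow_of_le ha
  have h3 := rpow_le_rpow_of_le hb
  have h4 := rpow_le_rpow_of_le hk
  have h5 := rpow_le_rpow_of_le hl
  gcongr

/-- With only two weights to pay for, `17 / 4 = 2 + 2 * (9 / 8) ≤ 11 / 2` leaves two powers of `L`,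
one of which will pay for the `L + 3` possible target sites on the line. -/
lemma ofReal_heatKernel_le_two {C : ℝ} (hC0 : 0 ≤ C)
    (hC : ∀ n (x : Fin d → ℤ), heatKernel n x ≤ C * ((n : ℝ) + 1) ^ (-(11 / 2) : ℝ))
    {L N a k : ℕ} {t : ℤ} (hL : 0 < L) (ht : (L : ℤ) ≤ |t|) (ha : a ≤ N)
    (hk : k ≤ N) : ENNReal.ofReal (heatKernel N (t • firstVec d)) ≤
      ENNReal.ofReal (C / (L * L)) * (decay a * decay k) := by
  by_cases h0 : heatKernel N (t • firstVec d) = 0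
  · rw [h0, ENNReal.ofReal_zero]; exact zero_le
  have hLN := le_of_heatKernel_ne_zero ht h0
  simp only [decay]
  rw [← ENNReal.ofReal_mul (by positivity), ← ENNReal.ofReal_mul (by positivity)]
  refine ENNReal.ofReal_le_ofReal ((hC _ _).trans ?_)
  have hN : (0 : ℝ) < (N : ℝ) + 1 := by positivity
  have hsplit : ((N : ℝ) + 1) ^ (-(17 / 4) : ℝ) = (((N : ℝ) + 1)⁻¹ * ((N : ℝ) + 1)⁻¹) *
      (((N : ℝ) + 1) ^ (-(9 / 8) : ℝ) * ((N : ℝ) + 1) ^ (-(9 / 8) : ℝ)) := by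
    rw [← Real.rpow_neg_one, ← Real.rpow_add hN, ← Real.rpow_add hN, ← Real.rpow_add hN]
    norm_num
  have hle : ((N : ℝ) + 1) ^ (-(11 / 2) : ℝ) ≤ ((N : ℝ) + 1) ^ (-(17 / 4) : ℝ) :=
    Real.rpow_le_rpow_of_exponent_le (by have : (0 : ℝ) ≤ N := by positivity
                                         linarith) (by norm_num)
  refine (mul_le_mul_of_nonneg_left hle hC0).trans ?_
  rw [hsplit, div_eq_mul_inv C, mul_inv, mul_assoc C]
  have h1 := rpow_succ_le_inv hL hLN
  have h2 := rpow_le_rpow_of_le ha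
  have h3 := rpow_le_rpow_of_le hk
  gcongr

end Bounds

end BRW

namespace BRW

/-! ### Positivity of the probability that `0` is pivotal -/

section Positivity

variable {d : ℕ} [NeZero d] (p : PMF ℕ) (hp : ∑' k : ℕ, (k : ℝ≥0∞) * p k = 1)

lemma measure_iUnion₂_le_tsum {Ω : Type*} [MeasurableSpace Ω] (μ : Measure Ω) {ι κ : Type*}
    [Countable ι] [Countable κ] (s : ι → κ → Set Ω) :
    μ (⋃ (i) (j), s i j) ≤ ∑' (i) (j), μ (s i j) :=
  (measure_iUnion_le _).trans (ENNReal.tsum_le_tsum fun _ => measure_iUnion_le _)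

lemma notMem_Icc_of_mem_future {L b : ℕ} {v : List ℕ} {a : ℤ × List ℕ}
    (h : a ∈ pathVertices L (L + 1 + b) (L + 1 + b) v) : a.1 ∉ Finset.Icc (-(L : ℤ)) L := by
  have := fst_of_mem_pathVertices h
  rw [Finset.mem_Icc]
  omega

lemma notMem_Icc_of_mem_past {L a : ℕ} {u : List ℕ} {c : ℤ × List ℕ}
    (h : c ∈ pathVertices (-L - 1 - a) (-L - 1) (-L - 1 - a) u) :
    c.1 ∉ Finset.Icc (-(L : ℤ)) L := by
  have := fst_of_mem_pathVertices h
  rw [Finset.mem_Icc]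
  omega

lemma card_future (L b : ℕ) (v : List ℕ) :
    (pathVertices L (L + 1 + b) (L + 1 + b) v).card = b + 1 + v.length := by
  rw [card_pathVertices]
  omega

lemma card_past (L a : ℕ) (u : List ℕ) :
    (pathVertices (-L - 1 - a) (-L - 1) (-L - 1 - a) u).card = a + u.length := by
  rw [card_pathVertices]
  omega

lemma law_window_inter_inTree_inter_dirSum {m L : ℕ} {n : ℤ} (hn : n ∉ Finset.Icc (-(L : ℤ)) L)
    (u : List ℕ) {J : Finset (ℤ × List ℕ)} (hJ : ∀ a ∈ J, a.1 ∉ Finset.Icc (-(L : ℤ)) L)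
    (x : Fin d → ℤ) :
    law d p hp ((window d m L ∩ {ω | InTree ω n u}) ∩ {ω | dirSum J jumpSign ω = x}) =
      law d p hp (window d m L) * treeWeight d p hp u * ENNReal.ofReal (heatKernel J.card x) := by
  rw [law_inter_dirSum_eq p hp ((measurableSet_window m L).inter (measurableSet_inTree n u)) J
    jumpSign_eq, law_window_inter_inTree p hp hn]
  intro a ha ω e
  rw [Set.mem_inter_iff, Set.mem_inter_iff, setDir_mem_window (hJ a ha), setDir_mem_inTree]

lemma law_window_inter_two_inTree_inter_dirSum {m L : ℕ} {n n' : ℤ} (hn : n ∉ Finset.Icc (-(L : ℤ)) L)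
    (hn' : n' ∉ Finset.Icc (-(L : ℤ)) L) (hne : n' ≠ n)
    (u v : List ℕ) {J : Finset (ℤ × List ℕ)} (hJ : ∀ a ∈ J, a.1 ∉ Finset.Icc (-(L : ℤ)) L)
    (x : Fin d → ℤ) :
    law d p hp ((window d m L ∩ {ω | InTree ω n u} ∩ {ω | InTree ω n' v}) ∩
      {ω | dirSum J jumpSign ω = x}) =
      law d p hp (window d m L) * (treeWeight d p hp u * treeWeight d p hp v) *
        ENNReal.ofReal (heatKernel J.card x) := by
  rw [law_inter_dirSum_eq p hp (((measurableSet_window m L).inter (measurableSet_inTree n u)).inter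
    (measurableSet_inTree n' v)) J jumpSign_eq,
    law_window_inter_inTree_inter_inTree p hp hn hn' hne]
  intro a ha ω e
  rw [Set.mem_inter_iff, Set.mem_inter_iff, Set.mem_inter_iff, Set.mem_inter_iff,
    setDir_mem_window (hJ a ha), setDir_mem_inTree, setDir_mem_inTree]

/-- The expected decay of the generation over the vertices of a hanging tree. -/
noncomputable def treeDecay (d : ℕ) [NeZero d] (p : PMF ℕ)
    (hp : ∑' k : ℕ, (k : ℝ≥0∞) * p k = 1) : ℝ≥0∞ :=
  ∑' u : List ℕ, treeWeight d p hp u * decay u.length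

lemma treeDecay_ne_top (hsq : ∑' k : ℕ, (k : ℝ≥0∞) ^ 2 * p k < ∞) : treeDecay d p hp ≠ ∞ :=
  ne_top_of_le_ne_top (ENNReal.mul_ne_top (ENNReal.add_ne_top.2 ⟨by simp, hsq.ne⟩)
    tsum_decay_ne_top) (tsum_treeWeight_mul_le p hp decay)

variable {C : ℝ} (hC0 : 0 ≤ C)
  (hC : ∀ n (x : Fin d → ℤ), heatKernel n x ≤ C * ((n : ℝ) + 1) ^ (-(11 / 2) : ℝ))

include hC0 hC

/-- The window, the two tree membership events and the jumps along the path involve separate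
coordinates, so each term factorises exactly, and the number of jumps dominates both times and both
generations. -/
lemma law_double_le (m : ℕ) {L : ℕ} (hL : 0 < L) :
    law d p hp (⋃ (a : ℕ) (b : ℕ) (u : List ℕ) (v : List ℕ), (window d m L ∩
          {ω | InTree ω (-L - 1 - a) u} ∩ {ω | InTree ω (L + 1 + b) v}) ∩
          {ω | dirSum (pathVertices (-L - 1 - a) (-L - 1) (-L - 1 - a) u ∪
            pathVertices L (L + 1 + b) (L + 1 + b) v) jumpSign ω =
              (-(2 * L + 1) : ℤ) • firstVec d}) ≤
      law d p hp (window d m L) * ENNReal.ofReal (C / L) *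
        ((∑' k, decay k) * (∑' k, decay k) * (treeDecay d p hp * treeDecay d p hp)) := by
  calc _ ≤ ∑' (a : ℕ) (b : ℕ) (u : List ℕ) (v : List ℕ),
      law d p hp (window d m L) * ENNReal.ofReal (C / L) * (decay a * (decay b *
        ((treeWeight d p hp u * decay u.length) * (treeWeight d p hp v * decay v.length)))) := by
        refine (measure_iUnion₂_le_tsum _ _).trans (ENNReal.tsum_le_tsum fun a =>
          ENNReal.tsum_le_tsum fun b => (measure_iUnion₂_le_tsum _ _).trans
          (ENNReal.tsum_le_tsum fun u => ENNReal.tsum_le_tsum fun v => ?_))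
        set J := pathVertices (-L - 1 - a) (-L - 1) (-L - 1 - a) u ∪
            pathVertices L (L + 1 + b) (L + 1 + b) v with hJ
        have h1 : a + u.length ≤ J.card := by
          rw [← card_past L]; exact Finset.card_le_card Finset.subset_union_left
        have h2 : b + 1 + v.length ≤ J.card := by
          rw [← card_future L]; exact Finset.card_le_card Finset.subset_union_right
        rw [law_window_inter_two_inTree_inter_dirSum p hp (by rw [Finset.mem_Icc]; omega)
          (by rw [Finset.mem_Icc]; omega) (by omega)]
        · refine (mul_le_mul_right (ofReal_heatKernel_le_four hC0 hC hL (N := J.card) (a := a)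
            (b := b) (k := u.length) (l := v.length) (t := -(2 * L + 1)) ?_ (by omega)
            (by omega) (by omega) (by omega)) _).trans (le_of_eq (by ring))
          rw [abs_neg, abs_of_nonneg (by omega)]
          omega
        · intro c hc
          rcases Finset.mem_union.1 hc with hc | hc
          · exact notMem_Icc_of_mem_past hc
          · exact notMem_Icc_of_mem_future hc
    _ = _ := by
        simp only [ENNReal.tsum_mul_left, ENNReal.tsum_mul_right, treeDecay]
        ring

lemma law_future_le (m : ℕ) {L : ℕ} (hL : 0 < L) :
    law d p hp (⋃ t ∈ Finset.Icc L (2 * L + 2), ⋃ (b : ℕ) (v : List ℕ), (window d m L ∩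
          {ω | InTree ω (L + 1 + b) v}) ∩
          {ω | dirSum (pathVertices L (L + 1 + b) (L + 1 + b) v) jumpSign ω =
            (-t : ℤ) • firstVec d}) ≤
      (L + 3 : ℕ) * (law d p hp (window d m L) * ENNReal.ofReal (C / (L * L)) *
        ((∑' k, decay k) * treeDecay d p hp)) := by
  refine (measure_biUnion_finset_le _ _).trans ?_
  refine (Finset.sum_le_card_nsmul _ _ (law d p hp (window d m L) * ENNReal.ofReal (C / (L * L)) *
        ((∑' k, decay k) * treeDecay d p hp)) fun t ht => ?_).trans (le_of_eq ?_)
  · rw [Finset.mem_Icc] at ht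
    calc _ ≤ ∑' (b : ℕ) (v : List ℕ),
      law d p hp (window d m L) * ENNReal.ofReal (C / (L * L)) * (decay b *
        (treeWeight d p hp v * decay v.length)) := by
          refine (measure_iUnion₂_le_tsum _ _).trans (ENNReal.tsum_le_tsum fun b =>
            ENNReal.tsum_le_tsum fun v => ?_)
          have h2 := card_future L b v
          rw [law_window_inter_inTree_inter_dirSum p hp (by rw [Finset.mem_Icc]; omega) _
            fun _ hc => notMem_Icc_of_mem_future hc]
          refine (mul_le_mul_right (ofReal_heatKernel_le_two hC0 hC hL (a := b)
            (k := v.length) (t := -t) ?_ (by omega) (by omega)) _).trans (le_of_eq (by ring))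
          rw [abs_neg, abs_of_nonneg (by omega)]
          omega
      _ = _ := by
        simp only [ENNReal.tsum_mul_left, ENNReal.tsum_mul_right, treeDecay]
  · rw [Nat.card_Icc, nsmul_eq_mul]
    congr 2
    omega

lemma law_past_le (m : ℕ) {L : ℕ} (hL : 0 < L) :
    law d p hp (⋃ t ∈ Finset.Icc L (2 * L + 2), ⋃ (a : ℕ) (u : List ℕ), (window d m L ∩
          {ω | InTree ω (-L - 1 - a) u}) ∩
          {ω | dirSum (pathVertices (-L - 1 - a) (-L - 1) (-L - 1 - a) u) jumpSign ω =
            (-t : ℤ) • firstVec d}) ≤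
      (L + 3 : ℕ) * (law d p hp (window d m L) * ENNReal.ofReal (C / (L * L)) *
        ((∑' k, decay k) * treeDecay d p hp)) := by
  refine (measure_biUnion_finset_le _ _).trans ?_
  refine (Finset.sum_le_card_nsmul _ _ (law d p hp (window d m L) * ENNReal.ofReal (C / (L * L)) *
        ((∑' k, decay k) * treeDecay d p hp)) fun t ht => ?_).trans (le_of_eq ?_)
  · rw [Finset.mem_Icc] at ht
    calc _ ≤ ∑' (b : ℕ) (v : List ℕ),
      law d p hp (window d m L) * ENNReal.ofReal (C / (L * L)) * (decay b *
        (treeWeight d p hp v * decay v.length)) := by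
          refine (measure_iUnion₂_le_tsum _ _).trans (ENNReal.tsum_le_tsum fun b =>
            ENNReal.tsum_le_tsum fun v => ?_)
          have h2 := card_past L b v
          rw [law_window_inter_inTree_inter_dirSum p hp (by rw [Finset.mem_Icc]; omega) _
            fun _ hc => notMem_Icc_of_mem_past hc]
          refine (mul_le_mul_right (ofReal_heatKernel_le_two hC0 hC hL (a := b)
            (k := v.length) (t := -t) ?_ (by omega) (by omega)) _).trans (le_of_eq (by ring))
          rw [abs_neg, abs_of_nonneg (by omega)]
          omega
      _ = _ := by
        simp only [ENNReal.tsum_mul_left, ENNReal.tsum_mul_right, treeDecay]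
  · rw [Nat.card_Icc, nsmul_eq_mul]
    congr 2
    omega

omit hC in
lemma natCast_mul_ofReal_le {L : ℕ} (hL : 0 < L) :
    ((L + 3 : ℕ) : ℝ≥0∞) * ENNReal.ofReal (C / (L * L)) ≤ 4 * ENNReal.ofReal (C / L) := by
  rw [← ENNReal.ofReal_natCast, ← ENNReal.ofReal_mul (by positivity),
    show (4 : ℝ≥0∞) = ENNReal.ofReal 4 by simp, ← ENNReal.ofReal_mul (by norm_num)]
  refine ENNReal.ofReal_le_ofReal ?_
  have h1 : (1 : ℝ) ≤ L := by exact_mod_cast hL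
  have h2 : (0 : ℝ) < L := by linarith
  have h3 : ((L + 3 : ℕ) : ℝ) ≤ 4 * L := by push_cast; linarith
  calc ((L + 3 : ℕ) : ℝ) * (C / (L * L)) ≤ 4 * L * (C / (L * L)) := by gcongr
    _ = 4 * (C / L) := by field_simp

/-- Every error term carries the factor `law d p hp (window d m L)`. The bound is thus a conditional
one, and it does not matter that the window itself may be exponentially unlikely in `L`. -/
lemma law_window_le (m : ℕ) {L : ℕ} (hL : 0 < L) :
    law d p hp (window d m L) ≤ law d p hp {ω | IsPivotal ω 0} +
      law d p hp (window d m L) * (ENNReal.ofReal (C / L) *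
        ((∑' k, decay k) * (∑' k, decay k) * (treeDecay d p hp * treeDecay d p hp) +
          8 * ((∑' k, decay k) * treeDecay d p hp))) := by
  refine (measure_mono window_subset).trans ((measure_union_le _ _).trans ?_)
  refine add_le_add le_rfl ((measure_union_le _ _).trans ((add_le_add
    (law_double_le p hp hC0 hC m hL) ((measure_union_le _ _).trans (add_le_add
      (law_future_le p hp hC0 hC m hL) (law_past_le p hp hC0 hC m hL)))).trans ?_))
  have key := natCast_mul_ofReal_le hC0 hL
  set w := law d p hp (window d m L)
  set A := (∑' k, decay k) * treeDecay d p hp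
  calc _ = w * ENNReal.ofReal (C / L) * ((∑' k, decay k) * (∑' k, decay k) *
        (treeDecay d p hp * treeDecay d p hp)) +
        2 * (w * A) * (((L + 3 : ℕ) : ℝ≥0∞) * ENNReal.ofReal (C / (L * L))) := by ring
    _ ≤ w * ENNReal.ofReal (C / L) * ((∑' k, decay k) * (∑' k, decay k) *
        (treeDecay d p hp * treeDecay d p hp)) +
        2 * (w * A) * (4 * ENNReal.ofReal (C / L)) := by gcongr
    _ = _ := by ring

omit hC0 hC

/-- In dimension at least `11`, the origin is pivotal with positive probability. -/
theorem law_isPivotal_pos (hd : 10 < d) (h1 : p 1 ≠ 1)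
    (hsq : ∑' k : ℕ, (k : ℝ≥0∞) ^ 2 * p k < ∞) : 0 < law d p hp {ω | IsPivotal ω 0} := by
  obtain ⟨C, hC0, hC⟩ := exists_heatKernel_le hd
  obtain ⟨m, hm⟩ := exists_childrenLaw_nil_ne_zero p hp
  set K := (∑' k, decay k) * (∑' k, decay k) * (treeDecay d p hp * treeDecay d p hp) +
          8 * ((∑' k, decay k) * treeDecay d p hp) with hK
  have hKtop : K ≠ ∞ := by
    have h1 := tsum_decay_ne_top
    have h2 := treeDecay_ne_top (d := d) p hp hsq
    rw [hK]
    finiteness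
  have hlim : Tendsto (fun L : ℕ => ENNReal.ofReal (C / L) * K) atTop (𝓝 0) := by
    have h1 : Tendsto (fun L : ℕ => ENNReal.ofReal (C / L)) atTop (𝓝 0) := by
      have := ENNReal.tendsto_ofReal (tendsto_const_div_atTop_nhds_zero_nat C)
      simpa using this
    have := ENNReal.Tendsto.mul_const h1 (Or.inr hKtop)
    simpa using this
  -- The number of leaves `m` and the constant `K` do not depend on `L`, so `L` can be taken large
  -- enough for the conditional failure probability to be below `1`.
  obtain ⟨L, hL1, hL⟩ := ((hlim.eventually (gt_mem_nhds zero_lt_one)).and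
    (eventually_gt_atTop 0)).exists
  have hle := law_window_le p hp hC0 hC m hL
  have hw := law_window_ne_zero (d := d) p hp h1 hm L
  rw [pos_iff_ne_zero]
  intro h0
  rw [h0, zero_add] at hle
  have hlt : law d p hp (window d m L) * (ENNReal.ofReal (C / L) * K) <
      law d p hp (window d m L) * 1 :=
    ENNReal.mul_lt_mul_right hw (measure_ne_top _ _) hL1
  rw [mul_one] at hlt
  exact hle.not_gt hlt

end Positivity

end BRW

namespace BRW

/-! ### Kac's formula and the law of large numbers -/

section Stationarity

variable {d : ℕ}

lemma isPivotal_iterate_shift (k : ℕ) (ω : Sample d) (i : ℤ) :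
    IsPivotal (shift^[k] ω) i ↔ IsPivotal ω (i + k) := by
  induction k generalizing ω with
  | zero => simp
  | succ k ih =>
    rw [Function.iterate_succ_apply, ih, isPivotal_shift]
    push_cast
    rw [add_assoc]

lemma IsPivotalMetric.iterate_shift {D : Sample d → ℤ → ℤ → ℝ} (hD : IsPivotalMetric D) (k : ℕ)
    (ω : Sample d) (i j : ℤ) : D (BRW.shift^[k] ω) i j = D ω (i + k) (j + k) := by
  induction k generalizing ω with
  | zero => simp
  | succ k ih =>
    rw [Function.iterate_succ_apply, ih, hD.shift]
    push_cast
    rw [add_assoc, add_assoc]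

/-- There is a pivotal point at a positive time. -/
def HasFuturePivotal (ω : Sample d) : Prop := ∃ n : ℕ, 0 < n ∧ IsPivotal ω n

lemma HasFuturePivotal.spec {ω : Sample d} (h : HasFuturePivotal ω) :
    0 < firstPivotal ω ∧ IsPivotal ω (firstPivotal ω) :=
  Nat.sInf_mem (s := {n : ℕ | 0 < n ∧ IsPivotal ω n}) h

lemma firstPivotal_le {ω : Sample d} {n : ℕ} (hn : 0 < n) (h : IsPivotal ω n) :
    firstPivotal ω ≤ n :=
  Nat.sInf_le (s := {n : ℕ | 0 < n ∧ IsPivotal ω n}) ⟨hn, h⟩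

lemma firstPivotal_eq_one {ω : Sample d} (h : IsPivotal ω 1) : firstPivotal ω = 1 := by
  have h' : IsPivotal ω (1 : ℕ) := by simpa using h
  refine le_antisymm (firstPivotal_le one_pos h') ?_
  exact (HasFuturePivotal.spec ⟨1, one_pos, h'⟩).1

lemma firstPivotal_eq_succ {ω : Sample d} (h : ¬ IsPivotal ω 1) (hω : HasFuturePivotal ω)
    (hω' : HasFuturePivotal (shift ω)) : firstPivotal ω = firstPivotal (shift ω) + 1 := by
  obtain ⟨h1, h2⟩ := hω.spec
  obtain ⟨h3, h4⟩ := hω'.spec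
  refine le_antisymm (firstPivotal_le (Nat.succ_pos _) ?_) ?_
  · rw [isPivotal_shift] at h4
    exact_mod_cast h4
  · obtain ⟨k, hk⟩ := Nat.exists_eq_succ_of_ne_zero h1.ne'
    rw [hk] at h2 ⊢
    have hk0 : 0 < k := by
      rcases Nat.eq_zero_or_pos k with rfl | hk0
      · exact absurd (by simpa using h2) h
      · exact hk0
    refine Nat.succ_le_succ (firstPivotal_le hk0 ?_)
    rw [isPivotal_shift]
    exact_mod_cast h2

/-- The contribution of the origin to a pivotal metric. -/
noncomputable def pivotalGap (D : Sample d → ℤ → ℤ → ℝ) : Sample d → ℝ :=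
  {ω | IsPivotal ω 0}.indicator fun ω => D ω 0 (firstPivotal ω)

lemma IsPivotalMetric.measurable_firstPivotal {D : Sample d → ℤ → ℤ → ℝ}
    (hD : IsPivotalMetric D) : Measurable fun ω => D ω 0 (firstPivotal ω) := by
  have h := measurable_from_prod_countable_left (α := Sample d) (β := ℕ)
    (f := fun p => D p.1 0 p.2) fun n => hD.measurable 0 n
  exact h.comp (measurable_id.prodMk BRW.measurable_firstPivotal)

lemma IsPivotalMetric.measurable_pivotalGap {D : Sample d → ℤ → ℤ → ℝ}
    (hD : IsPivotalMetric D) : Measurable (pivotalGap D) :=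
  hD.measurable_firstPivotal.indicator (measurableSet_isPivotal 0)

lemma IsPivotalMetric.self {D : Sample d → ℤ → ℤ → ℝ} (hD : IsPivotalMetric D) (ω : Sample d)
    (i : ℤ) : D ω i i = 0 :=
  le_antisymm (by simpa using hD.le_abs ω i i) (hD.nonneg ω i i)

/-- The first pivotal time after time `n`. -/
noncomputable def nextPivotal (ω : Sample d) (n : ℕ) : ℕ := n + firstPivotal (shift^[n] ω)

/-- The ergodic sums of the gaps telescope. -/
lemma IsPivotalMetric.birkhoffSum_pivotalGap {D : Sample d → ℤ → ℤ → ℝ} (hD : IsPivotalMetric D)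
    {ω : Sample d} (hω : ∀ k : ℕ, HasFuturePivotal (BRW.shift^[k] ω)) (n : ℕ) :
    birkhoffSum BRW.shift (pivotalGap D) n (BRW.shift ω) = D ω (firstPivotal ω) (nextPivotal ω n) := by
  induction n with
  | zero => simp [nextPivotal, hD.self]
  | succ n ih =>
    rw [birkhoffSum_succ, ih, ← Function.iterate_succ_apply]
    -- If `n + 1` is pivotal, it is the end of the current stretch, and additivity at this cut point
    -- appends the gap that starts there. Otherwise the summand is zero and the next pivotal time is
    -- unchanged.
    by_cases hpiv : IsPivotal ω (n + 1)
    · have h0 : IsPivotal (BRW.shift^[n + 1] ω) 0 := by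
        rw [isPivotal_iterate_shift]; push_cast; simpa using hpiv
      have h1 : nextPivotal ω n = n + 1 := by
        rw [nextPivotal, firstPivotal_eq_one]
        rw [isPivotal_iterate_shift, add_comm]
        exact hpiv
      rw [pivotalGap, Set.indicator_of_mem (show _ ∈ {ω : Sample d | IsPivotal ω 0} from h0),
        hD.iterate_shift, h1, nextPivotal]
      have h2 : firstPivotal ω ≤ n + 1 := firstPivotal_le (Nat.succ_pos n) (by exact_mod_cast hpiv)
      have h3 := hD.add_le ω (firstPivotal ω) ((n + 1 : ℕ) : ℤ)
        ((n + 1 + firstPivotal (BRW.shift^[n + 1] ω) : ℕ) : ℤ) (by exact_mod_cast hpiv)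
        (by exact_mod_cast h2) (by exact_mod_cast Nat.le_add_right _ _)
      have h4 := hD.triangle ω (firstPivotal ω) ((n + 1 : ℕ) : ℤ)
        ((n + 1 + firstPivotal (BRW.shift^[n + 1] ω) : ℕ) : ℤ)
      rw [zero_add, add_comm ((firstPivotal (BRW.shift^[n + 1] ω) : ℕ) : ℤ), ← Nat.cast_add]
      exact le_antisymm h3 h4
    · have h0 : ¬ IsPivotal (BRW.shift^[n + 1] ω) 0 := by
        rw [isPivotal_iterate_shift]; push_cast; simpa using hpiv
      have h1 : nextPivotal ω (n + 1) = nextPivotal ω n := by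
        have e := Function.iterate_succ_apply' BRW.shift n ω
        have h2 : ¬ IsPivotal (BRW.shift^[n] ω) 1 := by
          rwa [isPivotal_iterate_shift, add_comm]
        rw [nextPivotal, nextPivotal, firstPivotal_eq_succ h2 (hω n) (e ▸ hω (n + 1)), ← e]
        ring
      rw [pivotalGap, Set.indicator_of_notMem (s := {ω : Sample d | IsPivotal ω 0}) h0, h1, add_zero]

variable [NeZero d] (p : PMF ℕ) (hp : ∑' k : ℕ, (k : ℝ≥0∞) * p k = 1)

lemma ergodic_law : Ergodic shift (law d p hp) := ergodic_shift (treeLaw d p hp)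

omit [NeZero d] in
lemma measurableSet_hasFuturePivotal : MeasurableSet {ω : Sample d | HasFuturePivotal ω} := by
  have : {ω : Sample d | HasFuturePivotal ω} =
      ⋃ n : ℕ, ⋃ _ : 0 < n, {ω : Sample d | IsPivotal ω n} := by
    ext; simp [HasFuturePivotal]
  rw [this]
  exact .iUnion fun n => .iUnion fun _ => measurableSet_isPivotal n

/-- A pivotal time in the future of the shifted sample is one in the future of the original, so by
ergodicity the event has probability `0` or `1`; it contains the event that `1` is pivotal. -/
lemma ae_hasFuturePivotal (hpos : 0 < law d p hp {ω | IsPivotal ω 0}) :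
    ∀ᵐ ω ∂law d p hp, HasFuturePivotal ω := by
  have hsub : shift ⁻¹' {ω : Sample d | HasFuturePivotal ω} ⊆ {ω | HasFuturePivotal ω} := by
    rintro ω ⟨n, hn, h⟩
    rw [isPivotal_shift] at h
    exact ⟨n + 1, Nat.succ_pos n, by exact_mod_cast h⟩
  rcases (ergodic_law p hp).ae_empty_or_univ_of_preimage_ae_le
    measurableSet_hasFuturePivotal.nullMeasurableSet hsub.eventuallyLE with h | h
  · exfalso
    have h1 : law d p hp (shift ⁻¹' {ω | IsPivotal ω 0}) ≤
        law d p hp {ω | HasFuturePivotal ω} := by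
      refine measure_mono fun ω hω => ?_
      rw [Set.mem_preimage, Set.mem_ofPred_eq, isPivotal_shift] at hω
      exact ⟨1, one_pos, by simpa using hω⟩
    rw [(ergodic_law p hp).measure_preimage (measurableSet_isPivotal 0).nullMeasurableSet,
      measure_congr h, measure_empty] at h1
    exact hpos.not_ge h1
  · exact eventuallyEq_univ.1 h

lemma ae_exists_isPivotal_neg (hpos : 0 < law d p hp {ω | IsPivotal ω 0}) :
    ∀ᵐ ω ∂law d p hp, ∃ n : ℕ, IsPivotal ω (-n) := by
  have hm : MeasurableSet {ω : Sample d | ∃ n : ℕ, IsPivotal ω (-n)} := by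
    have : {ω : Sample d | ∃ n : ℕ, IsPivotal ω (-n)} =
        ⋃ n : ℕ, {ω : Sample d | IsPivotal ω (-n)} := by ext; simp
    rw [this]
    exact .iUnion fun n => measurableSet_isPivotal _
  have hsub : {ω : Sample d | ∃ n : ℕ, IsPivotal ω (-n)} ⊆
      shift ⁻¹' {ω : Sample d | ∃ n : ℕ, IsPivotal ω (-n)} := by
    rintro ω ⟨n, h⟩
    refine ⟨n + 1, ?_⟩
    rw [isPivotal_shift]
    push_cast
    simpa using h
  rcases (ergodic_law p hp).ae_empty_or_univ_of_ae_le_preimage hm.nullMeasurableSet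
    hsub.eventuallyLE with h | h
  · exfalso
    have h1 : law d p hp {ω | IsPivotal ω 0} ≤
        law d p hp {ω | ∃ n : ℕ, IsPivotal ω (-n)} :=
      measure_mono fun ω hω => ⟨0, by simpa using hω⟩
    rw [measure_congr h, measure_empty] at h1
    exact hpos.not_ge h1
  · exact eventuallyEq_univ.1 h

/-- The event that the last pivotal time before `0` is `-m`. -/
def lastPivotalEvent (d m : ℕ) : Set (Sample d) :=
  {ω | IsPivotal ω (-m)} ∩ ⋂ j : ℕ, ⋂ _ : j < m, {ω | IsPivotal ω (-j)}ᶜ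

omit [NeZero d] in
lemma measurableSet_lastPivotalEvent (m : ℕ) : MeasurableSet (lastPivotalEvent d m) :=
  (measurableSet_isPivotal _).inter
    (.iInter fun _ => .iInter fun _ => (measurableSet_isPivotal _).compl)

/-- Almost surely there is a pivotal time `≤ 0`, and the events record which one is the last. -/
lemma tsum_law_lastPivotalEvent (hpos : 0 < law d p hp {ω | IsPivotal ω 0}) :
    ∑' m, law d p hp (lastPivotalEvent d m) = 1 := by
  rw [← measure_iUnion ?_ measurableSet_lastPivotalEvent]
  · rw [prob_compl_eq_zero_iff (.iUnion measurableSet_lastPivotalEvent) |>.1]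
    change ∀ᵐ ω ∂law d p hp, ω ∈ ⋃ m, lastPivotalEvent d m
    filter_upwards [ae_exists_isPivotal_neg p hp hpos] with ω hω
    classical
    rw [Set.mem_iUnion]
    refine ⟨Nat.find hω, Nat.find_spec hω, ?_⟩
    simp only [Set.mem_iInter]
    exact fun j hj => Nat.find_min hω hj
  · have key : ∀ m m' : ℕ, m < m' → Disjoint (lastPivotalEvent d m) (lastPivotalEvent d m') := by
      intro m m' hlt
      refine Set.disjoint_left.2 fun ω h h' => ?_
      have := Set.mem_iInter₂.1 h'.2 m hlt
      exact this h.1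
    intro m m' hne
    rcases hne.lt_or_gt with h | h
    · exact key m m' h
    · exact (key m' m h).symm

/-- Viewed from time `m`, "`0` is pivotal and none of `1, …, m` is" says that `-m` is the last
pivotal time up to `0`. The events agree only almost surely, because `firstPivotal` is `0` by
default when no positive time is pivotal. -/
lemma law_inter_lt_firstPivotal (hpos : 0 < law d p hp {ω | IsPivotal ω 0}) (m : ℕ) :
    law d p hp ({ω | IsPivotal ω 0} ∩ {ω | m < firstPivotal ω}) =
      law d p hp (lastPivotalEvent d m) := by
  rw [← ((ergodic_law p hp).toMeasurePreserving.iterate m).measure_preimage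
    (measurableSet_lastPivotalEvent m).nullMeasurableSet]
  refine measure_congr ?_
  filter_upwards [ae_hasFuturePivotal p hp hpos] with ω hω
  have key : ω ∈ ({ω | IsPivotal ω 0} ∩ {ω | m < firstPivotal ω} : Set (Sample d)) ↔
      ω ∈ shift^[m] ⁻¹' lastPivotalEvent d m := by
    simp only [lastPivotalEvent, Set.preimage_inter, Set.preimage_iInter, Set.mem_inter_iff,
      Set.mem_iInter, Set.mem_preimage, Set.mem_compl_iff, Set.mem_ofPred_eq,
      isPivotal_iterate_shift, neg_add_cancel]
    refine and_congr_right fun _ => ⟨fun h j hj hpiv => ?_, fun h => ?_⟩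
    · have := firstPivotal_le (ω := ω) (n := m - j) (by omega) (by
        rw [Nat.cast_sub hj.le]
        convert hpiv using 1
        ring)
      omega
    · by_contra hle
      obtain ⟨h1, h2⟩ := hω.spec
      refine h (m - firstPivotal ω) (by omega) ?_
      rw [Nat.cast_sub (by omega)]
      convert h2 using 1
      ring
  exact propext key

/-- Kac's formula. -/
theorem lintegral_firstPivotal (hpos : 0 < law d p hp {ω | IsPivotal ω 0}) :
    ∫⁻ ω in {ω | IsPivotal ω 0}, (firstPivotal ω : ℝ≥0∞) ∂law d p hp = 1 := by
  have hm : ∀ m : ℕ, MeasurableSet {ω : Sample d | m < firstPivotal ω} := fun m =>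
    measurableSet_lt measurable_const measurable_firstPivotal
  have h1 : ∀ ω : Sample d, (firstPivotal ω : ℝ≥0∞) =
      ∑' m : ℕ, {ω : Sample d | m < firstPivotal ω}.indicator (1 : Sample d → ℝ≥0∞) ω := by
    intro ω
    rw [tsum_eq_sum (s := Finset.range (firstPivotal ω))]
    · rw [Finset.sum_congr rfl fun m hm => Set.indicator_of_mem
        (show ω ∈ {ω : Sample d | m < firstPivotal ω} from Finset.mem_range.1 hm) _]
      simp
    · intro m hm
      exact Set.indicator_of_notMem (s := {ω : Sample d | m < firstPivotal ω})
        (fun h => hm (Finset.mem_range.2 h)) (1 : Sample d → ℝ≥0∞)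
  simp_rw [h1]
  rw [lintegral_tsum fun m => (measurable_one.indicator (hm m)).aemeasurable,
    ← tsum_law_lastPivotalEvent p hp hpos]
  refine tsum_congr fun m => ?_
  rw [lintegral_indicator_one (hm m), Measure.restrict_apply (hm m), Set.inter_comm,
    law_inter_lt_firstPivotal p hp hpos]

lemma integrableOn_firstPivotal (hpos : 0 < law d p hp {ω | IsPivotal ω 0}) :
    IntegrableOn (fun ω => (firstPivotal ω : ℝ)) {ω | IsPivotal ω 0} (law d p hp) := by
  refine ⟨(measurable_from_top.comp measurable_firstPivotal).aestronglyMeasurable, ?_⟩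
  rw [HasFiniteIntegral]
  have : ∀ ω : Sample d, ‖(firstPivotal ω : ℝ)‖ₑ = (firstPivotal ω : ℝ≥0∞) := fun ω => by
    rw [Real.enorm_natCast]
  simp_rw [this]
  rw [lintegral_firstPivotal p hp hpos]
  exact ENNReal.one_lt_top

lemma integral_firstPivotal (hpos : 0 < law d p hp {ω | IsPivotal ω 0}) :
    ∫ ω in {ω | IsPivotal ω 0}, (firstPivotal ω : ℝ) ∂law d p hp = 1 := by
  rw [integral_eq_lintegral_of_nonneg_ae (Eventually.of_forall fun ω => Nat.cast_nonneg _)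
    (integrableOn_firstPivotal p hp hpos).aestronglyMeasurable]
  simp_rw [ENNReal.ofReal_natCast]
  rw [lintegral_firstPivotal p hp hpos, ENNReal.toReal_one]

variable {D : Sample d → ℤ → ℤ → ℝ}

omit [NeZero d] in
lemma IsPivotalMetric.le_firstPivotal (hD : IsPivotalMetric D) (ω : Sample d) :
    D ω 0 (firstPivotal ω) ≤ firstPivotal ω := by
  simpa using hD.le_abs ω 0 (firstPivotal ω)

lemma IsPivotalMetric.integrableOn (hD : IsPivotalMetric D)
    (hpos : 0 < law d p hp {ω | IsPivotal ω 0}) :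
    IntegrableOn (fun ω => D ω 0 (firstPivotal ω)) {ω | IsPivotal ω 0} (law d p hp) :=
  (integrableOn_firstPivotal p hp hpos).mono' hD.measurable_firstPivotal.aestronglyMeasurable
    (Eventually.of_forall fun ω => by
      rw [Real.norm_of_nonneg (hD.nonneg _ _ _)]; exact hD.le_firstPivotal ω)

lemma IsPivotalMetric.integrable_pivotalGap (hD : IsPivotalMetric D)
    (hpos : 0 < law d p hp {ω | IsPivotal ω 0}) : Integrable (pivotalGap D) (law d p hp) :=
  (hD.integrableOn p hp hpos).integrable_indicator (measurableSet_isPivotal 0)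

lemma integral_pivotalGap :
    ∫ ω, pivotalGap D ω ∂law d p hp =
      ∫ ω in {ω | IsPivotal ω 0}, D ω 0 (firstPivotal ω) ∂law d p hp :=
  integral_indicator (measurableSet_isPivotal 0)

lemma IsPivotalMetric.integrable_pivotalLaw (hD : IsPivotalMetric D)
    (hpos : 0 < law d p hp {ω | IsPivotal ω 0}) :
    Integrable (fun ω => D ω 0 (firstPivotal ω)) (pivotalLaw d p hp) :=
  (hD.integrableOn p hp hpos).smul_measure (ENNReal.inv_ne_top.2 hpos.ne')

/-- The normalisation of the conditional law cancels, and by Kac's formula the remaining denominator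
is `1`. -/
lemma integral_pivotalLaw_div (hpos : 0 < law d p hp {ω | IsPivotal ω 0}) (f : Sample d → ℝ) :
    (∫ ω, f ω ∂pivotalLaw d p hp) / ∫ ω, (firstPivotal ω : ℝ) ∂pivotalLaw d p hp =
      ∫ ω in {ω | IsPivotal ω 0}, f ω ∂law d p hp := by
  have hc : ((law d p hp {ω | IsPivotal ω 0})⁻¹).toReal ≠ 0 :=
    (ENNReal.toReal_pos (ENNReal.inv_ne_zero.2 (measure_ne_top _ _))
      (ENNReal.inv_ne_top.2 hpos.ne')).ne'
  rw [pivotalLaw, ProbabilityTheory.cond, integral_smul_measure, integral_smul_measure,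
    integral_firstPivotal p hp hpos]
  simp only [smul_eq_mul, mul_one]
  rw [mul_div_cancel_left₀ _ hc]

/-- The ergodic averages of the gaps, along the positive times. -/
lemma IsPivotalMetric.ae_tendsto_nextPivotal (hD : IsPivotalMetric D)
    (hpos : 0 < law d p hp {ω | IsPivotal ω 0}) :
    ∀ᵐ ω ∂law d p hp, Tendsto (fun n : ℕ => D ω (firstPivotal ω) (nextPivotal ω n) / n) atTop
      (𝓝 (∫ ω in {ω | IsPivotal ω 0}, D ω 0 (firstPivotal ω) ∂law d p hp)) := by
  have h0 : ∀ᵐ ω ∂law d p hp, Tendsto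
      (fun n : ℕ => birkhoffSum BRW.shift (pivotalGap D) n ω / n) atTop
      (𝓝 (∫ ω, pivotalGap D ω ∂law d p hp)) :=
    ae_tendsto_birkhoffSum_div (ergodic_law p hp) (hD.integrable_pivotalGap p hp hpos)
      hD.measurable_pivotalGap
  -- The sums start from the shifted sample so as to run over the times `1, …, n`, among which the
  -- first pivotal one is `γ₁`.
  have h1 : ∀ᵐ ω ∂law d p hp, Tendsto
      (fun n : ℕ => birkhoffSum BRW.shift (pivotalGap D) n (BRW.shift ω) / n) atTop
      (𝓝 (∫ ω, pivotalGap D ω ∂law d p hp)) :=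
    (ergodic_law p hp).toMeasurePreserving.quasiMeasurePreserving.ae h0
  have h2 : ∀ᵐ ω ∂law d p hp, ∀ k : ℕ, HasFuturePivotal (BRW.shift^[k] ω) := ae_all_iff.2 fun k =>
    ((ergodic_law p hp).toMeasurePreserving.iterate k).quasiMeasurePreserving.ae
      (ae_hasFuturePivotal p hp hpos)
  filter_upwards [h1, h2] with ω h1 h2
  rw [integral_pivotalGap] at h1
  exact h1.congr fun n => by rw [hD.birkhoffSum_pivotalGap h2]

/-- The law of large numbers for pivotal metrics. -/
theorem IsPivotalMetric.ae_tendsto (hD : IsPivotalMetric D)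
    (hpos : 0 < law d p hp {ω | IsPivotal ω 0}) :
    ∀ᵐ ω ∂law d p hp, Tendsto (fun n : ℕ => D ω 0 n / n) atTop
      (𝓝 (∫ ω in {ω | IsPivotal ω 0}, D ω 0 (firstPivotal ω) ∂law d p hp)) := by
  have habs := isPivotalMetric_abs_sub.ae_tendsto_nextPivotal p hp hpos
  have hone : ∫ ω in {ω : Sample d | IsPivotal ω 0}, |((0 : ℤ) : ℝ) - ((firstPivotal ω : ℤ) : ℝ)|
      ∂law d p hp = 1 := by
    simpa using integral_firstPivotal p hp hpos
  rw [hone] at habs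
  filter_upwards [habs, hD.ae_tendsto_nextPivotal p hp hpos, ae_hasFuturePivotal p hp hpos]
    with ω h1 h2 hω
  set a := firstPivotal ω with ha
  -- Write `N` for the first pivotal time after `n`. Changing the endpoints from `(a, N)` to `(0,
  -- n)` costs at most `a + (N - n)`, and `N ≤ |a - N| + a`. The bracket tends to `0` by the law of
  -- large numbers for the time metric.
  set err : ℕ → ℝ := fun n => 2 * a / n + (|((a : ℤ) : ℝ) - ((nextPivotal ω n : ℤ) : ℝ)| / n - 1)
    with herr
  have herr0 : Tendsto err atTop (𝓝 0) := by
    have := (tendsto_const_div_atTop_nhds_zero_nat (2 * a : ℝ)).add (h1.sub_const 1)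
    simpa [herr] using this
  have hbound : ∀ᶠ n : ℕ in atTop,
      |D ω 0 n / n - D ω a (nextPivotal ω n) / n| ≤ err n := by
    filter_upwards [eventually_gt_atTop 0] with n hn
    have hn' : (0 : ℝ) < n := by exact_mod_cast hn
    have hnext : n ≤ nextPivotal ω n := Nat.le_add_right _ _
    have hnext' : (n : ℝ) ≤ nextPivotal ω n := by exact_mod_cast hnext
    have e1 := hD.triangle ω 0 a n
    have e2 := hD.triangle ω a (nextPivotal ω n) n
    have e3 := hD.triangle ω a 0 (nextPivotal ω n)
    have e4 := hD.triangle ω 0 n (nextPivotal ω n)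
    have b1 := hD.le_abs ω 0 a
    have b2 := hD.le_abs ω a 0
    have b3 := hD.le_abs ω (nextPivotal ω n) n
    have b4 := hD.le_abs ω n (nextPivotal ω n)
    simp only [Int.cast_zero, Int.cast_natCast, zero_sub, sub_zero, abs_neg, Nat.abs_cast] at b1 b2 b3 b4
    rw [abs_of_nonneg (by linarith)] at b3
    rw [abs_of_nonpos (by linarith)] at b4
    have habs' : (nextPivotal ω n : ℝ) - a ≤ |((a : ℤ) : ℝ) - ((nextPivotal ω n : ℤ) : ℝ)| := by
      rw [abs_sub_comm]
      simpa using le_abs_self ((nextPivotal ω n : ℝ) - a)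
    have hval : err n = (2 * a + (|((a : ℤ) : ℝ) - ((nextPivotal ω n : ℤ) : ℝ)| - n)) / n := by
      rw [herr]
      field_simp
    rw [hval, ← sub_div, abs_div, abs_of_pos hn']
    gcongr
    rw [abs_le]
    constructor <;> linarith
  have hdiff : Tendsto (fun n : ℕ => D ω 0 n / n - D ω a (nextPivotal ω n) / n) atTop (𝓝 0) :=
    squeeze_zero_norm' (by simpa only [Real.norm_eq_abs] using hbound) herr0
  simpa using hdiff.add h2

end Stationarity

end BRW

/-! ### Conclusion for the effective resistance and the graph distance -/

theorem lemma4p9 (d : ℕ) [NeZero d] (hd : 10 < d)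
    (p : PMF ℕ)
    (hmean : ∑' k : ℕ, (k : ℝ≥0∞) * p k = 1)
    (hnontrivial : p 1 ≠ 1)
    (hsq : ∑' k : ℕ, (k : ℝ≥0∞) ^ 2 * p k < ∞) :
    -- the constants `ρ₁` and `ρ₂` are well defined
    (0 < BRW.law d p hmean {ω | BRW.IsPivotal ω 0} ∧
      (∀ᵐ ω ∂BRW.law d p hmean, ∃ n : ℕ, 0 < n ∧ BRW.IsPivotal ω n) ∧
      Integrable (fun ω => (BRW.firstPivotal ω : ℝ)) (BRW.pivotalLaw d p hmean) ∧
      Integrable (fun ω => BRW.resistance ω (BRW.firstPivotal ω)) (BRW.pivotalLaw d p hmean) ∧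
      Integrable (fun ω => BRW.distance ω (BRW.firstPivotal ω)) (BRW.pivotalLaw d p hmean)) ∧
    -- the two laws of large numbers
    (∀ᵐ ω ∂BRW.law d p hmean,
      Tendsto (fun n : ℕ => BRW.resistance ω n / n) atTop (𝓝 (BRW.rho₁ d p hmean))) ∧
    (∀ᵐ ω ∂BRW.law d p hmean,
      Tendsto (fun n : ℕ => BRW.distance ω n / n) atTop (𝓝 (BRW.rho₂ d p hmean))) := by
  have hpos := BRW.law_isPivotal_pos p hmean hd hnontrivial hsq
  have hR : ∀ (ω : BRW.Sample d) (n : ℕ), BRW.resistance ω n = (BRW.effectiveResistance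
      (BRW.trace ω) (BRW.backbone ω (0 : ℤ)) (BRW.backbone ω (n : ℤ))).toReal := fun ω n => by
    rw [BRW.resistance, BRW.backbone_zero]
  have hdist : ∀ (ω : BRW.Sample d) (n : ℕ), BRW.distance ω n =
      ((BRW.trace ω).dist (BRW.backbone ω (0 : ℤ)) (BRW.backbone ω (n : ℤ)) : ℝ) := fun ω n => by
    rw [BRW.distance, BRW.backbone_zero]
  refine ⟨⟨hpos, BRW.ae_hasFuturePivotal p hmean hpos, ?_, ?_, ?_⟩, ?_, ?_⟩
  · exact (BRW.integrableOn_firstPivotal p hmean hpos).smul_measure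
      (ENNReal.inv_ne_top.2 hpos.ne')
  · simp_rw [hR]
    exact BRW.isPivotalMetric_effectiveResistance.integrable_pivotalLaw p hmean hpos
  · simp_rw [hdist]
    exact BRW.isPivotalMetric_dist.integrable_pivotalLaw p hmean hpos
  · simp_rw [BRW.rho₁, BRW.integral_pivotalLaw_div p hmean hpos, hR]
    exact BRW.isPivotalMetric_effectiveResistance.ae_tendsto p hmean hpos
  · simp_rw [BRW.rho₂, BRW.integral_pivotalLaw_div p hmean hpos, hdist]
    exact BRW.isPivotalMetric_dist.ae_tendsto p hmean hpos
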